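/- **Notation.** Let $\tau$ lie in the upper half-plane $\mathbb H$, $q=e^{2\pi i\tau}$, and $\theta(\xi,\tau)=\sum_{\nu\in\mathbb Z+1/2}(-1)^{\nu-1/2}e^{\pi i\nu^2\tau+2\pi i\nu\xi}$. Define $f_n$ by $$\frac{\theta'(0,\tau)\,\theta(\xi+\alpha,\tau)}{\theta(\xi,\tau)\,\theta(\alpha,\tau)}=\sum_{n\ge 0}f_n(\xi,\tau)(2\pi i\alpha)^{n-1},$$ and $\omega_n(\xi,\tau)=\sum_{k=0}^n\frac{1}{k!}\big(\tfrac{\Im\xi}{\Im\tau}\big)^kf_{n-k}(\xi,\tau)$. *A-elliptic multiple zeta values.* $A(n_1,\dots,n_r;\tau)$ is the regularized value of the iterated integral of $\omega_{n_1}(t_1,\tau)\cdots\omega_{n_r}(t_r,\tau)$ over $1\ge t_1\ge\dots\ge t_r\ge 0$: the integral over $1-\epsilon\ge t_1\ge\dots\ge t_r\ge\epsilon$ is, up to $O(\epsilon^\nu)$ for some $\nu>0$ as $\epsilon\to0^+$, a polynomial of degree at most $r$ in $\log(-2\pi i\epsilon)$ (principal branch), and $A$ is its constant term. Put $A_{n,r}(\tau)=A(n,0,\dots,0;\tau)$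 with $r-1$ zeros, let $A^\infty_{n,r}$ be the constant term of the $q$-expansion of $A_{n,r}$, and let $$\mathcal A(X,Y;\tau)=\sum_{n\ge0,\,r\ge1}\frac{A_{n,r}(\tau)}{(2\pi i)^{r-1}}X^{n-1}Y^{r-1},\qquad \mathcal A^\infty_{+}(X,Y)=\sum_{n\ge1,\,r\ge1}\frac{A^\infty_{n,r}}{(2\pi i)^{r-1}}X^{n-1}Y^{r-1}.$$ *Regularized integrals.* If $g(\tau)=g^\infty(\tau)+g^0(\tau)$ with $g^\infty$ a polynomial in $\tau$ and $g^0$ exponentially small towards $i\infty$, put $\int_\tau^{\vec 1_\infty}g(z)\,dz=\int_\tau^{i\infty}g^0(z)\,dz-\int_0^\tau g^\infty(z)\,dz$. *Iterated Eisenstein integrals.* Let $\mathbb G_k=(2\pi i)^{1-k}G_k$ with $G_0=-1$, $G_1=0$ and $G_k(\tau)=\sum_{(m,n)\ne(0,0)}(m\tau+n)^{-k}$ for $k\geq 2$ (Eisenstein summation for $k=2$). Define recursively $\Gamma(\emptyset;\tau)=1$, $\Gamma(n_1,\dots,n_r;\tau)=\int_\tau^{\vec1_\infty}\mathbb G_{n_1}(z)\,\Gamma(n_2,\dots,n_r;z)\,dz$,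 put $\Gamma^L_{n,k}(\tau)=\Gamma(0,\dots,0,n;\tau)$ with $k-1$ zeros, and $$\mathcal E(X,Y;\tau)=\sum_{n,k\ge1}\frac{(-1)^{n-1}}{(2\pi i)^{k-1}}\frac{(n+k-1)!}{(n-1)!}\Gamma^L_{n+k,k}(\tau)X^{n-1}Y^{k-1},\qquad \mathcal E^*=\mathcal E-\mathcal E(0,0;\tau).$$ *Cocycles.* For $m\ge4$ let $E_m(\tau)=-\frac{B_m}{2m}+\frac{1+(-1)^m}{2}\sum_{k\ge1}\sigma_{m-1}(k)q^k$, with $B_m$ the Bernoulli numbers, and $$[\underline E_m](X,Y;\tau)=(2\pi i)^{m-1}\int_\tau^{\vec1_\infty}(X-zY)^{m-2}E_m(z)\,dz .$$ For $\gamma=\begin{pmatrix}a&b\\c&d\end{pmatrix}\in \mathrm{SL}_2(\mathbb Z)$ let $P|_\gamma(X,Y)=P(aX+bY,cX+dY)$, and let $\mathcal C_\gamma(a_{E_m})=[\underline E_m](X,Y;\tau_0)-[\underline E_m](X,Y;\gamma\tau_0)|_\gamma$ with $\tau_0=i$; put $\mathcal P_\gamma=\sum_{m\ge4}\mathcal C_\gamma(a_{E_m})$.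 *Operators.* $\mathcal L_{X,Y}$ divides the coefficient of $X^iY^j$ by $(i+j)!$; $\exp(\Lambda)=\sum_{k\ge0}\Lambda^k/k!$; and $\log\eta(\tau)=\frac{\pi i\tau}{12}+\sum_{n\ge1}\log(1-q^n)$ is the standard branch of the logarithm of the Dedekind eta function. **Theorem.** The regularized values defining $A_{n,r}(\tau)$ exist for all $n\geq 0$, $r\geq 1$, and $A_{n,r}(\tau)$ is the sum of its $q$-expansion. For all $m\ge 4$ and $\gamma\in\mathrm{SL}_2(\mathbb Z)$, $[\underline E_m](\tau)=\mathcal C_\gamma(a_{E_m})+[\underline E_m](\gamma\tau)|_\gamma$ for every $\tau\in\mathbb H$. Moreover, for every $\gamma=\begin{pmatrix}a&b\\c&d\end{pmatrix}\in\mathrm{SL}_2(\mathbb Z)$ and $\tau\in\mathbb H$, writing $(X',Y')=(dX+bY,\;cX+aY)$, $$\begin{aligned}\mathcal A(X,Y;\gamma\tau)={}&\frac{2\pi i\,(e^Y-1)}{XY}+\exp\Big(-(\gamma\tau)Y\frac{\partial}{\partial X}\Big)\mathcal A^\infty_+(X,Y)+2(e^Y-1)\log\eta(\gamma\tau)\\&+(e^Y-1)\exp\Big(-(\gamma\tau)Y\frac{\partial}{\partial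 X}\Big)\exp\Big(\tau Y'\frac{\partial}{\partial X'}\Big)\mathcal E^*(X',Y';\tau)\\&-2(e^Y-1)\exp\Big(-(\gamma\tau)Y\frac{\partial}{\partial X}\Big)\mathcal L_{X',Y'}\mathcal P_\gamma\Big(\frac{X'}{2\pi i},\frac{-Y'}{2\pi i}\Big).\end{aligned}$$ Here the operators in $X',Y'$ are applied to formal power series in the independent variables $X',Y'$, then $X'=dX+bY$, $Y'=cX+aY$ is substituted, and then $\exp(-(\gamma\tau)Y\partial/\partial X)$ is applied. The identity holds in $\mathbb C[[Y]]((X))$. -/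

import Mathlib

open Filter Topology Asymptotics MeasureTheory UpperHalfPlane

noncomputable section

namespace EllipticMZV

/-! ### The Kronecker function and the functions `f_n`, `ω_n` -/

/-- The odd Jacobi theta function `∑_{ν ∈ ℤ + 1/2} (-1)^{ν - 1/2} q^{ν²/2} u^ν`, with
`q = exp (2πiτ)`, `u = exp (2πiξ)` and `ν = n + 1/2`. -/
def theta (ξ : ℂ) (τ : ℍ) : ℂ :=
  ∑' n : ℤ, (-1 : ℂ) ^ n *
    Complex.exp (2 * Real.pi * Complex.I *
      (((n : ℂ) + 1 / 2) ^ 2 / 2 * (τ : ℂ) + ((n : ℂ) + 1 / 2) * ξ))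

/-- The Kronecker function `F(ξ, α, τ) = θ'(0, τ) θ(ξ + α, τ) / (θ(ξ, τ) θ(α, τ))`. -/
def kronecker (ξ α : ℂ) (τ : ℍ) : ℂ :=
  deriv (fun x => theta x τ) 0 * theta (ξ + α) τ / (theta ξ τ * theta α τ)

/-- The function `α ↦ 2πi α F(ξ, α, τ)`, with its removable singularity at `α = 0` removed:
`dslope θ 0 α` is `θ(α)/α` for `α ≠ 0` and `θ'(0)` for `α = 0`. -/
def kroneckerReg (ξ : ℂ) (τ : ℍ) (α : ℂ) : ℂ :=
  2 * Real.pi * Complex.I * (deriv (fun x => theta x τ) 0 * theta (ξ + α) τ) /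
    (theta ξ τ * dslope (fun x => theta x τ) 0 α)

/-- `f_n(ξ, τ)`, the coefficient of `(2πiα)^{n-1}` in the Laurent expansion of `F(ξ, α, τ)`
at `α = 0`, i.e. the coefficient of `(2πiα)^n` in the Taylor expansion of `2πi α F(ξ, α, τ)`. -/
def kroneckerCoeff (n : ℕ) (ξ : ℂ) (τ : ℍ) : ℂ :=
  iteratedDeriv n (kroneckerReg ξ τ) 0 / ((n.factorial : ℂ) * (2 * Real.pi * Complex.I) ^ n)

/-- `ω_n(ξ, τ) = ∑_{k ≤ n} r_τ(ξ)^k / k! f_{n-k}(ξ, τ)` with `r_τ(ξ) = Im ξ / Im τ`. -/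
def omega (n : ℕ) (ξ : ℂ) (τ : ℍ) : ℂ :=
  ∑ k ∈ Finset.range (n + 1),
    ((ξ.im / τ.im : ℝ) : ℂ) ^ k / (k.factorial : ℂ) * kroneckerCoeff (n - k) ξ τ

/-! ### A-elliptic multiple zeta values -/

/-- The iterated integral
`∫_{b ≥ t_1 ≥ ⋯ ≥ t_r ≥ ε} ω_{n_1}(t_1, τ) ⋯ ω_{n_r}(t_r, τ) dt_1 ⋯ dt_r`. -/
def iterInt (τ : ℍ) (ε : ℝ) : List ℕ → ℝ → ℂ
  | [], _ => 1
  | n :: ns, b => ∫ t in ε..b, omega n (t : ℂ) τ * iterInt τ ε ns t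

/-- `a` is the regularized value of the iterated integral on `[0, 1]`: the constant term in the
expansion of the integral on `[ε, 1 - ε]` as a polynomial of degree at most `r` in
`log (-2πiε)` (principal branch), up to `O(ε^ν)` for some `ν > 0`. -/
def IsRegularizedValue (ns : List ℕ) (τ : ℍ) (a : ℂ) : Prop :=
  ∃ c : ℕ → ℂ, c 0 = a ∧ ∃ ν : ℝ, 0 < ν ∧
    (fun ε : ℝ => iterInt τ ε ns (1 - ε) -
      ∑ k ∈ Finset.range (ns.length + 1),
        c k * Complex.log (-2 * Real.pi * Complex.I * (ε : ℂ)) ^ k)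
      =O[𝓝[>] (0 : ℝ)] (fun ε : ℝ => ε ^ ν)

/-- The A-elliptic multiple zeta value `A(n_1, …, n_r; τ)`. -/
def ellipticA (ns : List ℕ) (τ : ℍ) : ℂ := Classical.epsilon (IsRegularizedValue ns τ)

/-- `A_{n,r}(τ) = A(n, 0, …, 0; τ)`, with `r - 1` zeros. -/
def depthOneA (n r : ℕ) (τ : ℍ) : ℂ := ellipticA (n :: List.replicate (r - 1) 0) τ

/-- `A^∞_{n,r}`, the constant term of the `q`-expansion of `A_{n,r}`. -/
def depthOneAInf (n r : ℕ) : ℂ := (qExpansion 1 (depthOneA n r)).coeff 0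

/-! ### Eisenstein series and regularized integrals from `τ` to the tangential base point -/

/-- The lattice sums `G_k(τ)`, with `G_0 = -1`, `G_1 = 0`, and Eisenstein summation for `k = 2`. -/
def latticeG : ℕ → ℍ → ℂ
  | 0, _ => -1
  | 1, _ => 0
  | 2, τ => EisensteinSeries.G2 τ
  | k + 3, τ => ∑' v : Fin 2 → ℤ, EisensteinSeries.eisSummand ((k : ℤ) + 3) v τ

/-- `𝔾_k(τ) = (2πi)^{1-k} G_k(τ)`. -/
def modG (k : ℕ) (τ : ℍ) : ℂ := (2 * Real.pi * Complex.I) ^ (1 - (k : ℤ)) * latticeG k τ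

/-- `E_k(τ) = -B_k/(2k) + (1 + (-1)^k)/2 ∑_{m ≥ 1} σ_{k-1}(m) q^m`. -/
def eisE (k : ℕ) (τ : ℍ) : ℂ :=
  -(bernoulli k : ℂ) / (2 * (k : ℂ)) + (1 + (-1 : ℂ) ^ k) / 2 *
    ∑' m : ℕ, (ArithmeticFunction.sigma (k - 1) (m + 1) : ℂ) *
      Complex.exp (2 * Real.pi * Complex.I * (τ : ℂ)) ^ (m + 1)

/-- `p` is the polynomial part `g^∞` of `g`: on every vertical line, `g - p` is exponentially small
towards `i∞`. -/
def IsPolyPart (g : ℍ → ℂ) (p : Polynomial ℂ) : Prop :=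
  ∀ x : ℝ, ∃ c : ℝ, 0 < c ∧
    (fun y : ℝ => g (ofComplex (x + y * Complex.I)) - p.eval (x + y * Complex.I))
      =O[atTop] (fun y : ℝ => Real.exp (-c * y))

/-- The polynomial part `g^∞` of `g`. -/
def polyPart (g : ℍ → ℂ) : Polynomial ℂ := Classical.epsilon (IsPolyPart g)

/-- The regularized integral of `g` from `τ` to the tangential base point at infinity:
`∫_τ^{i∞} (g - g^∞)(z) dz - ∫_0^τ g^∞(z) dz`. -/
def tangInt (g : ℍ → ℂ) (τ : ℍ) : ℂ :=
  Complex.I * (∫ t in Set.Ioi (0 : ℝ),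
      (g (ofComplex ((τ : ℂ) + t * Complex.I)) -
        (polyPart g).eval ((τ : ℂ) + t * Complex.I))) -
    ∫ s in (0 : ℝ)..1, (polyPart g).eval ((s : ℂ) * (τ : ℂ)) * (τ : ℂ)

/-- `Γ(n_1, …, n_r; τ)`, the iterated regularized integral of `𝔾_{n_r}(z_r)dz_r ⋯ 𝔾_{n_1}(z_1)dz_1`
from `τ` to the tangential base point (`z_1` is the variable nearest to `τ`). -/
def iterG : List ℕ → ℍ → ℂ
  | [], _ => 1
  | n :: ns, τ => tangInt (fun z => modG n z * iterG ns z) τ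

/-- `Γ^L_{n,k}(τ) = Γ(0, …, 0, n; τ)`, with `k - 1` zeros. -/
def gammaL (n k : ℕ) (τ : ℍ) : ℂ := iterG (List.replicate (k - 1) 0 ++ [n]) τ

/-- The branch `πiτ/12 + ∑_{n ≥ 1} log (1 - q^n)` of the logarithm of the Dedekind eta function. -/
def logEta (τ : ℍ) : ℂ :=
  Real.pi * Complex.I * (τ : ℂ) / 12 +
    ∑' n : ℕ, Complex.log (1 - Complex.exp (2 * Real.pi * Complex.I * (τ : ℂ)) ^ (n + 1))

/-! ### Period polynomials of Eisenstein series; the variables `X`, `Y` have index `0`, `1` -/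

/-- `[E_m](X, Y; τ) = (2πi)^{m-1} ∫_τ (X - zY)^{m-2} E_m(z) dz`, the (coefficientwise) regularized
integral from `τ` to the tangential base point. -/
def eisInt (m : ℕ) (τ : ℍ) : MvPolynomial (Fin 2) ℂ :=
  ∑ j ∈ Finset.range (m - 1),
    MvPolynomial.C ((2 * Real.pi * Complex.I) ^ (m - 1) * ((m - 2).choose j : ℂ) * (-1) ^ j *
        tangInt (fun z => (z : ℂ) ^ j * eisE m z) τ) *
      (MvPolynomial.X 0 ^ (m - 2 - j) * MvPolynomial.X 1 ^ j)

/-- The action `P|_γ (X, Y) = P(aX + bY, cX + dY)`. -/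
def polyAct (γ : Matrix.SpecialLinearGroup (Fin 2) ℤ) (P : MvPolynomial (Fin 2) ℂ) :
    MvPolynomial (Fin 2) ℂ :=
  MvPolynomial.aeval (fun i : Fin 2 =>
    MvPolynomial.C (γ i 0 : ℂ) * MvPolynomial.X 0 +
      MvPolynomial.C (γ i 1 : ℂ) * (MvPolynomial.X 1 : MvPolynomial (Fin 2) ℂ)) P

/-- The value at `γ` of the cocycle of `E_m`, i.e. `[E_m](τ) - [E_m](γτ)|_γ`, computed at the base
point `τ = i`. -/
def eisCocycle (m : ℕ) (γ : Matrix.SpecialLinearGroup (Fin 2) ℤ) : MvPolynomial (Fin 2) ℂ :=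
  eisInt m UpperHalfPlane.I - polyAct γ (eisInt m (γ • UpperHalfPlane.I))

/-! ### Operations on formal power series in `X`, `Y` -/

/-- The power series `∑_{i,j ≥ 0} c i j X^i Y^j`. -/
def series (c : ℕ → ℕ → ℂ) : MvPowerSeries (Fin 2) ℂ := fun d => c (d 0) (d 1)

/-- `𝒫_γ(X, Y) = ∑_{m ≥ 4}` of the cocycles of `E_m` at `γ` (a locally finite sum). -/
def periodSeries (γ : Matrix.SpecialLinearGroup (Fin 2) ℤ) : MvPowerSeries (Fin 2) ℂ :=
  fun d => ∑ᶠ (m : ℕ) (_ : 4 ≤ m), MvPolynomial.coeff d (eisCocycle m γ)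

/-- `K* = K - K(0)`. -/
def dropConst (K : MvPowerSeries (Fin 2) ℂ) : MvPowerSeries (Fin 2) ℂ :=
  K - MvPowerSeries.C (MvPowerSeries.constantCoeff K)

/-- The Laplace operator `ℒ_{X,Y}`: the coefficient of `X^i Y^j` is divided by `(i + j)!`. -/
def laplace (K : MvPowerSeries (Fin 2) ℂ) : MvPowerSeries (Fin 2) ℂ :=
  fun d => MvPowerSeries.coeff d K / ((d 0 + d 1).factorial : ℂ)

/-- The linear substitution `K(aX + bY, cX + dY)`. -/
def linSubst (a b c d : ℂ) (K : MvPowerSeries (Fin 2) ℂ) : MvPowerSeries (Fin 2) ℂ :=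
  MvPowerSeries.subst
    ![MvPowerSeries.C a * MvPowerSeries.X 0 + MvPowerSeries.C b * MvPowerSeries.X 1,
      MvPowerSeries.C c * MvPowerSeries.X 0 +
        MvPowerSeries.C d * (MvPowerSeries.X 1 : MvPowerSeries (Fin 2) ℂ)] K

/-- The operator `c Y ∂/∂X`. -/
def shiftOp (c : ℂ) (K : MvPowerSeries (Fin 2) ℂ) : MvPowerSeries (Fin 2) ℂ :=
  MvPowerSeries.C c * MvPowerSeries.X 1 * MvPowerSeries.pderiv ℂ 0 K

/-- `exp(Λ) = ∑_k Λ^k / k!`, a coefficientwise finite sum for `Λ = c Y ∂/∂X`. -/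
def expOp (Λ : MvPowerSeries (Fin 2) ℂ → MvPowerSeries (Fin 2) ℂ)
    (K : MvPowerSeries (Fin 2) ℂ) : MvPowerSeries (Fin 2) ℂ :=
  fun d => ∑ᶠ k : ℕ, MvPowerSeries.coeff d (Λ^[k] K) / (k.factorial : ℂ)

/-- `e^Y - 1`. -/
def expYSubOne : MvPowerSeries (Fin 2) ℂ :=
  series (fun i j => if i = 0 then 1 / (j.factorial : ℂ) else 0) - 1

/-! ### The generating series -/

/-- `ℰ(X, Y; τ) = ∑_{n,k ≥ 1} (-1)^{n-1} / (2πi)^{k-1} (n+k-1)!/(n-1)! Γ^L_{n+k,k}(τ) X^{n-1} Y^{k-1}`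
(here `i = n - 1`, `j = k - 1`). -/
def genE (τ : ℍ) : MvPowerSeries (Fin 2) ℂ :=
  series (fun i j => (-1) ^ i / (2 * Real.pi * Complex.I) ^ j *
    ((i + j + 1).factorial : ℂ) / (i.factorial : ℂ) * gammaL (i + j + 2) (j + 1) τ)

/-- `𝒜(X, Y; τ) = ∑_{n ≥ 0, r ≥ 1} A_{n,r}(τ) / (2πi)^{r-1} X^{n-1} Y^{r-1}`, in `ℂ⟦Y⟧((X))`. -/
def genA (τ : ℍ) : LaurentSeries (PowerSeries ℂ) :=
  HahnSeries.single (-1 : ℤ) (1 : PowerSeries ℂ) *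
    HahnSeries.ofPowerSeries ℤ (PowerSeries ℂ)
      (PowerSeries.mk fun n => PowerSeries.mk fun j =>
        depthOneA n (j + 1) τ / (2 * Real.pi * Complex.I) ^ j)

/-- The regular part `∑_{n ≥ 1, r ≥ 1} A^∞_{n,r} / (2πi)^{r-1} X^{n-1} Y^{r-1}` of the series of
constant terms. -/
def genAInfReg : MvPowerSeries (Fin 2) ℂ :=
  series (fun i j => depthOneAInf (i + 1) (j + 1) / (2 * Real.pi * Complex.I) ^ j)

/-- The polar part `2πi (e^Y - 1) / (XY)`, in `ℂ⟦Y⟧((X))`. -/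
def polarPart : LaurentSeries (PowerSeries ℂ) :=
  HahnSeries.single (-1 : ℤ)
    (PowerSeries.mk fun j => 2 * Real.pi * Complex.I / ((j + 1).factorial : ℂ))

/-- The inclusion of `ℂ⟦X, Y⟧` into `ℂ⟦Y⟧((X))`. -/
def toLaurent (K : MvPowerSeries (Fin 2) ℂ) : LaurentSeries (PowerSeries ℂ) :=
  HahnSeries.ofPowerSeries ℤ (PowerSeries ℂ)
    (PowerSeries.mk fun i => PowerSeries.mk fun j =>
      MvPowerSeries.coeff (Finsupp.single 0 i + Finsupp.single 1 j) K)

/-! ### The defining properties used above determine their objects -/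

theorem kroneckerReg_of_ne {ξ α : ℂ} (τ : ℍ) (hα : α ≠ 0) :
    kroneckerReg ξ τ α = 2 * Real.pi * Complex.I * α * kronecker ξ α τ := by
  have h0 : theta 0 τ = 0 := by
    have h : theta 0 τ = -theta 0 τ := by
      conv_lhs => rw [theta, ← (Equiv.subLeft (-1 : ℤ)).tsum_eq]
      rw [theta, ← tsum_neg]
      refine tsum_congr fun n => ?_
      have e1 : ((-1 : ℂ)) ^ ((Equiv.subLeft (-1 : ℤ)) n) = -(-1 : ℂ) ^ n := by
        rw [Equiv.subLeft_apply, zpow_sub₀ (by norm_num), zpow_neg_one]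
        rcases Int.even_or_odd n with h | h
        · simp [h.neg_one_zpow]
        · simp [h.neg_one_zpow]
      rw [e1, Equiv.subLeft_apply]
      push_cast
      rw [neg_mul]
      congr 3
      ring
    linear_combination h / 2
  rw [kroneckerReg, kronecker, dslope_of_ne _ hα, slope_def_field, h0]
  by_cases hz : theta α τ = 0
  · simp [hz]
  · by_cases hx : theta ξ τ = 0
    · simp [hx]
    · field_simp
      ring

theorem poly_eq_zero_of_tendsto {ι : Type*} {l : Filter ι} [l.NeBot] {z : ι → ℂ}
    (hz : Tendsto (fun i => ‖z i‖) l atTop) {p : Polynomial ℂ}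
    (h : Tendsto (fun i => p.eval (z i)) l (𝓝 0)) : p = 0 := by
  by_cases hd : 0 < p.degree
  · exact absurd h.norm (not_tendsto_nhds_of_tendsto_atTop (p.tendsto_norm_atTop hd hz) _)
  · rw [Polynomial.eq_C_of_degree_le_zero (not_lt.mp hd)] at h ⊢
    simp only [Polynomial.eval_C] at h
    simp [tendsto_nhds_unique tendsto_const_nhds h]

theorem IsPolyPart.unique {g : ℍ → ℂ} {p p' : Polynomial ℂ} (h : IsPolyPart g p)
    (h' : IsPolyPart g p') : p = p' := by
  obtain ⟨c, hc, h⟩ := h 0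
  obtain ⟨c', hc', h'⟩ := h' 0
  have ht : ∀ {a : ℝ}, 0 < a → Tendsto (fun y : ℝ => Real.exp (-a * y)) atTop (𝓝 0) :=
    fun ha => Real.tendsto_exp_atBot.comp
      (tendsto_id.const_mul_atTop_of_neg (neg_lt_zero.mpr ha))
  have := (h'.trans_tendsto (ht hc')).sub (h.trans_tendsto (ht hc))
  refine sub_eq_zero.mp (poly_eq_zero_of_tendsto (l := atTop)
    (z := fun y : ℝ => ((0 : ℝ) : ℂ) + y * Complex.I) ?_ ?_)
  · simpa using tendsto_abs_atTop_atTop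
  · simpa using this

theorem IsPolyPart.polyPart_eq {g : ℍ → ℂ} {p : Polynomial ℂ} (h : IsPolyPart g p) :
    polyPart g = p :=
  (Classical.epsilon_spec (p := IsPolyPart g) ⟨p, h⟩).unique h

theorem IsRegularizedValue.unique {ns : List ℕ} {τ : ℍ} {a a' : ℂ}
    (h : IsRegularizedValue ns τ a) (h' : IsRegularizedValue ns τ a') : a = a' := by
  obtain ⟨c, rfl, ν, hν, h⟩ := h
  obtain ⟨c', rfl, ν', hν', h'⟩ := h'
  have ht : ∀ {b : ℝ}, 0 < b → Tendsto (fun ε : ℝ => ε ^ b) (𝓝[>] 0) (𝓝 0) := fun {b} hb => by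
    have := (Real.continuousAt_rpow_const 0 b (Or.inr hb.le)).tendsto
    rw [Real.zero_rpow hb.ne'] at this
    exact this.mono_left nhdsWithin_le_nhds
  have key := (h'.trans_tendsto (ht hν')).sub (h.trans_tendsto (ht hν))
  have hz : Tendsto (fun ε : ℝ => ‖Complex.log (-2 * Real.pi * Complex.I * (ε : ℂ))‖)
      (𝓝[>] 0) atTop := by
    have h1 : Tendsto (fun ε : ℝ => |Real.log (2 * Real.pi * ε)|) (𝓝[>] 0) atTop := by
      refine tendsto_abs_atBot_atTop.comp (Real.tendsto_log_nhdsGT_zero.comp ?_)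
      refine tendsto_nhdsWithin_iff.mpr ⟨?_, ?_⟩
      · have : Tendsto (fun ε : ℝ => 2 * Real.pi * ε) (𝓝 0) (𝓝 (2 * Real.pi * 0)) :=
          tendsto_id.const_mul _
        rw [mul_zero] at this
        exact this.mono_left nhdsWithin_le_nhds
      · filter_upwards [self_mem_nhdsWithin] with ε hε
        exact mul_pos Real.two_pi_pos hε
    refine tendsto_atTop_mono' _ ?_ h1
    filter_upwards [self_mem_nhdsWithin] with ε hε
    refine le_trans (le_of_eq ?_) (Complex.abs_re_le_norm _)
    rw [Complex.log_re]
    have : (0 : ℝ) < ε := hε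
    simp [abs_of_pos Real.pi_pos, abs_of_pos this]
  have hp := poly_eq_zero_of_tendsto (l := 𝓝[>] (0 : ℝ)) hz
    (p := ∑ k ∈ Finset.range (ns.length + 1), Polynomial.C (c k - c' k) * Polynomial.X ^ k) (by
      rw [sub_zero] at key
      refine key.congr fun ε => ?_
      rw [Polynomial.eval_finsetSum, sub_sub_sub_cancel_left, ← Finset.sum_sub_distrib]
      refine Finset.sum_congr rfl fun k _ => ?_
      simp [sub_mul])
  have := congrArg (fun p => Polynomial.coeff p 0) hp
  simp only [Polynomial.finsetSum_coeff, Polynomial.coeff_C_mul, Polynomial.coeff_X_pow,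
    Polynomial.coeff_zero] at this
  rw [Finset.sum_eq_single 0 (fun k _ hk => by simp [hk.symm]) (by simp)] at this
  simpa [sub_eq_zero] using this

theorem IsRegularizedValue.ellipticA_eq {ns : List ℕ} {τ : ℍ} {a : ℂ}
    (h : IsRegularizedValue ns τ a) : ellipticA ns τ = a :=
  (Classical.epsilon_spec (p := IsRegularizedValue ns τ) ⟨a, h⟩).unique h

theorem exp_logEta (τ : ℍ) : Complex.exp (logEta τ) = ModularForm.eta (τ : ℂ) := by
  have hq : ∀ n : ℕ, Complex.exp (2 * Real.pi * Complex.I * (τ : ℂ)) ^ (n + 1) =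
      ModularForm.eta_q n (τ : ℂ) := fun n => (ModularForm.eta_q_eq_pow n _).symm
  rw [logEta, Complex.exp_add, ModularForm.eta]
  simp_rw [hq]
  congr 1
  · rw [Function.Periodic.qParam]
    congr 1
    push_cast
    ring
  · refine Complex.cexp_tsum_eq_tprod (fun n => ModularForm.one_sub_eta_q_ne_zero n τ.im_pos) ?_
    have := (ModularForm.summable_eta_q τ)
    have h2 := Complex.summable_log_one_add_of_summable (Summable.of_norm this)
    simpa [sub_eq_add_neg] using h2

end EllipticMZV

end

/-! On the real axis the correction terms of `omega` vanish, so ω_n = f_n there, and ω_0 = 2πi. The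
inner integrals of A(n,0,…,0) are therefore elementary, and A_{n,r}/(2πi)^{r-1} is the regularized
moment of f_n(t) against t^{r-1}/(r-1)!. The task is to compute these moments and to recognise their
generating series.

With z = e^{2πiξ}, |z| = 1, z ≠ 1, and w = e^{2πiα}, for α near 0 the Kronecker function equals -2πi
times z/(1-z) + 1/(1-w) + ∑_{k,m≥1} (z^m w^k - z^{-m} w^{-k}) q^{km}. This comes from multiplying
∑_k w^k/(1 - z q^k) by θ(α): the coefficients of the product satisfy the recursion that
characterises θ(ξ+α) up to a constant (`theta_mul_kernel`, `kernel_eq`, `kroneckerCoeff_ofReal`).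
Only f_1 is singular at the endpoints, and its singular part does not depend on τ; its regularized
moments are never evaluated, because they enter the constant terms A^∞ and nothing else. The double
series is integrated termwise. The moment of e^{2πimt} against t^j/j! is a combination of 1/((j-l)!
(2πim)^{l+1}) for l < j, and ∑ k^i (2πim)^{-l-1} q^{km} is the (l+1)-fold primitive of ∑
σ_{i+l+1}(n) q^n (`hasSum_lambert`, `integral_pairCoeff`).

The weights 1/(j-l)! amount to multiplication by e^Y - 1, and the primitives are the coefficients of
ℰ up to Bernoulli multiples of powers of τ. Those powers of τ are exactly what exp(-τY∂/∂X) produces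
from A^∞, and the coefficient of weight two is 2 log η. This yields `genA_eq`, the identity for
trivial γ, which is then used at the point γτ.

It remains to transform ℰ*. By Cauchy's formula for repeated integrals, Γ(0,…,0,m) is a single
integral of a power of z - τ against E_m, so exp(τY∂/∂X)ℰ* is twice the Laplace transform of the
series of [E_m](X/2πi, -Y/2πi) (`expOp_dropConst_genE`). The form (X - zY)^{m-2} E_m(z) dz is
invariant under SL₂(ℤ), which gives the cocycle relation (`eisInt_eq_cocycle_add`). Since
exp(cY∂/∂X) is the substitution X ↦ X + cY and ℒ commutes with linear substitutions, the rest is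
multiplication of 2×2 matrices (`dropConst_genE_smul`). -/

noncomputable section

namespace EllipticMZV

/-! ### Linear substitutions in power series of two variables -/

/-- The bidegree `(i, j)`. -/
def bideg (i j : ℕ) : Fin 2 →₀ ℕ := Finsupp.single 0 i + Finsupp.single 1 j

@[simp] theorem bideg_zero (i j : ℕ) : bideg i j 0 = i := by simp [bideg]

@[simp] theorem bideg_one (i j : ℕ) : bideg i j 1 = j := by simp [bideg]

theorem bideg_eta (d : Fin 2 →₀ ℕ) : bideg (d 0) (d 1) = d := by
  ext i; fin_cases i <;> simp

theorem bideg_inj {i j i' j' : ℕ} : bideg i j = bideg i' j' ↔ i = i' ∧ j = j' := by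
  constructor
  · intro h
    have h0 := DFunLike.congr_fun h 0
    have h1 := DFunLike.congr_fun h 1
    simpa using And.intro h0 h1
  · rintro ⟨rfl, rfl⟩; rfl

theorem mvPowerSeries_ext {K K' : MvPowerSeries (Fin 2) ℂ}
    (h : ∀ i j, MvPowerSeries.coeff (bideg i j) K = MvPowerSeries.coeff (bideg i j) K') :
    K = K' := by
  ext d; rw [← bideg_eta d]; exact h _ _

@[simp] theorem coeff_series (c : ℕ → ℕ → ℂ) (i j : ℕ) :
    MvPowerSeries.coeff (bideg i j) (series c) = c i j := by
  simp [series, MvPowerSeries.coeff_apply]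

@[simp] theorem coeff_laplace (K : MvPowerSeries (Fin 2) ℂ) (d : Fin 2 →₀ ℕ) :
    MvPowerSeries.coeff d (laplace K) =
      MvPowerSeries.coeff d K / ((d 0 + d 1).factorial : ℂ) := rfl

/-- The polynomial `aX + bY`. -/
def linForm (a b : ℂ) : MvPolynomial (Fin 2) ℂ :=
  MvPolynomial.C a * MvPolynomial.X 0 + MvPolynomial.C b * MvPolynomial.X 1

theorem isHomogeneous_linForm (a b : ℂ) : (linForm a b).IsHomogeneous 1 := by
  refine MvPolynomial.IsHomogeneous.add ?_ ?_
  · simpa using (MvPolynomial.isHomogeneous_C (Fin 2) a).mul (MvPolynomial.isHomogeneous_X ℂ 0)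
  · simpa using (MvPolynomial.isHomogeneous_C (Fin 2) b).mul (MvPolynomial.isHomogeneous_X ℂ 1)

/-- The coefficients of the matrix of a linear substitution on monomials. -/
def linWeight (a b c d : ℂ) (e f : Fin 2 →₀ ℕ) : ℂ :=
  MvPolynomial.coeff f (linForm a b ^ e 0 * linForm c d ^ e 1)

theorem linWeight_eq_zero {a b c d : ℂ} {e f : Fin 2 →₀ ℕ} (h : e 0 + e 1 ≠ f 0 + f 1) :
    linWeight a b c d e f = 0 := by
  have := ((isHomogeneous_linForm a b).pow (e 0)).mul ((isHomogeneous_linForm c d).pow (e 1))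
  refine this.coeff_eq_zero ?_
  simpa [Finsupp.degree_eq_sum, Fin.sum_univ_two, eq_comm] using h

/-- The substitution data of `linSubst`. -/
def linVec (a b c d : ℂ) : Fin 2 → MvPowerSeries (Fin 2) ℂ :=
  ![(linForm a b : MvPowerSeries (Fin 2) ℂ), (linForm c d : MvPowerSeries (Fin 2) ℂ)]

theorem linSubst_eq (a b c d : ℂ) (K : MvPowerSeries (Fin 2) ℂ) :
    linSubst a b c d K = MvPowerSeries.subst (linVec a b c d) K := by
  simp [linSubst, linVec, linForm]

theorem hasSubst_linVec (a b c d : ℂ) : MvPowerSeries.HasSubst (linVec a b c d) := by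
  refine MvPowerSeries.hasSubst_of_constantCoeff_zero fun s => ?_
  fin_cases s <;> simp [linVec, linForm]

theorem coeff_linSubst (a b c d : ℂ) (K : MvPowerSeries (Fin 2) ℂ) (f : Fin 2 →₀ ℕ) :
    MvPowerSeries.coeff f (linSubst a b c d K) =
      ∑ᶠ e : Fin 2 →₀ ℕ, MvPowerSeries.coeff e K * linWeight a b c d e f := by
  rw [linSubst_eq, MvPowerSeries.coeff_subst (hasSubst_linVec a b c d)]
  refine finsum_congr fun e => ?_
  rw [Finsupp.prod_fintype _ _ (by simp), Fin.prod_univ_two, smul_eq_mul, linWeight,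
    ← MvPolynomial.coeff_coe]
  simp [linVec]

/-- Linear forms are homogeneous, so a linear substitution preserves total degree. Operators acting
by a scalar on each degree, and sums with one term per degree, can thus be handled as if constant.
-/
theorem coeff_linSubst_congr {a b c d : ℂ} {K K' : MvPowerSeries (Fin 2) ℂ} {f : Fin 2 →₀ ℕ}
    (h : ∀ e : Fin 2 →₀ ℕ, e 0 + e 1 = f 0 + f 1 →
      MvPowerSeries.coeff e K = MvPowerSeries.coeff e K') :
    MvPowerSeries.coeff f (linSubst a b c d K) = MvPowerSeries.coeff f (linSubst a b c d K') := by
  rw [coeff_linSubst, coeff_linSubst]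
  refine finsum_congr fun e => ?_
  by_cases he : e 0 + e 1 = f 0 + f 1
  · rw [h e he]
  · rw [linWeight_eq_zero he, mul_zero, mul_zero]

theorem linSubst_add (a b c d : ℂ) (K K' : MvPowerSeries (Fin 2) ℂ) :
    linSubst a b c d (K + K') = linSubst a b c d K + linSubst a b c d K' := by
  simp_rw [linSubst_eq]
  exact MvPowerSeries.subst_add (hasSubst_linVec a b c d) K K'

theorem linSubst_C_mul (a b c d r : ℂ) (K : MvPowerSeries (Fin 2) ℂ) :
    linSubst a b c d (MvPowerSeries.C r * K) = MvPowerSeries.C r * linSubst a b c d K := by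
  simp_rw [linSubst_eq, ← MvPowerSeries.smul_eq_C_mul]
  exact MvPowerSeries.subst_smul (hasSubst_linVec a b c d) r K

theorem linSubst_linSubst (a b c d a' b' c' d' : ℂ) (K : MvPowerSeries (Fin 2) ℂ) :
    linSubst a' b' c' d' (linSubst a b c d K) =
      linSubst (a * a' + b * c') (a * b' + b * d') (c * a' + d * c') (c * b' + d * d') K := by
  simp_rw [linSubst_eq]
  rw [MvPowerSeries.subst_comp_subst_apply (hasSubst_linVec a b c d)
    (hasSubst_linVec a' b' c' d')]
  congr 1
  funext s
  fin_cases s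
  all_goals
    simp only [linVec, Fin.zero_eta, Fin.mk_one, Matrix.cons_val_zero, Matrix.cons_val_one]
    rw [MvPowerSeries.subst_coe]
    simp [linForm, MvPowerSeries.algebraMap_apply]
    ring

theorem linSubst_id (K : MvPowerSeries (Fin 2) ℂ) : linSubst 1 0 0 1 K = K := by
  rw [linSubst_eq]
  have : linVec 1 0 0 1 = MvPowerSeries.X := by
    funext s; fin_cases s <;> simp [linVec, linForm]
  rw [this, MvPowerSeries.subst_self, id]

/-- The Laplace operator is a scalar on each homogeneous component, and linear substitutions
preserve these components. -/
theorem laplace_linSubst (a b c d : ℂ) (K : MvPowerSeries (Fin 2) ℂ) :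
    laplace (linSubst a b c d K) = linSubst a b c d (laplace K) := by
  ext f
  have h : MvPowerSeries.coeff f (linSubst a b c d (laplace K)) =
      MvPowerSeries.coeff f (linSubst a b c d
        (MvPowerSeries.C (((f 0 + f 1).factorial : ℂ)⁻¹) * K)) := by
    refine coeff_linSubst_congr fun e he => ?_
    rw [coeff_laplace, he, MvPowerSeries.coeff_C_mul]
    ring
  rw [h, linSubst_C_mul, MvPowerSeries.coeff_C_mul, coeff_laplace]
  ring

theorem laplace_add (K K' : MvPowerSeries (Fin 2) ℂ) :
    laplace (K + K') = laplace K + laplace K' := by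
  ext f; simp [add_div]

theorem coe_polyAct (γ : Matrix.SpecialLinearGroup (Fin 2) ℤ) (P : MvPolynomial (Fin 2) ℂ) :
    ((polyAct γ P : MvPolynomial (Fin 2) ℂ) : MvPowerSeries (Fin 2) ℂ) =
      linSubst (γ 0 0) (γ 0 1) (γ 1 0) (γ 1 1) P := by
  rw [linSubst_eq, MvPowerSeries.subst_coe, polyAct]
  induction P using MvPolynomial.induction_on with
  | C r => simp [MvPowerSeries.algebraMap_apply, MvPolynomial.algebraMap_eq]
  | add p q hp hq => simp only [map_add, MvPolynomial.coe_add, hp, hq]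
  | mul_X p i hp =>
    rw [map_mul, map_mul, MvPolynomial.coe_mul, hp, MvPolynomial.aeval_X, MvPolynomial.aeval_X]
    congr 1
    fin_cases i <;> simp [linVec, linForm]

/-! ### The exponential of `c Y ∂/∂X` -/

theorem coeff_shiftOp (c : ℂ) (K : MvPowerSeries (Fin 2) ℂ) (i j : ℕ) :
    MvPowerSeries.coeff (bideg i j) (shiftOp c K) =
      if j = 0 then 0 else c * (i + 1) * MvPowerSeries.coeff (bideg (i + 1) (j - 1)) K := by
  rw [shiftOp, mul_assoc, MvPowerSeries.coeff_C_mul, mul_comm (MvPowerSeries.X 1)]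
  split_ifs with hj
  · subst hj
    rw [MvPowerSeries.X, MvPowerSeries.coeff_mul_monomial, if_neg, mul_zero]
    intro h
    have := h 1
    simp at this
  · have h : bideg i j = bideg i (j - 1) + Finsupp.single 1 1 := by
      ext s; fin_cases s <;> simp [bideg]; omega
    rw [h, MvPowerSeries.X, MvPowerSeries.coeff_add_mul_monomial, MvPowerSeries.coeff_pderiv]
    have h' : bideg i (j - 1) + Finsupp.single 0 1 = bideg (i + 1) (j - 1) := by
      ext s; fin_cases s <;> simp [bideg]
    rw [h']
    simp
    ring

/-- Division by `k!` turns the falling factorial of the `k`-th derivative into a binomial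
coefficient. Each application raises the degree in Y by one, so only `k ≤ j` contributes and the
exponential is a finite sum in each bidegree. -/
theorem coeff_shiftOp_iterate (c : ℂ) (K : MvPowerSeries (Fin 2) ℂ) (k i j : ℕ) :
    MvPowerSeries.coeff (bideg i j) ((shiftOp c)^[k] K) / (k.factorial : ℂ) =
      if j < k then 0 else c ^ k * ((i + k).choose k : ℂ) *
        MvPowerSeries.coeff (bideg (i + k) (j - k)) K := by
  rw [div_eq_iff (by exact_mod_cast k.factorial_ne_zero)]
  induction k generalizing i j with
  | zero => simp
  | succ k ih =>
    rw [Function.iterate_succ_apply', coeff_shiftOp]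
    by_cases hj : j = 0
    · simp [hj]
    rw [if_neg hj, ih]
    by_cases hk : j - 1 < k
    · rw [if_pos hk, if_pos (by omega)]; simp
    rw [if_neg hk, if_neg (by omega)]
    have e1 : i + 1 + k = i + (k + 1) := by omega
    have e2 : j - 1 - k = j - (k + 1) := by omega
    have e3 : ((i : ℂ) + 1) * ((i + 1 + k).choose k : ℂ) =
        (k + 1) * ((i + (k + 1)).choose (k + 1) : ℂ) := by
      have h := Nat.choose_succ_right_eq (i + (k + 1)) k
      rw [show i + (k + 1) - k = i + 1 by omega] at h
      have h' : (((i + (k + 1)).choose (k + 1) : ℂ)) * (k + 1) =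
          ((i + (k + 1)).choose k : ℂ) * (i + 1) := by exact_mod_cast h
      rw [e1]; linear_combination -h'
    rw [e2, Nat.factorial_succ]
    push_cast
    rw [← e1]
    rw [← e1] at e3
    linear_combination c ^ (k + 1) * (k.factorial : ℂ) *
      MvPowerSeries.coeff (bideg (i + 1 + k) (j - (k + 1))) K * e3

theorem coeff_expOp_shiftOp (c : ℂ) (K : MvPowerSeries (Fin 2) ℂ) (i j : ℕ) :
    MvPowerSeries.coeff (bideg i j) (expOp (shiftOp c) K) =
      ∑ k ∈ Finset.range (j + 1), c ^ k * ((i + k).choose k : ℂ) *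
        MvPowerSeries.coeff (bideg (i + k) (j - k)) K := by
  have h : MvPowerSeries.coeff (bideg i j) (expOp (shiftOp c) K) =
      ∑ᶠ k : ℕ, MvPowerSeries.coeff (bideg i j) ((shiftOp c)^[k] K) / (k.factorial : ℂ) := rfl
  rw [h, finsum_congr fun k => coeff_shiftOp_iterate c K k i j,
    finsum_eq_sum_of_support_subset (s := Finset.range (j + 1))]
  · refine Finset.sum_congr rfl fun k hk => if_neg ?_
    have := Finset.mem_range.mp hk; omega
  · intro k hk
    by_contra hk'
    simp only [Finset.coe_range, Set.mem_Iio, not_lt] at hk'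
    exact hk (if_pos (by omega))

theorem linWeight_shift (c : ℂ) (i j p r : ℕ) (h : i + j = p + r) :
    linWeight 1 c 0 1 (bideg i j) (bideg p r) =
      if j ≤ r then c ^ (r - j) * (i.choose p : ℂ) else 0 := by
  have e1 : linForm 1 c = MvPolynomial.X 0 + MvPolynomial.C c * MvPolynomial.X 1 := by
    simp [linForm]
  have e2 : linForm 0 1 = MvPolynomial.X 1 := by simp [linForm]
  have e3 : ∀ k ∈ Finset.range (i + 1),
      (MvPolynomial.X 0 : MvPolynomial (Fin 2) ℂ) ^ k *
        (MvPolynomial.C c * MvPolynomial.X 1) ^ (i - k) * (i.choose k : MvPolynomial (Fin 2) ℂ) *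
        MvPolynomial.X 1 ^ j =
      MvPolynomial.monomial (bideg k (i - k + j)) (c ^ (i - k) * (i.choose k : ℂ)) := by
    intro k _
    have h1 : MvPolynomial.monomial (bideg k (i - k + j)) (c ^ (i - k) * (i.choose k : ℂ)) =
        MvPolynomial.C (c ^ (i - k) * (i.choose k : ℂ)) *
          (MvPolynomial.X 0 ^ k * MvPolynomial.X 1 ^ (i - k + j)) := by
      rw [MvPolynomial.X_pow_eq_monomial, MvPolynomial.X_pow_eq_monomial,
        MvPolynomial.monomial_mul, MvPolynomial.C_mul_monomial, bideg]
      simp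
    rw [h1]
    simp only [MvPolynomial.C_mul, MvPolynomial.C_pow, map_natCast]
    ring
  rw [linWeight, bideg_zero, bideg_one, e1, e2, add_pow, Finset.sum_mul, Finset.sum_congr rfl e3,
    MvPolynomial.coeff_sum]
  simp_rw [MvPolynomial.coeff_monomial, bideg_inj]
  rw [Finset.sum_eq_single p]
  · by_cases hp : p ≤ i
    · rw [if_pos ⟨rfl, by omega⟩, if_pos (by omega), show i - p = r - j by omega]
    · rw [if_neg (by omega), if_neg (by omega)]
  · intro k _ hk
    rw [if_neg (fun h => hk h.1)]
  · intro hp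
    rw [Finset.mem_range] at hp
    rw [Nat.choose_eq_zero_of_lt (by omega)]
    simp

/-- Taylor's formula: exp(cY∂/∂X) is the translation X ↦ X + cY. Every operator of the theorem other
than ℒ becomes a matrix substitution and can be composed by `linSubst_linSubst`. -/
theorem expOp_shiftOp (c : ℂ) (K : MvPowerSeries (Fin 2) ℂ) :
    expOp (shiftOp c) K = linSubst 1 c 0 1 K := by
  refine mvPowerSeries_ext fun p r => ?_
  rw [coeff_expOp_shiftOp, coeff_linSubst,
    finsum_eq_sum_of_support_subset
      (s := (Finset.range (r + 1)).image fun k => bideg (p + k) (r - k)), Finset.sum_image]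
  · refine Finset.sum_congr rfl fun k hk => ?_
    have := Finset.mem_range.mp hk
    rw [linWeight_shift c _ _ _ _ (by omega), if_pos (by omega),
      show r - (r - k) = k by omega, Nat.choose_symm_add]
    ring
  · intro k hk l hl h
    have := (bideg_inj.mp h).1
    omega
  · intro e he
    have he' : linWeight 1 c 0 1 e (bideg p r) ≠ 0 := right_ne_zero_of_mul he
    have hd : e 0 + e 1 = p + r := by
      by_contra hd
      exact he' (linWeight_eq_zero (by simpa using hd))
    rw [← bideg_eta e, linWeight_shift c _ _ _ _ hd] at he'
    have h1 : e 1 ≤ r := by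
      by_contra h1
      exact he' (if_neg h1)
    simp only [Finset.coe_image, Set.mem_image, Finset.coe_range, Set.mem_Iio]
    exact ⟨r - e 1, by omega, by rw [show r - (r - e 1) = e 1 by omega,
      show p + (r - e 1) = e 0 by omega, bideg_eta]⟩

theorem expOp_shiftOp_neg_cancel (c : ℂ) (K : MvPowerSeries (Fin 2) ℂ) :
    expOp (shiftOp (-c)) (expOp (shiftOp c) K) = K := by
  rw [expOp_shiftOp, expOp_shiftOp, linSubst_linSubst]
  simpa using linSubst_id K

/-! ### Series of Eisenstein integrals -/

/-- `∑_{m ≥ 4} [E_m](X, Y; τ)`. -/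
def eisSeries (τ : ℍ) : MvPowerSeries (Fin 2) ℂ :=
  fun d => ∑ᶠ (m : ℕ) (_ : 4 ≤ m), MvPolynomial.coeff d (eisInt m τ)

theorem isHomogeneous_eisInt (m : ℕ) (τ : ℍ) : (eisInt m τ).IsHomogeneous (m - 2) := by
  rw [eisInt]
  refine MvPolynomial.IsHomogeneous.sum (Finset.range (m - 1)) _ (m - 2) fun j hj => ?_
  have hj' := Finset.mem_range.mp hj
  have := ((MvPolynomial.isHomogeneous_X_pow (R := ℂ) (0 : Fin 2) (m - 2 - j)).mul
    (MvPolynomial.isHomogeneous_X_pow (R := ℂ) (1 : Fin 2) j))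
  rw [show m - 2 - j + j = m - 2 by omega] at this
  have h := (MvPolynomial.isHomogeneous_C (Fin 2) ((2 * Real.pi * Complex.I) ^ (m - 1) *
    ((m - 2).choose j : ℂ) * (-1) ^ j * tangInt (fun z => (z : ℂ) ^ j * eisE m z) τ)).mul this
  rwa [zero_add] at h

theorem coeff_polyAct (γ : Matrix.SpecialLinearGroup (Fin 2) ℤ) (P : MvPolynomial (Fin 2) ℂ)
    (f : Fin 2 →₀ ℕ) : MvPolynomial.coeff f (polyAct γ P) =
      MvPowerSeries.coeff f (linSubst (γ 0 0) (γ 0 1) (γ 1 0) (γ 1 1) P) := by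
  rw [← coe_polyAct, MvPolynomial.coeff_coe]

theorem coeff_polyAct_eq_zero (γ : Matrix.SpecialLinearGroup (Fin 2) ℤ)
    {P : MvPolynomial (Fin 2) ℂ} {n : ℕ} (hP : P.IsHomogeneous n) {f : Fin 2 →₀ ℕ}
    (hf : f 0 + f 1 ≠ n) : MvPolynomial.coeff f (polyAct γ P) = 0 := by
  rw [coeff_polyAct, coeff_linSubst_congr (K' := MvPowerSeries.C 0 * (P : MvPowerSeries (Fin 2) ℂ)), linSubst_C_mul]
  · simp
  · intro e he
    rw [MvPolynomial.coeff_coe, hP.coeff_eq_zero]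
    · simp
    · rw [Finsupp.degree_eq_sum, Fin.sum_univ_two, he]; exact hf

theorem coeff_eisInt_eq_zero {m : ℕ} {τ : ℍ} {f : Fin 2 →₀ ℕ} (hf : f 0 + f 1 ≠ m - 2) :
    MvPolynomial.coeff f (eisInt m τ) = 0 :=
  (isHomogeneous_eisInt m τ).coeff_eq_zero (by rwa [Finsupp.degree_eq_sum, Fin.sum_univ_two])

/-- The polynomial attached to E_m is homogeneous of degree `m - 2`, so a monomial of degree `n`
meets only the weight `m = n + 2`, and none at all if `n < 2`. -/
theorem finsum_weight_eq {u : ℕ → ℂ} {n : ℕ} (h : ∀ m, 4 ≤ m → m - 2 ≠ n → u m = 0) :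
    ∑ᶠ (m : ℕ) (_ : 4 ≤ m), u m = if 2 ≤ n then u (n + 2) else 0 := by
  have h' : ∀ m, (∑ᶠ (_ : 4 ≤ m), u m) = if 4 ≤ m then u m else 0 := fun m => by
    split_ifs with hm <;> simp [hm]
  rw [finsum_congr h', finsum_eq_single _ (n + 2)]
  · simp
  · intro m hm
    split_ifs with h4
    · exact h m h4 (by omega)
    · rfl

theorem coeff_eisSeries (τ : ℍ) (d : Fin 2 →₀ ℕ) : MvPowerSeries.coeff d (eisSeries τ) =
    if 2 ≤ d 0 + d 1 then MvPolynomial.coeff d (eisInt (d 0 + d 1 + 2) τ) else 0 :=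
  finsum_weight_eq (u := fun m => MvPolynomial.coeff d (eisInt m τ))
    fun _ _ hm => coeff_eisInt_eq_zero (Ne.symm hm)

theorem coeff_periodSeries (γ : Matrix.SpecialLinearGroup (Fin 2) ℤ) (d : Fin 2 →₀ ℕ) :
    MvPowerSeries.coeff d (periodSeries γ) =
      if 2 ≤ d 0 + d 1 then MvPolynomial.coeff d (eisCocycle (d 0 + d 1 + 2) γ) else 0 := by
  refine finsum_weight_eq (u := fun m => MvPolynomial.coeff d (eisCocycle m γ)) fun m _ hm => ?_
  rw [eisCocycle, MvPolynomial.coeff_sub, coeff_eisInt_eq_zero (Ne.symm hm),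
    coeff_polyAct_eq_zero γ (isHomogeneous_eisInt m _) (Ne.symm hm), sub_zero]

theorem eisSeries_eq_add (γ : Matrix.SpecialLinearGroup (Fin 2) ℤ) (τ : ℍ)
    (h : ∀ m : ℕ, 4 ≤ m → eisInt m τ = eisCocycle m γ + polyAct γ (eisInt m (γ • τ))) :
    eisSeries τ = periodSeries γ +
      linSubst (γ 0 0) (γ 0 1) (γ 1 0) (γ 1 1) (eisSeries (γ • τ)) := by
  ext d
  rw [map_add, coeff_eisSeries, coeff_periodSeries]
  split_ifs with hd
  · rw [h _ (by omega), MvPolynomial.coeff_add, coeff_polyAct]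
    congr 1
    refine coeff_linSubst_congr fun e he => ?_
    rw [coeff_eisSeries, he, if_pos hd, MvPolynomial.coeff_coe]
  · rw [coeff_linSubst_congr (K' := MvPowerSeries.C 0 * eisSeries (γ • τ)), linSubst_C_mul]
    · simp
    · intro e he
      rw [coeff_eisSeries, he, if_neg hd]
      simp

/-- The behaviour of `exp(τ Y ∂/∂X) ℰ*` under the modular group follows from its expression in
terms of the Eisenstein integrals `[E_m]`. -/
theorem dropConst_genE_smul (γ : Matrix.SpecialLinearGroup (Fin 2) ℤ) (τ : ℍ)
    (hE : ∀ τ : ℍ, expOp (shiftOp (τ : ℂ)) (dropConst (genE τ)) =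
      MvPowerSeries.C 2 * laplace (linSubst (1 / (2 * Real.pi * Complex.I)) 0
        0 (-1 / (2 * Real.pi * Complex.I)) (eisSeries τ)))
    (h : ∀ m : ℕ, 4 ≤ m → eisInt m τ = eisCocycle m γ + polyAct γ (eisInt m (γ • τ))) :
    dropConst (genE (γ • τ)) =
      expOp (shiftOp (-((γ • τ : ℍ) : ℂ)))
        (linSubst (γ 1 1) (γ 0 1) (γ 1 0) (γ 0 0)
          (expOp (shiftOp (τ : ℂ)) (dropConst (genE τ)))) -
      2 * expOp (shiftOp (-((γ • τ : ℍ) : ℂ)))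
        (linSubst (γ 1 1) (γ 0 1) (γ 1 0) (γ 0 0)
          (laplace (linSubst (1 / (2 * Real.pi * Complex.I)) 0
            0 (-1 / (2 * Real.pi * Complex.I)) (periodSeries γ)))) := by
  have hdet : (γ 0 0 : ℂ) * γ 1 1 - γ 0 1 * γ 1 0 = 1 := by
    have := γ.det_coe
    rw [Matrix.det_fin_two] at this
    exact_mod_cast this
  set ι : ℂ := 1 / (2 * Real.pi * Complex.I) with hι
  have hι' : -1 / (2 * Real.pi * Complex.I) = -ι := by rw [hι]; ring
  rw [hι'] at hE ⊢
  -- The sign in `-Y'/(2πi)` conjugates γ by diag(1, -1), giving the matrix with rows (a, -b), (-c,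
  -- d). Its inverse has rows (d, b), (c, a), which is exactly the substitution defining X' and Y'.
  have key : linSubst (γ 1 1) (γ 0 1) (γ 1 0) (γ 0 0) (linSubst ι 0 0 (-ι)
      (linSubst (γ 0 0) (γ 0 1) (γ 1 0) (γ 1 1) (eisSeries (γ • τ)))) =
      linSubst ι 0 0 (-ι) (eisSeries (γ • τ)) := by
    rw [linSubst_linSubst, linSubst_linSubst]
    congr 1
    · linear_combination ι * hdet
    · ring
    · ring
    · linear_combination -ι * hdet
  have h2 : (2 : MvPowerSeries (Fin 2) ℂ) = MvPowerSeries.C 2 := (map_ofNat MvPowerSeries.C 2).symm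
  -- Only exp(τY∂/∂X)ℰ* has a simple expression through [E_m], so the exponential at γτ and its
  -- inverse are inserted first.
  conv_lhs => rw [← expOp_shiftOp_neg_cancel ((γ • τ : ℍ) : ℂ) (dropConst (genE (γ • τ)))]
  rw [hE τ, hE (γ • τ), eisSeries_eq_add γ τ h, linSubst_add, laplace_add, mul_add, linSubst_add,
    linSubst_C_mul, linSubst_C_mul, ← laplace_linSubst, ← laplace_linSubst, key]
  simp only [expOp_shiftOp, linSubst_add, linSubst_C_mul]
  rw [h2]
  ring

/-! ### `q`-series with coefficients of polynomial growth -/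

/-- Polynomial growth of a sequence that vanishes at `0`. -/
def HasPolyGrowth (c : ℕ → ℂ) : Prop := ∃ C : ℝ, ∃ k : ℕ, ∀ n, ‖c n‖ ≤ C * (n : ℝ) ^ (k + 1)

theorem HasPolyGrowth.apply_zero {c : ℕ → ℂ} (h : HasPolyGrowth c) : c 0 = 0 := by
  obtain ⟨C, k, h⟩ := h
  simpa using h 0

/-- The exponential `exp(2πi n z)`. -/
def qexp (n : ℕ) (z : ℂ) : ℂ := Complex.exp (2 * Real.pi * Complex.I * z) ^ n

/-- The sum of the `q`-series with coefficients `c`. -/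
def qs (c : ℕ → ℂ) (z : ℂ) : ℂ := ∑' n : ℕ, c n * qexp n z

theorem norm_qexp (n : ℕ) (z : ℂ) : ‖qexp n z‖ = Real.exp (-(2 * Real.pi * z.im)) ^ n := by
  rw [qexp, norm_pow, Complex.norm_exp]
  congr 2
  simp

theorem hasDerivAt_qexp (n : ℕ) (z : ℂ) :
    HasDerivAt (qexp n) (2 * Real.pi * Complex.I * n * qexp n z) z := by
  have h : qexp n = fun z => Complex.exp (n * (2 * Real.pi * Complex.I * z)) := by
    funext z; rw [qexp, ← Complex.exp_nat_mul]
  rw [h]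
  refine (((hasDerivAt_id z).const_mul (2 * Real.pi * Complex.I)).const_mul (n : ℂ)).cexp.congr_deriv
    ?_
  simp only [id]; ring

theorem exp_neg_lt_one {y : ℝ} (hy : 0 < y) : Real.exp (-(2 * Real.pi * y)) < 1 := by
  rw [Real.exp_lt_one_iff]
  have := mul_pos Real.two_pi_pos hy
  linarith

theorem HasPolyGrowth.summable_norm {c : ℕ → ℂ} (h : HasPolyGrowth c) {y : ℝ} (hy : 0 < y) :
    Summable fun n : ℕ => ‖c n‖ * Real.exp (-(2 * Real.pi * y)) ^ n := by
  obtain ⟨C, k, h⟩ := h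
  have := (summable_pow_mul_geometric_of_norm_lt_one (k + 1)
    (r := Real.exp (-(2 * Real.pi * y)))
    (by rw [Real.norm_eq_abs, Real.abs_exp]; exact exp_neg_lt_one hy)).mul_left C
  refine Summable.of_nonneg_of_le (fun n => by positivity) (fun n => ?_) this
  rw [← mul_assoc]
  exact mul_le_mul_of_nonneg_right (h n) (by positivity)

theorem HasPolyGrowth.summable {c : ℕ → ℂ} (h : HasPolyGrowth c) {z : ℂ} (hz : 0 < z.im) :
    Summable fun n : ℕ => c n * qexp n z := by
  refine Summable.of_norm ?_
  simp_rw [norm_mul, norm_qexp]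
  exact h.summable_norm hz

theorem HasPolyGrowth.deriv {c : ℕ → ℂ} (h : HasPolyGrowth c) :
    HasPolyGrowth fun n => 2 * Real.pi * Complex.I * n * c n := by
  obtain ⟨C, k, h⟩ := h
  refine ⟨2 * Real.pi * C, k + 1, fun n => ?_⟩
  have : ‖(2 * Real.pi * Complex.I * n : ℂ)‖ = 2 * Real.pi * n := by
    simp [abs_of_pos Real.pi_pos]
  rw [norm_mul, this]
  calc 2 * Real.pi * n * ‖c n‖ ≤ 2 * Real.pi * n * (C * (n : ℝ) ^ (k + 1)) :=
        mul_le_mul_of_nonneg_left (h n) (by positivity)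
    _ = _ := by ring

theorem HasPolyGrowth.hasDerivAt {c : ℕ → ℂ} (h : HasPolyGrowth c) {z : ℂ} (hz : 0 < z.im) :
    HasDerivAt (qs c) (qs (fun n => 2 * Real.pi * Complex.I * n * c n) z) z := by
  -- On the half plane of height half that of `z`, the derivatives are dominated by one convergent
  -- series, as termwise differentiation requires.
  have hz2 : 0 < z.im / 2 := by linarith
  have ht : z ∈ {w : ℂ | z.im / 2 < w.im} := by simp; linarith
  refine hasDerivAt_tsum_of_isPreconnected (t := {w : ℂ | z.im / 2 < w.im})
    (g := fun n w => c n * qexp n w)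
    (g' := fun n w => 2 * Real.pi * Complex.I * n * c n * qexp n w)
    (u := fun n : ℕ => ‖2 * Real.pi * Complex.I * n * c n‖ *
      Real.exp (-(2 * Real.pi * (z.im / 2))) ^ n)
    (h.deriv.summable_norm hz2) (isOpen_lt continuous_const Complex.continuous_im)
    (convex_halfSpace_im_gt _).isPreconnected ?_ ?_ ht (h.summable hz) ht
  · intro n w _
    refine ((hasDerivAt_qexp n w).const_mul (c n)).congr_deriv ?_
    ring
  · intro n w hw
    rw [norm_mul, norm_qexp]
    gcongr
    exact le_of_lt hw

/-- A function on the upper half plane that decays exponentially on vertical lines. -/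
def VertDecay (G : ℂ → ℂ) : Prop :=
  ∀ x : ℝ, (fun y : ℝ => G (x + y * Complex.I)) =O[atTop] fun y : ℝ => Real.exp (-y)

theorem VertDecay.const_mul {G : ℂ → ℂ} (h : VertDecay G) (a : ℂ) :
    VertDecay fun z => a * G z := fun x => (h x).const_mul_left a

theorem VertDecay.sum {ι : Type*} {s : Finset ι} {G : ι → ℂ → ℂ} (h : ∀ i ∈ s, VertDecay (G i)) :
    VertDecay fun z => ∑ i ∈ s, G i z := fun x => IsBigO.fun_sum fun i hi => h i hi x

theorem HasPolyGrowth.isBigO {c : ℕ → ℂ} (h : HasPolyGrowth c) (x : ℝ) :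
    (fun y : ℝ => qs c (x + y * Complex.I)) =O[atTop]
      fun y : ℝ => Real.exp (-(2 * Real.pi * y)) := by
  have hs := h.summable_norm one_pos
  refine IsBigO.of_bound (Real.exp (2 * Real.pi) *
    ∑' n : ℕ, ‖c n‖ * Real.exp (-(2 * Real.pi * 1)) ^ n) ?_
  filter_upwards [eventually_ge_atTop (1 : ℝ)] with y hy
  have hy0 : 0 < y := by linarith
  have him : ((x : ℂ) + y * Complex.I).im = y := by simp
  rw [Real.norm_eq_abs, Real.abs_exp, qs]
  refine (norm_tsum_le_tsum_norm ?_).trans ?_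
  · simp_rw [norm_mul, norm_qexp, him]
    exact h.summable_norm hy0
  rw [mul_right_comm, ← tsum_mul_left]
  simp_rw [norm_mul, norm_qexp, him]
  refine Summable.tsum_le_tsum (fun n => ?_) (h.summable_norm hy0) (hs.mul_left _)
  rcases Nat.eq_zero_or_pos n with rfl | hn
  · simp [h.apply_zero]
  rw [mul_left_comm]
  refine mul_le_mul_of_nonneg_left ?_ (norm_nonneg _)
  rw [← Real.exp_nat_mul, ← Real.exp_nat_mul, ← Real.exp_add, ← Real.exp_add]
  refine Real.exp_le_exp.mpr ?_
  have hn' : (1 : ℝ) ≤ n := by exact_mod_cast hn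
  -- From (n-1)(y-1) ≥ 0 follows ny ≥ n + y - 1: this extracts e^{-2πy} from every term, with
  -- constant e^{2π} and the series at height 1.
  have := mul_nonneg Real.two_pi_pos.le (mul_nonneg (sub_nonneg.mpr hn') (sub_nonneg.mpr hy))
  linarith

theorem isBigO_polynomial_exp (p : Polynomial ℂ) (x : ℝ) :
    (fun y : ℝ => p.eval ((x : ℂ) + y * Complex.I)) =O[atTop] fun y : ℝ => Real.exp y := by
  induction p using Polynomial.induction_on' with
  | add p q hp hq => simpa [Polynomial.eval_add] using hp.add hq
  | monomial n a =>
    simp_rw [Polynomial.eval_monomial]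
    refine IsBigO.const_mul_left ?_ a
    have h1 : (fun y : ℝ => (x : ℂ) + y * Complex.I) =O[atTop] fun y : ℝ => y := by
      refine IsBigO.add ?_ ?_
      · exact (isLittleO_const_id_atTop (x : ℂ)).isBigO
      · exact IsBigO.of_bound 1 (by simp)
    exact (h1.pow n).trans (Real.isLittleO_pow_exp_atTop).isBigO

/-- Decay e^{-2πy} absorbs the crude bound e^y for a polynomial and still leaves e^{-y}, so the one
fixed rate in `VertDecay` serves for all integrands. -/
theorem HasPolyGrowth.vertDecay {c : ℕ → ℂ} (h : HasPolyGrowth c) (p : Polynomial ℂ) :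
    VertDecay fun z => p.eval z * qs c z := fun x => by
  refine ((isBigO_polynomial_exp p x).mul (h.isBigO x)).trans (IsBigO.of_bound 1 ?_)
  filter_upwards [eventually_ge_atTop (0 : ℝ)] with y hy
  rw [← Real.exp_add, one_mul, Real.norm_eq_abs, Real.norm_eq_abs, Real.abs_exp, Real.abs_exp]
  refine Real.exp_le_exp.mpr ?_
  have := mul_le_mul_of_nonneg_right Real.pi_gt_three.le hy
  linarith

/-! ### Evaluation of regularized integrals -/

/-- All regularized integrals are evaluated through this form of the fundamental theorem of
calculus. The polynomial part is unique, hence equal to `p`; the decaying part is integrated along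
the vertical ray, where `F` vanishes at infinity, and the polynomial part along the segment from 0
to τ, where `P` vanishes at 0. -/
theorem tangInt_eq {g : ℍ → ℂ} {p P : Polynomial ℂ} {G F : ℂ → ℂ}
    (hg : ∀ z : ℍ, g z = p.eval (z : ℂ) + G z)
    (hF : ∀ z : ℂ, 0 < z.im → HasDerivAt F (-G z) z)
    (hG : ∀ z : ℂ, 0 < z.im → ContinuousAt G z)
    (hP : P.derivative = -p) (hP0 : P.eval 0 = 0) (dG : VertDecay G) (dF : VertDecay F) (τ : ℍ) :
    tangInt g τ = P.eval (τ : ℂ) + F τ := by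
  have hpp : polyPart g = p := by
    refine IsPolyPart.polyPart_eq fun x => ⟨1, one_pos, ?_⟩
    refine IsBigO.congr' (dG x) ?_ ?_
    · filter_upwards [eventually_gt_atTop (0 : ℝ)] with y hy
      have him : 0 < ((x : ℂ) + y * Complex.I).im := by simpa using hy
      rw [hg, ofComplex_apply_of_im_pos him]
      simp
    · exact Eventually.of_forall fun y => by simp
  have him : ∀ t : ℝ, 0 ≤ t → 0 < ((τ : ℂ) + t * Complex.I).im := fun t ht => by
    have := τ.im_pos
    simp
    linarith
  have hτ : ∀ t : ℝ, (τ : ℂ) + t * Complex.I = (τ.re : ℂ) + ((τ.im + t : ℝ) : ℂ) * Complex.I :=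
    fun t => by
      apply Complex.ext <;> simp
  have hshift : ∀ {G : ℂ → ℂ}, VertDecay G →
      (fun t : ℝ => G ((τ : ℂ) + t * Complex.I)) =O[atTop] fun t : ℝ => Real.exp (-1 * t) := by
    intro G dG
    have h := (dG τ.re).comp_tendsto (tendsto_atTop_add_const_left atTop τ.im tendsto_id)
    refine (h.congr_left fun t => ?_).trans (IsBigO.of_bound 1 (Eventually.of_forall fun t => ?_))
    · simp only [Function.comp, id, hτ]
    · simp only [Function.comp, id, Real.norm_eq_abs, Real.abs_exp, one_mul]
      refine Real.exp_le_exp.mpr ?_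
      have := τ.im_pos
      linarith
  have hline : ∀ t : ℝ, HasDerivAt (fun t : ℝ => (τ : ℂ) + t * Complex.I) Complex.I t := fun t => by
    simpa using ((Complex.ofRealCLM.hasDerivAt (x := t)).mul_const Complex.I).const_add (τ : ℂ)
  have h1 : ∫ t in Set.Ioi (0 : ℝ), -G ((τ : ℂ) + t * Complex.I) * Complex.I =
      0 - F ((τ : ℂ) + (0 : ℝ) * Complex.I) := by
    refine integral_Ioi_of_hasDerivAt_of_tendsto' (f := fun t : ℝ => F ((τ : ℂ) + t * Complex.I))
      (fun t ht => ?_) ?_ ?_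
    · exact (hF _ (him t ht)).comp t (hline t)
    · refine (integrableOn_Ici_iff_integrableOn_Ioi (by finiteness)).mp
        ((ContinuousOn.locallyIntegrableOn ?_ measurableSet_Ici).integrableOn_of_isBigO_atTop
          (g := fun t => Real.exp (-1 * t)) ?_
          ⟨Set.Ioi 0, Ioi_mem_atTop 0, exp_neg_integrableOn_Ioi 0 one_pos⟩)
      · intro t ht
        have := ContinuousAt.comp (f := fun t : ℝ => (τ : ℂ) + t * Complex.I) (g := G) (x := t)
          (hG _ (him t ht)) (hline t).continuousAt
        exact (this.neg.mul continuousAt_const).continuousWithinAt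
      · have := (hshift dG).const_mul_left (-Complex.I)
        refine this.congr_left fun t => by ring
    · refine (hshift dF).trans_tendsto ?_
      exact Real.tendsto_exp_atBot.comp (tendsto_id.const_mul_atTop_of_neg (by norm_num))
  have h2 : ∫ s in (0 : ℝ)..1, p.eval ((s : ℂ) * (τ : ℂ)) * (τ : ℂ) =
      -P.eval ((1 : ℝ) * (τ : ℂ)) - -P.eval ((0 : ℝ) * (τ : ℂ)) := by
    refine intervalIntegral.integral_eq_sub_of_hasDerivAt
      (f := fun s : ℝ => -P.eval ((s : ℂ) * (τ : ℂ))) (fun s _ => ?_) ?_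
    · have hs : HasDerivAt (fun s : ℝ => (s : ℂ) * (τ : ℂ)) (τ : ℂ) s := by
        simpa using (Complex.ofRealCLM.hasDerivAt (x := s)).mul_const (τ : ℂ)
      have := ((P.hasDerivAt ((s : ℂ) * (τ : ℂ))).comp s hs).neg
      refine this.congr_deriv ?_
      simp [hP]
    · refine Continuous.intervalIntegrable ?_ _ _
      fun_prop
  rw [tangInt, hpp, h2]
  have h3 : ∫ t in Set.Ioi (0 : ℝ), (g (ofComplex ((τ : ℂ) + t * Complex.I)) -
      p.eval ((τ : ℂ) + t * Complex.I)) =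
      ∫ t in Set.Ioi (0 : ℝ), Complex.I * (-G ((τ : ℂ) + t * Complex.I) * Complex.I) := by
    refine setIntegral_congr_fun measurableSet_Ioi fun t ht => ?_
    rw [hg, ofComplex_apply_of_im_pos (him t (le_of_lt ht))]
    simp only
    linear_combination G (τ + t * Complex.I) * Complex.I_mul_I
  rw [h3, MeasureTheory.integral_const_mul, h1]
  simp only [Complex.ofReal_zero, Complex.ofReal_one, zero_mul, add_zero, one_mul, hP0]
  linear_combination -F τ * Complex.I_mul_I

/-- The antiderivative of a polynomial without constant term. -/
def polyInt (p : Polynomial ℂ) : Polynomial ℂ :=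
  p.sum fun n a => Polynomial.monomial (n + 1) (a / (n + 1))

theorem polyInt_add (p r : Polynomial ℂ) : polyInt (p + r) = polyInt p + polyInt r := by
  rw [polyInt, Polynomial.sum_add_index] <;> simp [polyInt, add_div]

theorem polyInt_monomial (n : ℕ) (a : ℂ) :
    polyInt (Polynomial.monomial n a) = Polynomial.monomial (n + 1) (a / (n + 1)) := by
  rw [polyInt, Polynomial.sum_monomial_index]; simp

theorem derivative_polyInt (p : Polynomial ℂ) : (polyInt p).derivative = p := by
  induction p using Polynomial.induction_on' with
  | add p q hp hq => rw [polyInt_add, Polynomial.derivative_add, hp, hq]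
  | monomial n a =>
    rw [polyInt_monomial, Polynomial.derivative_monomial]
    have : (n : ℂ) + 1 ≠ 0 := by exact_mod_cast n.succ_ne_zero
    simp [this]

theorem eval_zero_polyInt (p : Polynomial ℂ) : (polyInt p).eval 0 = 0 := by
  induction p using Polynomial.induction_on' with
  | add p q hp hq => rw [polyInt_add, Polynomial.eval_add, hp, hq, add_zero]
  | monomial n a => simp [polyInt_monomial]

theorem polyInt_C_mul (a : ℂ) (p : Polynomial ℂ) :
    polyInt (Polynomial.C a * p) = Polynomial.C a * polyInt p := by
  induction p using Polynomial.induction_on' with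
  | add p q hp hq => rw [mul_add, polyInt_add, polyInt_add, hp, hq, mul_add]
  | monomial n b =>
    rw [Polynomial.C_mul_monomial, polyInt_monomial, polyInt_monomial, Polynomial.C_mul_monomial,
      mul_div_assoc]

/-- The coefficients of the `a`-fold antiderivative of a `q`-series. -/
def antiCoeff (c : ℕ → ℂ) (a n : ℕ) : ℂ := c n / (2 * Real.pi * Complex.I * n) ^ a

theorem HasPolyGrowth.antiCoeff {c : ℕ → ℂ} (h : HasPolyGrowth c) (a : ℕ) :
    HasPolyGrowth (antiCoeff c a) := by
  have h0 := h.apply_zero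
  obtain ⟨C, k, h⟩ := h
  refine ⟨C, k, fun n => ?_⟩
  -- At `n = 0` the denominator may be zero, but `c 0 = 0`. For `n ≥ 1` the denominator has norm at
  -- least 1, so the growth bound persists.
  rcases Nat.eq_zero_or_pos n with rfl | hn
  · simp [EllipticMZV.antiCoeff, h0]
  · refine le_trans ?_ (h n)
    rw [EllipticMZV.antiCoeff, norm_div, norm_pow]
    refine div_le_self (norm_nonneg _) (one_le_pow₀ ?_)
    have hn' : (1 : ℝ) ≤ n := by exact_mod_cast hn
    have : ‖(2 * Real.pi * Complex.I * n : ℂ)‖ = 2 * Real.pi * n := by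
      simp [abs_of_pos Real.pi_pos]
    rw [this]
    nlinarith [Real.pi_gt_three]

theorem HasPolyGrowth.hasDerivAt_anti {c : ℕ → ℂ} (h : HasPolyGrowth c) (a : ℕ) {z : ℂ}
    (hz : 0 < z.im) :
    HasDerivAt (qs (EllipticMZV.antiCoeff c (a + 1))) (qs (EllipticMZV.antiCoeff c a) z) z := by
  convert (h.antiCoeff (a + 1)).hasDerivAt hz using 2
  funext n
  rcases Nat.eq_zero_or_pos n with rfl | hn
  · simp [EllipticMZV.antiCoeff, h.apply_zero]
  · have hn' : (2 * Real.pi * Complex.I * n : ℂ) ≠ 0 :=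
      mul_ne_zero Complex.two_pi_I_ne_zero (by exact_mod_cast hn.ne')
    rw [EllipticMZV.antiCoeff, EllipticMZV.antiCoeff, pow_succ, mul_div_assoc',
      mul_comm _ (c n), mul_div_mul_right _ _ hn']

theorem antiCoeff_zero (c : ℕ → ℂ) : antiCoeff c 0 = c := by
  funext n; simp [antiCoeff]

/-- The part of the regularized integral of `p(z) ∑ c_n q^n` that is small towards `i∞`. -/
def smallInt (c : ℕ → ℂ) (M : ℕ) (p : Polynomial ℂ) (z : ℂ) : ℂ :=
  ∑ s ∈ Finset.range M, (-1) ^ s * ((Polynomial.derivative^[s] p).eval z *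
    qs (antiCoeff c (s + 1)) z)

/-- Repeated integration by parts: the derivative telescopes to the wanted integrand and a remainder
containing the `M`-th derivative of `p`, which is zero because the degree of `p` is less than `M`.
-/
theorem HasPolyGrowth.hasDerivAt_smallInt {c : ℕ → ℂ} (h : HasPolyGrowth c) {M : ℕ}
    {p : Polynomial ℂ} (hp : p.natDegree < M) {z : ℂ} (hz : 0 < z.im) :
    HasDerivAt (smallInt c M p) (p.eval z * qs c z) z := by
  have h1 : HasDerivAt (smallInt c M p) (∑ s ∈ Finset.range M, (-1) ^ s *
      ((Polynomial.derivative^[s + 1] p).eval z * qs (EllipticMZV.antiCoeff c (s + 1)) z +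
        (Polynomial.derivative^[s] p).eval z * qs (EllipticMZV.antiCoeff c s) z)) z := by
    refine HasDerivAt.fun_sum fun s _ => ?_
    refine HasDerivAt.const_mul _ ?_
    rw [Function.iterate_succ_apply']
    exact (Polynomial.hasDerivAt _ z).mul (h.hasDerivAt_anti s hz)
  convert h1 using 1
  have h2 : ∀ N : ℕ, ∑ s ∈ Finset.range N, (-1 : ℂ) ^ s *
      ((Polynomial.derivative^[s + 1] p).eval z * qs (EllipticMZV.antiCoeff c (s + 1)) z +
        (Polynomial.derivative^[s] p).eval z * qs (EllipticMZV.antiCoeff c s) z) =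
      p.eval z * qs c z - (-1) ^ N *
        ((Polynomial.derivative^[N] p).eval z * qs (EllipticMZV.antiCoeff c N) z) := by
    intro N
    induction N with
    | zero => simp [antiCoeff_zero]
    | succ N ih => rw [Finset.sum_range_succ, ih]; ring
  rw [h2, Polynomial.iterate_derivative_eq_zero hp]
  simp

theorem HasPolyGrowth.vertDecay_smallInt {c : ℕ → ℂ} (h : HasPolyGrowth c) (M : ℕ)
    (p : Polynomial ℂ) : VertDecay (smallInt c M p) :=
  VertDecay.sum fun s _ => ((h.antiCoeff (s + 1)).vertDecay _).const_mul _

theorem tangInt_polynomial_mul {c : ℕ → ℂ} (h : HasPolyGrowth c) (e b : ℂ) {M : ℕ}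
    {p : Polynomial ℂ} (hp : p.natDegree < M) {g : ℍ → ℂ}
    (hg : ∀ z : ℍ, g z = p.eval (z : ℂ) * (e + b * qs c z)) (τ : ℍ) :
    tangInt g τ = -e * (polyInt p).eval (τ : ℂ) - b * smallInt c M p τ := by
  rw [tangInt_eq (g := g) (p := Polynomial.C e * p) (P := Polynomial.C (-e) * polyInt p)
    (G := fun z => b * (p.eval z * qs c z)) (F := fun z => -b * smallInt c M p z)]
  · simp; ring
  · intro z; rw [hg]; simp; ring
  · intro z hz
    refine ((h.hasDerivAt_smallInt hp hz).const_mul (-b)).congr_deriv ?_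
    ring
  · intro z hz
    exact continuousAt_const.mul (p.continuous.continuousAt.mul (h.hasDerivAt hz).continuousAt)
  · rw [Polynomial.derivative_C_mul, derivative_polyInt]; simp
  · simp [eval_zero_polyInt]
  · exact (h.vertDecay p).const_mul b
  · exact (h.vertDecay_smallInt M p).const_mul (-b)

/-! ### Eisenstein series -/

/-- The coefficients `σ_{m-1}(n)`. -/
def sigCoeff (m n : ℕ) : ℂ := (ArithmeticFunction.sigma (m - 1) n : ℂ)

theorem hasPolyGrowth_sigCoeff (m : ℕ) : HasPolyGrowth (sigCoeff m) := by
  refine ⟨1, m - 1, fun n => ?_⟩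
  rw [sigCoeff, Complex.norm_natCast, one_mul]
  exact_mod_cast ArithmeticFunction.sigma_le_pow_succ (m - 1) n

/-- The constant term of `E_m`. -/
def eisConst (m : ℕ) : ℂ := -(bernoulli m : ℂ) / (2 * (m : ℂ))

/-- The parity factor `(1 + (-1)^m)/2`. -/
def parity (m : ℕ) : ℂ := (1 + (-1 : ℂ) ^ m) / 2

/-- `E_m` as a function on `ℂ`. -/
def eisFun (m : ℕ) (z : ℂ) : ℂ := eisConst m + parity m * qs (sigCoeff m) z

theorem eisE_eq (m : ℕ) (τ : ℍ) : eisE m τ = eisFun m τ := by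
  rw [eisE, eisFun, qs, ((hasPolyGrowth_sigCoeff m).summable τ.im_pos).tsum_eq_zero_add,
    (hasPolyGrowth_sigCoeff m).apply_zero, zero_mul, zero_add]
  rfl

theorem parity_even {m : ℕ} (h : Even m) : parity m = 1 := by
  rw [parity, h.neg_one_pow]; norm_num

theorem parity_odd {m : ℕ} (h : Odd m) : parity m = 0 := by
  rw [parity, h.neg_one_pow]; norm_num

theorem eisConst_odd {m : ℕ} (h : Odd m) (hm : 3 ≤ m) : eisConst m = 0 := by
  rw [eisConst, bernoulli_eq_zero_of_odd h (by omega)]; simp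

theorem eisE_odd {m : ℕ} (h : Odd m) (hm : 3 ≤ m) (τ : ℍ) : eisE m τ = 0 := by
  rw [eisE_eq, eisFun, eisConst_odd h hm, parity_odd h]; simp

theorem two_mul_zeta_even {m : ℕ} (h : Even m) (hm : 3 ≤ m) :
    2 * riemannZeta m = (2 * Real.pi * Complex.I) ^ m * (2 / ((m - 1).factorial : ℂ)) *
      eisConst m := by
  obtain ⟨k, rfl⟩ := h
  have hk : k ≠ 0 := by omega
  have e1 : ((k + k : ℕ) : ℂ) = 2 * (k : ℂ) := by push_cast; ring
  rw [e1, riemannZeta_two_mul_nat hk, eisConst, ← two_mul]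
  have e2 : (2 * k).factorial = 2 * k * (2 * k - 1).factorial :=
    (Nat.mul_factorial_pred (by omega)).symm
  have e3 : (2 : ℂ) ^ (2 * k) = 2 * 2 ^ (2 * k - 1) := by
    rw [← pow_succ']; congr 1; omega
  have h1 : ((2 * k - 1).factorial : ℂ) ≠ 0 := by exact_mod_cast Nat.factorial_ne_zero _
  have h2 : (k : ℂ) ≠ 0 := by exact_mod_cast hk
  rw [e2, mul_pow, mul_pow, pow_mul Complex.I, Complex.I_sq, e3, pow_succ (-1 : ℂ)]
  push_cast
  field_simp

/-- For even weight this is the classical q-expansion, with ζ(m) rewritten by Euler's formula. For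
odd weight the symmetry v ↦ -v kills the lattice sum, and `eisE m` is zero as well, so later
arguments need not separate parities. -/
theorem tsum_eisSummand {m : ℕ} (hm : 3 ≤ m) (τ : ℍ) :
    ∑' v : Fin 2 → ℤ, EisensteinSeries.eisSummand (m : ℤ) v τ =
      (2 * Real.pi * Complex.I) ^ m * (2 / ((m - 1).factorial : ℂ)) * eisE m τ := by
  rcases Nat.even_or_odd m with h | h
  · rw [tsum_eisSummand_eq_tsum_sigma_mul_cexp_pow hm h τ, two_mul_zeta_even h hm, eisE, parity_even h |>
      (fun e => (show (1 + (-1 : ℂ) ^ m) / 2 = 1 from e)),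
      tsum_pnat_eq_tsum_succ (f := fun n ↦ (ArithmeticFunction.sigma (m - 1) n : ℂ) *
        Complex.exp (2 * Real.pi * Complex.I * τ) ^ n), eisConst]
    have : (-2 * (Real.pi : ℂ) * Complex.I) ^ m = (2 * Real.pi * Complex.I) ^ m := by
      rw [neg_mul, neg_mul, h.neg_pow]
    rw [this]
    ring
  · have h1 : ∑' v : Fin 2 → ℤ, EisensteinSeries.eisSummand (m : ℤ) v τ =
        -∑' v : Fin 2 → ℤ, EisensteinSeries.eisSummand (m : ℤ) v τ := by
      conv_lhs => rw [← (Equiv.neg (Fin 2 → ℤ)).tsum_eq]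
      rw [← tsum_neg]
      refine tsum_congr fun v => ?_
      rw [EisensteinSeries.eisSummand, EisensteinSeries.eisSummand, zpow_neg, zpow_neg,
        zpow_natCast, zpow_natCast, ← inv_neg, ← h.neg_pow]
      congr 2
      simp
      ring
    rw [eisE_odd h hm, mul_zero]
    linear_combination h1 / 2

theorem latticeG_eq {m : ℕ} (hm : 3 ≤ m) (τ : ℍ) : latticeG m τ =
    (2 * Real.pi * Complex.I) ^ m * (2 / ((m - 1).factorial : ℂ)) * eisE m τ := by
  obtain ⟨k, rfl⟩ : ∃ k, m = k + 3 := ⟨m - 3, by omega⟩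
  rw [← tsum_eisSummand hm τ]
  rw [latticeG]
  push_cast
  rfl

theorem modG_eq {m : ℕ} (hm : 3 ≤ m) (τ : ℍ) : modG m τ =
    4 * Real.pi * Complex.I / ((m - 1).factorial : ℂ) * eisE m τ := by
  rw [modG, latticeG_eq hm, zpow_sub₀ Complex.two_pi_I_ne_zero, zpow_one, zpow_natCast]
  have := pow_ne_zero m Complex.two_pi_I_ne_zero
  field_simp
  ring

/-- Modularity is read off from the lattice sum, whose terms are permuted by right multiplication of
row vectors by γ up to the automorphy factor. -/
theorem eisE_smul {m : ℕ} (hm : 3 ≤ m) (γ : Matrix.SpecialLinearGroup (Fin 2) ℤ) (τ : ℍ) :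
    eisE m (γ • τ) = ((γ 1 0 : ℂ) * τ + (γ 1 1 : ℂ)) ^ m * eisE m τ := by
  have hd : denom γ τ = (γ 1 0 : ℂ) * τ + (γ 1 1 : ℂ) := by
    simp [UpperHalfPlane.denom]
  let e : (Fin 2 → ℤ) ≃ (Fin 2 → ℤ) :=
    { toFun := fun v => Matrix.vecMul v (γ : Matrix (Fin 2) (Fin 2) ℤ)
      invFun := fun v => Matrix.vecMul v ((γ⁻¹ : Matrix.SpecialLinearGroup (Fin 2) ℤ) :
        Matrix (Fin 2) (Fin 2) ℤ)
      left_inv := fun v => by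
        simp only [Matrix.vecMul_vecMul, ← Matrix.SpecialLinearGroup.coe_mul, mul_inv_cancel,
          Matrix.SpecialLinearGroup.coe_one, Matrix.vecMul_one]
      right_inv := fun v => by
        simp only [Matrix.vecMul_vecMul, ← Matrix.SpecialLinearGroup.coe_mul, inv_mul_cancel,
          Matrix.SpecialLinearGroup.coe_one, Matrix.vecMul_one] }
  have h1 : ∑' v : Fin 2 → ℤ, EisensteinSeries.eisSummand (m : ℤ) v (γ • τ) =
      ((γ 1 0 : ℂ) * τ + (γ 1 1 : ℂ)) ^ m *
        ∑' v : Fin 2 → ℤ, EisensteinSeries.eisSummand (m : ℤ) v τ := by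
    rw [← e.tsum_eq (fun v => EisensteinSeries.eisSummand (m : ℤ) v τ), ← tsum_mul_left]
    refine tsum_congr fun v => ?_
    rw [EisensteinSeries.eisSummand_SL2_apply, zpow_natCast, hd]
    rfl
  rw [tsum_eisSummand hm, tsum_eisSummand hm] at h1
  have h2 : (2 * Real.pi * Complex.I) ^ m * (2 / ((m - 1).factorial : ℂ)) ≠ 0 := by
    have : ((m - 1).factorial : ℂ) ≠ 0 := by exact_mod_cast Nat.factorial_ne_zero _
    exact mul_ne_zero (pow_ne_zero _ Complex.two_pi_I_ne_zero) (div_ne_zero two_ne_zero this)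
  apply mul_left_cancel₀ h2
  rw [h1]
  ring

/-! ### Primitives of polynomial multiples of `E_m` -/

theorem smallInt_add (c : ℕ → ℂ) (M : ℕ) (p r : Polynomial ℂ) (z : ℂ) :
    smallInt c M (p + r) z = smallInt c M p z + smallInt c M r z := by
  simp only [smallInt, ← Finset.sum_add_distrib]
  refine Finset.sum_congr rfl fun s _ => ?_
  rw [iterate_map_add, Polynomial.eval_add]
  ring

theorem smallInt_smul (c : ℕ → ℂ) (M : ℕ) (a : ℂ) (p : Polynomial ℂ) (z : ℂ) :
    smallInt c M (a • p) z = a * smallInt c M p z := by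
  simp only [smallInt, Finset.mul_sum]
  refine Finset.sum_congr rfl fun s _ => ?_
  rw [Polynomial.iterate_derivative_smul, Polynomial.eval_smul, smul_eq_mul]
  ring

/-- The regularized integral of `p(z) E_m(z)` from `τ` to the tangential base point, as a linear
function of the polynomial `p`, of degree less than `m`. -/
def eisPrim (m : ℕ) (τ : ℂ) : Polynomial ℂ →ₗ[ℂ] ℂ where
  toFun p := -eisConst m * (polyInt p).eval τ - parity m * smallInt (sigCoeff m) m p τ
  map_add' p r := by rw [polyInt_add, smallInt_add, Polynomial.eval_add]; ring
  map_smul' a p := by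
    rw [smallInt_smul, Polynomial.smul_eq_C_mul, polyInt_C_mul]; simp; ring

theorem eisPrim_apply (m : ℕ) (τ : ℂ) (p : Polynomial ℂ) : eisPrim m τ p =
    -eisConst m * (polyInt p).eval τ - parity m * smallInt (sigCoeff m) m p τ := rfl

theorem tangInt_mul_eisE {m : ℕ} {p : Polynomial ℂ} (hp : p.natDegree < m) {g : ℍ → ℂ}
    (hg : ∀ z : ℍ, g z = p.eval (z : ℂ) * eisE m z) (τ : ℍ) : tangInt g τ = eisPrim m τ p :=
  tangInt_polynomial_mul (hasPolyGrowth_sigCoeff m) _ _ hp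
    (fun z => by rw [hg, eisE_eq, eisFun]) τ

theorem hasDerivAt_eisPrim {m : ℕ} {p : Polynomial ℂ} (hp : p.natDegree < m) {z : ℂ}
    (hz : 0 < z.im) : HasDerivAt (fun z => eisPrim m z p) (-(p.eval z * eisFun m z)) z := by
  have h1 := ((polyInt p).hasDerivAt z).const_mul (-eisConst m)
  have h2 := ((hasPolyGrowth_sigCoeff m).hasDerivAt_smallInt hp hz).const_mul (parity m)
  refine (h1.sub h2).congr_deriv ?_
  rw [derivative_polyInt, eisFun]
  ring

/-- By linearity in the polynomial factor, the coefficientwise definition reassembles into one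
regularized integral of a power of a linear form. In this shape the action of γ is visible. -/
theorem eval_eisInt {m : ℕ} (hm : 2 ≤ m) (τ : ℍ) (v : Fin 2 → ℂ) :
    MvPolynomial.eval v (eisInt m τ) = (2 * Real.pi * Complex.I) ^ (m - 1) *
      eisPrim m τ ((Polynomial.C (v 0) - Polynomial.C (v 1) * Polynomial.X) ^ (m - 2)) := by
  have h1 : (Polynomial.C (v 0) - Polynomial.C (v 1) * Polynomial.X) ^ (m - 2) =
      ∑ j ∈ Finset.range (m - 1), (((m - 2).choose j : ℂ) * (-1) ^ j * v 0 ^ (m - 2 - j) *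
        v 1 ^ j) • (Polynomial.X ^ j : Polynomial ℂ) := by
    rw [sub_eq_neg_add, add_pow, show m - 2 + 1 = m - 1 by omega]
    refine Finset.sum_congr rfl fun j _ => ?_
    rw [Polynomial.smul_eq_C_mul]
    simp only [Polynomial.C_mul, Polynomial.C_pow, Polynomial.C_neg, Polynomial.C_1,
      Polynomial.C_eq_natCast]
    rw [neg_eq_neg_one_mul, mul_pow, mul_pow]
    ring
  rw [h1, map_sum, eisInt, map_sum, Finset.mul_sum]
  refine Finset.sum_congr rfl fun j hj => ?_
  have hj' := Finset.mem_range.mp hj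
  rw [map_smul, tangInt_mul_eisE (m := m) (p := Polynomial.X ^ j)
    (by rw [Polynomial.natDegree_X_pow]; omega) (fun z => by simp)]
  simp
  ring

theorem natDegree_linear_pow_lt {m : ℕ} (hm : 2 ≤ m) (x y : ℂ) :
    ((Polynomial.C x - Polynomial.C y * Polynomial.X) ^ (m - 2)).natDegree < m := by
  have h1 : (Polynomial.C x - Polynomial.C y * Polynomial.X).natDegree ≤ 1 := by
    compute_degree
  exact (Polynomial.natDegree_pow_le_of_le (m - 2) h1).trans_lt (by omega)

/-- The difference [E_m](τ) - [E_m](γτ)|_γ does not depend on τ: in its derivative the factor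
(cz+d)^m from E_m is balanced by (cz+d)^{-2} from the derivative of the Möbius map and
(cz+d)^{-(m-2)} from the linear form. Its value is thus the one at the base point i, where the
cocycle is defined. -/
theorem eisInt_eq_cocycle_add (γ : Matrix.SpecialLinearGroup (Fin 2) ℤ) {m : ℕ} (hm : 4 ≤ m)
    (τ : ℍ) : eisInt m τ = eisCocycle m γ + polyAct γ (eisInt m (γ • τ)) := by
  have hdet : (γ 0 0 : ℂ) * γ 1 1 - γ 0 1 * γ 1 0 = 1 := by
    have := γ.det_coe
    rw [Matrix.det_fin_two] at this
    exact_mod_cast this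
  rw [eisCocycle]
  -- Over an infinite field polynomials may be compared by their values, which turns the claim into
  -- one about scalar functions of τ for fixed `v`.
  refine MvPolynomial.funext fun v => ?_
  have hact : ∀ P : MvPolynomial (Fin 2) ℂ, MvPolynomial.eval v (polyAct γ P) =
      MvPolynomial.eval (fun i => (γ i 0 : ℂ) * v 0 + (γ i 1 : ℂ) * v 1) P := by
    intro P
    rw [polyAct]
    induction P using MvPolynomial.induction_on with
    | C r => simp
    | add p q hp hq => simp only [map_add, hp, hq]
    | mul_X p i hp => rw [map_mul, map_mul, hp, map_mul]; simp
  rw [map_add, map_sub, hact, hact, eval_eisInt (by omega), eval_eisInt (by omega),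
    eval_eisInt (by omega), eval_eisInt (by omega)]
  set p := (Polynomial.C (v 0) - Polynomial.C (v 1) * Polynomial.X) ^ (m - 2) with hp
  set r := (Polynomial.C ((γ 0 0 : ℂ) * v 0 + (γ 0 1 : ℂ) * v 1) -
    Polynomial.C ((γ 1 0 : ℂ) * v 0 + (γ 1 1 : ℂ) * v 1) * Polynomial.X) ^ (m - 2) with hr
  have hpd : p.natDegree < m := natDegree_linear_pow_lt (by omega) _ _
  have hrd : r.natDegree < m := natDegree_linear_pow_lt (by omega) _ _
  let mob : ℂ → ℂ := fun z => ((γ 0 0 : ℂ) * z + γ 0 1) / ((γ 1 0 : ℂ) * z + γ 1 1)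
  have hmob : ∀ τ : ℍ, ((γ • τ : ℍ) : ℂ) = mob τ := fun τ => by
    rw [UpperHalfPlane.coe_specialLinearGroup_apply]; simp [mob]
  let D : ℂ → ℂ := fun z => eisPrim m z p - eisPrim m (mob z) r
  have hD : ∀ z : ℂ, 0 < z.im → HasDerivAt D 0 z := by
    intro z hz
    let t : ℍ := ⟨z, hz⟩
    have ht : (t : ℂ) = z := rfl
    have hden : (γ 1 0 : ℂ) * z + γ 1 1 ≠ 0 := by
      have := UpperHalfPlane.denom_ne_zero γ t
      simpa [UpperHalfPlane.denom] using this
    have h1 : HasDerivAt mob (1 / ((γ 1 0 : ℂ) * z + γ 1 1) ^ 2) z := by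
      have hn : HasDerivAt (fun z : ℂ => (γ 0 0 : ℂ) * z + γ 0 1) (γ 0 0 : ℂ) z := by
        simpa using ((hasDerivAt_id z).const_mul (γ 0 0 : ℂ)).add_const (γ 0 1 : ℂ)
      have hd : HasDerivAt (fun z : ℂ => (γ 1 0 : ℂ) * z + γ 1 1) (γ 1 0 : ℂ) z := by
        simpa using ((hasDerivAt_id z).const_mul (γ 1 0 : ℂ)).add_const (γ 1 1 : ℂ)
      refine (hn.div hd hden).congr_deriv ?_
      congr 1
      linear_combination hdet
    have him : 0 < (mob z).im := by rw [← ht, ← hmob]; exact (γ • t).im_pos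
    have h2 := (hasDerivAt_eisPrim hpd hz).sub ((hasDerivAt_eisPrim hrd him).comp z h1)
    refine h2.congr_deriv ?_
    have h3 : eisFun m (mob z) = ((γ 1 0 : ℂ) * z + γ 1 1) ^ m * eisFun m z := by
      rw [← ht, ← hmob, ← eisE_eq, ← eisE_eq, eisE_smul (by omega)]
    have h4 : r.eval (mob z) * ((γ 1 0 : ℂ) * z + γ 1 1) ^ (m - 2) = p.eval z := by
      rw [hr, hp, Polynomial.eval_pow, Polynomial.eval_pow, ← mul_pow]
      congr 1
      simp only [mob, Polynomial.eval_sub, Polynomial.eval_mul, Polynomial.eval_C,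
        Polynomial.eval_X]
      field_simp
      linear_combination (v 0 - v 1 * z) * hdet
    obtain ⟨k, rfl⟩ : ∃ k, m = k + 2 := ⟨m - 2, by omega⟩
    rw [h3, ← h4]
    simp only [Nat.add_sub_cancel]
    field_simp
    ring
  have hopen : IsOpen {z : ℂ | 0 < z.im} := isOpen_lt continuous_const Complex.continuous_im
  have hconst : D τ = D UpperHalfPlane.I :=
    hopen.is_const_of_deriv_eq_zero (convex_halfSpace_im_gt 0).isPreconnected
      (fun z hz => (hD z hz).differentiableAt.differentiableWithinAt) (fun z hz => (hD z hz).deriv)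
      τ.im_pos UpperHalfPlane.I.im_pos
  simp only [D, ← hmob] at hconst
  linear_combination (2 * Real.pi * Complex.I) ^ (m - 1) * hconst

/-! ### The iterated integrals `Γ(0, …, 0, m)` -/

/-- Each zero contributes the constant 𝔾_0 = -2πi, and integration from τ to the base point
contributes minus a primitive. The signs cancel, so every further zero gives a factor 2πi and one
more primitive, normalised to vanish at 0 on the polynomial part and at i∞ on the q-series. -/
theorem iterG_zeros {m : ℕ} (hm : 3 ≤ m) (j : ℕ) (τ : ℍ) :
    iterG (List.replicate j 0 ++ [m]) τ =
      -((2 * Real.pi * Complex.I) ^ j * (4 * Real.pi * Complex.I / ((m - 1).factorial : ℂ)) *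
        (eisConst m * (τ : ℂ) ^ (j + 1) / ((j + 1).factorial : ℂ) +
          parity m * qs (antiCoeff (sigCoeff m) (j + 1)) τ)) := by
  have hc := hasPolyGrowth_sigCoeff m
  set κ : ℂ := 4 * Real.pi * Complex.I / ((m - 1).factorial : ℂ) with hκ
  induction j generalizing τ with
  | zero =>
    have h1 : iterG (List.replicate 0 0 ++ [m]) τ =
        tangInt (fun z => modG m z * iterG [] z) τ := rfl
    rw [h1, tangInt_mul_eisE (m := m) (p := Polynomial.C κ) (by simp; omega)
      (fun z => by rw [modG_eq hm, iterG]; simp [hκ])]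
    have h2 : Polynomial.C κ = κ • (Polynomial.monomial 0 (1 : ℂ)) := by
      simp [Polynomial.smul_eq_C_mul]
    have h3 : smallInt (sigCoeff m) m (Polynomial.monomial 0 1) τ =
        qs (antiCoeff (sigCoeff m) 1) τ := by
      rw [smallInt, Finset.sum_eq_single 0]
      · simp
      · intro s _ hs
        rw [Polynomial.iterate_derivative_eq_zero (by simp; omega)]
        simp
      · simp; omega
    rw [h2, map_smul, eisPrim_apply, polyInt_monomial, h3]
    simp
    ring
  | succ j ih =>
    have h1 : iterG (List.replicate (j + 1) 0 ++ [m]) τ =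
        tangInt (fun z => modG 0 z * iterG (List.replicate j 0 ++ [m]) z) τ := rfl
    have h0 : ∀ z, modG 0 z = -(2 * Real.pi * Complex.I) := fun z => by
      rw [modG, latticeG]; simp
    set A : ℂ := (2 * Real.pi * Complex.I) ^ (j + 1) * κ with hA
    have hf : ((j + 1).factorial : ℂ) ≠ 0 := by exact_mod_cast Nat.factorial_ne_zero _
    have hj : (j : ℂ) + 1 + 1 ≠ 0 := by exact_mod_cast (j + 1).succ_ne_zero
    rw [h1, tangInt_eq
      (p := Polynomial.monomial (j + 1) (A * eisConst m / ((j + 1).factorial : ℂ)))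
      (P := Polynomial.monomial (j + 2) (-(A * eisConst m / ((j + 2).factorial : ℂ))))
      (G := fun z => A * parity m * qs (antiCoeff (sigCoeff m) (j + 1)) z)
      (F := fun z => -(A * parity m) * qs (antiCoeff (sigCoeff m) (j + 2)) z)]
    · rw [Polynomial.eval_monomial, hA]; ring
    · intro z
      rw [h0, ih, Polynomial.eval_monomial, hA, pow_succ]; ring
    · intro z hz
      refine ((hc.hasDerivAt_anti (j + 1) hz).const_mul (-(A * parity m))).congr_deriv ?_
      ring
    · intro z hz
      exact continuousAt_const.mul ((hc.antiCoeff (j + 1)).hasDerivAt hz).continuousAt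
    · rw [Polynomial.derivative_monomial, ← map_neg]
      congr 1
      rw [Nat.factorial_succ (j + 1)]
      push_cast
      field_simp
      ring
    · simp
    · have := ((hc.antiCoeff (j + 1)).vertDecay 1).const_mul (A * parity m)
      simpa using this
    · have := ((hc.antiCoeff (j + 2)).vertDecay 1).const_mul (-(A * parity m))
      simpa using this

/-! ### `ℰ*` in terms of the Eisenstein integrals -/

theorem coeff_linSubst_diag (u v : ℂ) (K : MvPowerSeries (Fin 2) ℂ) (p r : ℕ) :
    MvPowerSeries.coeff (bideg p r) (linSubst u 0 0 v K) =
      u ^ p * v ^ r * MvPowerSeries.coeff (bideg p r) K := by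
  have h1 : ∀ e : Fin 2 →₀ ℕ, linWeight u 0 0 v e (bideg p r) =
      if e = bideg p r then u ^ p * v ^ r else 0 := by
    intro e
    have h2 : linForm u 0 ^ e 0 * linForm 0 v ^ e 1 =
        MvPolynomial.monomial e (u ^ e 0 * v ^ e 1) := by
      conv_rhs => rw [← bideg_eta e]
      rw [bideg, ← MvPolynomial.monomial_mul, ← MvPolynomial.C_mul_X_pow_eq_monomial,
        ← MvPolynomial.C_mul_X_pow_eq_monomial]
      simp [linForm, mul_pow]
    rw [linWeight, h2, MvPolynomial.coeff_monomial]
    split_ifs with h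
    · rw [h]; simp
    · rfl
  rw [coeff_linSubst, finsum_eq_single _ (bideg p r)]
  · rw [h1, if_pos rfl, mul_comm]
  · intro e he
    rw [h1, if_neg he, mul_zero]

theorem coeff_eisInt {m p l : ℕ} (h : p + l + 2 = m) (τ : ℍ) :
    MvPolynomial.coeff (bideg p l) (eisInt m τ) = (2 * Real.pi * Complex.I) ^ (m - 1) *
      ((m - 2).choose l : ℂ) * (-1) ^ l * eisPrim m τ (Polynomial.X ^ l) := by
  have h1 : ∀ j, (MvPolynomial.X 0 ^ (m - 2 - j) * MvPolynomial.X 1 ^ j : MvPolynomial (Fin 2) ℂ) =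
      MvPolynomial.monomial (bideg (m - 2 - j) j) 1 := by
    intro j
    rw [MvPolynomial.X_pow_eq_monomial, MvPolynomial.X_pow_eq_monomial, MvPolynomial.monomial_mul,
      bideg, mul_one]
  rw [eisInt, MvPolynomial.coeff_sum, Finset.sum_eq_single l]
  · rw [h1, MvPolynomial.coeff_C_mul, MvPolynomial.coeff_monomial, if_pos, mul_one,
      tangInt_mul_eisE (m := m) (p := Polynomial.X ^ l)
      (by rw [Polynomial.natDegree_X_pow]; omega) (fun z => by simp)]
    rw [show m - 2 - l = p by omega]
  · intro j _ hj
    rw [h1, MvPolynomial.coeff_C_mul, MvPolynomial.coeff_monomial, if_neg, mul_zero]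
    intro h2
    exact hj (bideg_inj.mp h2).2
  · intro hl
    exact absurd (Finset.mem_range.mpr (by omega)) hl

theorem eval_polyInt_sub_pow (τ : ℂ) (j : ℕ) :
    (polyInt ((Polynomial.X - Polynomial.C τ) ^ j)).eval τ = -(-τ) ^ (j + 1) / (j + 1) := by
  have hj : (j : ℂ) + 1 ≠ 0 := by exact_mod_cast j.succ_ne_zero
  have h1 : (polyInt ((Polynomial.X - Polynomial.C τ) ^ j) -
      Polynomial.C ((1 : ℂ) / (j + 1)) * (Polynomial.X - Polynomial.C τ) ^ (j + 1)).derivative =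
      0 := by
    rw [Polynomial.derivative_sub, derivative_polyInt, Polynomial.derivative_C_mul,
      Polynomial.derivative_X_sub_C_pow]
    have : ((j + 1 : ℕ) : ℂ) = (j : ℂ) + 1 := by simp
    rw [this, Nat.add_sub_cancel, ← mul_assoc, ← Polynomial.C_mul, one_div_mul_cancel hj]
    simp
  have h2 := Polynomial.eq_C_of_derivative_eq_zero h1
  have h3 := congrArg (Polynomial.eval τ) h2
  have h4 := congrArg (Polynomial.eval 0) h2
  rw [Polynomial.eval_C] at h3 h4
  rw [← h4] at h3
  simp only [Polynomial.eval_sub, Polynomial.eval_mul, Polynomial.eval_C, Polynomial.eval_pow,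
    Polynomial.eval_X, sub_self, eval_zero_polyInt, zero_sub] at h3
  rw [zero_pow j.succ_ne_zero] at h3
  rw [mul_zero, sub_zero] at h3
  rw [h3]
  field_simp

/-- Cauchy's formula for repeated integration. All derivatives of (z - τ)^j except the `j`-th vanish
at z = τ, so a single iterated primitive survives, the one occurring in `iterG_zeros`. -/
theorem eisPrim_sub_pow {m j : ℕ} (hj : j < m) (τ : ℂ) :
    eisPrim m τ ((Polynomial.X - Polynomial.C τ) ^ j) = -(-1) ^ j * (j.factorial : ℂ) *
      (eisConst m * τ ^ (j + 1) / ((j + 1).factorial : ℂ) +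
        parity m * qs (antiCoeff (sigCoeff m) (j + 1)) τ) := by
  have h1 : smallInt (sigCoeff m) m ((Polynomial.X - Polynomial.C τ) ^ j) τ =
      (-1) ^ j * (j.factorial : ℂ) * qs (antiCoeff (sigCoeff m) (j + 1)) τ := by
    rw [smallInt, Finset.sum_eq_single j]
    · rw [Polynomial.iterate_derivative_X_sub_pow_self]
      simp
      ring
    · intro s _ hs
      rw [Polynomial.iterate_derivative_X_sub_pow]
      rcases lt_or_gt_of_ne hs with h | h
      · simp [Nat.sub_ne_zero_of_lt h]
      · simp [Nat.descFactorial_eq_zero_iff_lt.mpr h]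
    · intro h; exact absurd (Finset.mem_range.mpr hj) h
  have hj1 : (j : ℂ) + 1 ≠ 0 := by exact_mod_cast j.succ_ne_zero
  have hf : (j.factorial : ℂ) ≠ 0 := by exact_mod_cast j.factorial_ne_zero
  rw [eisPrim_apply, eval_polyInt_sub_pow, h1, Nat.factorial_succ, neg_pow τ]
  push_cast
  field_simp
  ring

/-- The common value of the coefficients of `ℰ*` and of the series of Eisenstein integrals. -/
def coreCoeff (i j : ℕ) (τ : ℂ) : ℂ :=
  (-1) ^ (i + 1) * (4 * Real.pi * Complex.I) / (i.factorial : ℂ) *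
    (eisConst (i + j + 2) * τ ^ (j + 1) / ((j + 1).factorial : ℂ) +
      parity (i + j + 2) * qs (antiCoeff (sigCoeff (i + j + 2)) (j + 1)) τ)

/-- The constant coefficient is excluded because it has weight 2, outside the absolutely convergent
range. It is the term removed in ℰ* and replaced by log η. -/
theorem coeff_genE {i j : ℕ} (h : 1 ≤ i + j) (τ : ℍ) :
    MvPowerSeries.coeff (bideg i j) (genE τ) = coreCoeff i j τ := by
  rw [genE, coeff_series, gammaL, show j + 1 - 1 = j by omega, iterG_zeros (by omega),
    coreCoeff, show i + j + 2 - 1 = i + j + 1 by omega]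
  have h1 : ((i + j + 1).factorial : ℂ) ≠ 0 := by exact_mod_cast Nat.factorial_ne_zero _
  have h2 : (i.factorial : ℂ) ≠ 0 := by exact_mod_cast Nat.factorial_ne_zero _
  have h3 := pow_ne_zero j Complex.two_pi_I_ne_zero
  generalize (2 * Real.pi * Complex.I : ℂ) ^ j = w at *
  field_simp
  ring

theorem coeff_dropConst (K : MvPowerSeries (Fin 2) ℂ) (i j : ℕ) :
    MvPowerSeries.coeff (bideg i j) (dropConst K) =
      if i + j = 0 then 0 else MvPowerSeries.coeff (bideg i j) K := by
  rw [dropConst, map_sub, MvPowerSeries.coeff_C]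
  split_ifs with h1 h2 h2
  · rw [h1, MvPowerSeries.coeff_zero_eq_constantCoeff, sub_self]
  · exfalso
    apply h2
    have h0 := DFunLike.congr_fun h1 0
    have h1 := DFunLike.congr_fun h1 1
    simp at h0 h1
    omega
  · exfalso
    apply h1
    obtain ⟨rfl, rfl⟩ : i = 0 ∧ j = 0 := by omega
    simp [bideg]
  · rw [sub_zero]

theorem coreCoeff_odd {i j : ℕ} (h : Odd (i + j)) (τ : ℂ) : coreCoeff i j τ = 0 := by
  have h' : Odd (i + j + 2) := h.add_even even_two
  have : 1 ≤ i + j := h.pos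
  rw [coreCoeff, eisConst_odd h' (by omega), parity_odd h']
  simp

/-- After moving the exponential to the other side, the coefficient of X^i Y^j is a binomial sum of
the integrals of z^{j-k} E_m with powers of -τ. It is the integral of (z - τ)^j E_m, with m = i + j
+ 2, which `eisPrim_sub_pow` evaluates. -/
theorem expOp_dropConst_genE (τ : ℍ) :
    expOp (shiftOp (τ : ℂ)) (dropConst (genE τ)) =
      MvPowerSeries.C 2 * laplace (linSubst (1 / (2 * Real.pi * Complex.I)) 0
        0 (-1 / (2 * Real.pi * Complex.I)) (eisSeries τ)) := by
  have key : dropConst (genE τ) = expOp (shiftOp (-(τ : ℂ)))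
      (MvPowerSeries.C 2 * laplace (linSubst (1 / (2 * Real.pi * Complex.I)) 0
        0 (-1 / (2 * Real.pi * Complex.I)) (eisSeries τ))) := by
    refine mvPowerSeries_ext fun i j => ?_
    have hterm : ∀ k ∈ Finset.range (j + 1), (-(τ : ℂ)) ^ k * ((i + k).choose k : ℂ) *
        MvPowerSeries.coeff (bideg (i + k) (j - k)) (MvPowerSeries.C 2 * laplace
          (linSubst (1 / (2 * Real.pi * Complex.I)) 0 0 (-1 / (2 * Real.pi * Complex.I))
            (eisSeries τ))) = if 2 ≤ i + j then
          4 * Real.pi * Complex.I / ((i.factorial : ℂ) * (j.factorial : ℂ)) *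
            ((-(τ : ℂ)) ^ k * (j.choose k : ℂ) *
              eisPrim (i + j + 2) τ (Polynomial.X ^ (j - k))) else 0 := by
      intro k hk
      have hk' := Finset.mem_range.mp hk
      have hsum : i + k + (j - k) = i + j := by omega
      rw [MvPowerSeries.coeff_C_mul, coeff_laplace, coeff_linSubst_diag, coeff_eisSeries]
      simp only [bideg_zero, bideg_one, hsum]
      split_ifs with hij
      · rw [coeff_eisInt (by omega), show i + j + 2 - 1 = i + j + 1 by omega,
          Nat.add_sub_cancel]
        -- The binomials from the translation and from (X - zY)^{m-2}, divided by the Laplace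
        -- factorial, leave the single binomial needed to expand (z - τ)^j.
        have hc : ((i + k).choose k : ℂ) * ((i + j).choose (j - k) : ℂ) /
            ((i + j).factorial : ℂ) = (j.choose k : ℂ) / ((i.factorial : ℂ) * j.factorial) := by
          rw [Nat.cast_choose ℂ (show k ≤ i + k by omega),
            Nat.cast_choose ℂ (show j - k ≤ i + j by omega),
            Nat.cast_choose ℂ (show k ≤ j by omega), show i + k - k = i by omega,
            show i + j - (j - k) = i + k by omega]
          have f1 : ((i + j).factorial : ℂ) ≠ 0 := by exact_mod_cast Nat.factorial_ne_zero _
          have f2 : ((i + k).factorial : ℂ) ≠ 0 := by exact_mod_cast Nat.factorial_ne_zero _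
          have f3 : (j.factorial : ℂ) ≠ 0 := by exact_mod_cast Nat.factorial_ne_zero _
          field_simp
        have hw := Complex.two_pi_I_ne_zero
        have e1 : (1 / (2 * Real.pi * Complex.I) : ℂ) ^ (i + k) *
            (-1 / (2 * Real.pi * Complex.I)) ^ (j - k) * ((2 * Real.pi * Complex.I) ^ (i + j + 1) *
            (-1) ^ (j - k)) = 2 * Real.pi * Complex.I := by
          rw [neg_div, neg_pow]
          have : ((-1 : ℂ) ^ (j - k)) * (-1) ^ (j - k) = 1 := by
            rw [← mul_pow]; norm_num
          calc _ = (1 / (2 * Real.pi * Complex.I) : ℂ) ^ (i + k) *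
                (1 / (2 * Real.pi * Complex.I)) ^ (j - k) * (2 * Real.pi * Complex.I) ^ (i + j + 1)
                * (((-1 : ℂ) ^ (j - k)) * (-1) ^ (j - k)) := by ring
            _ = _ := by
                rw [this, ← pow_add, hsum, one_div, inv_pow, pow_succ]
                field_simp
        calc _ = (-(τ : ℂ)) ^ k * 2 * ((1 / (2 * Real.pi * Complex.I) : ℂ) ^ (i + k) *
            (-1 / (2 * Real.pi * Complex.I)) ^ (j - k) * ((2 * Real.pi * Complex.I) ^ (i + j + 1) *
            (-1) ^ (j - k))) * (((i + k).choose k : ℂ) * ((i + j).choose (j - k) : ℂ) /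
            ((i + j).factorial : ℂ)) * eisPrim (i + j + 2) τ (Polynomial.X ^ (j - k)) := by ring
          _ = _ := by rw [e1, hc]; ring
      · simp
    rw [coeff_dropConst, coeff_expOp_shiftOp, Finset.sum_congr rfl hterm]
    by_cases h2 : 2 ≤ i + j
    · rw [if_neg (by omega), coeff_genE (by omega)]
      simp only [if_pos h2]
      have hpow : (Polynomial.X - Polynomial.C (τ : ℂ)) ^ j = ∑ k ∈ Finset.range (j + 1),
          ((-(τ : ℂ)) ^ k * (j.choose k : ℂ)) • (Polynomial.X ^ (j - k) : Polynomial ℂ) := by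
        rw [sub_eq_neg_add, add_pow]
        refine Finset.sum_congr rfl fun k _ => ?_
        rw [Polynomial.smul_eq_C_mul]
        simp only [Polynomial.C_mul, Polynomial.C_pow, Polynomial.C_neg, Polynomial.C_eq_natCast]
        ring
      have hprim := congrArg (eisPrim (i + j + 2) (τ : ℂ)) hpow
      rw [map_sum, eisPrim_sub_pow (by omega)] at hprim
      simp only [map_smul, smul_eq_mul] at hprim
      rw [← Finset.mul_sum, ← hprim]
      have f3 : (j.factorial : ℂ) ≠ 0 := by exact_mod_cast Nat.factorial_ne_zero _
      rcases Nat.even_or_odd (i + j) with he | ho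
      · have hs : (-1 : ℂ) ^ (i + 1) = -(-1) ^ j := by
          have h3 : (-1 : ℂ) ^ (i + j) = 1 := he.neg_one_pow
          rw [pow_add] at h3
          have h4 : ((-1 : ℂ) ^ j) * (-1) ^ j = 1 := by rw [← mul_pow]; norm_num
          rw [pow_succ]
          linear_combination (-(-1 : ℂ) ^ j) * h3 + (-1) ^ i * h4
        rw [coreCoeff, hs]
        field_simp
      · rw [coreCoeff_odd ho]
        have h' : Odd (i + j + 2) := ho.add_even even_two
        rw [eisConst_odd h' (by omega), parity_odd h']
        simp
    -- In degree 0 the coefficient has been dropped; in degree 1 the weight is 3 and the Eisenstein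
    -- series vanishes. This matches the restriction `m ≥ 4`.
    · simp only [if_neg h2, Finset.sum_const_zero]
      split_ifs with h0
      · rfl
      · rw [coeff_genE (by omega), coreCoeff_odd]
        rw [show i + j = 1 by omega]
        exact odd_one
  rw [key, expOp_shiftOp, expOp_shiftOp, linSubst_linSubst]
  simpa using linSubst_id _

/-! ### The theta function -/

/-- The exponential `exp(2πi x)`. -/
def expi (x : ℂ) : ℂ := Complex.exp (2 * Real.pi * Complex.I * x)

theorem expi_add (x y : ℂ) : expi (x + y) = expi x * expi y := by
  rw [expi, expi, expi, ← Complex.exp_add]; congr 1; ring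

theorem expi_ne_zero (x : ℂ) : expi x ≠ 0 := Complex.exp_ne_zero _

theorem expi_int_mul (n : ℤ) (x : ℂ) : expi (n * x) = expi x ^ n := by
  rw [expi, expi, ← Complex.exp_int_mul]; congr 1; ring

theorem norm_expi (x : ℂ) : ‖expi x‖ = Real.exp (-(2 * Real.pi * x.im)) := by
  rw [expi, Complex.norm_exp]; simp

/-- The coefficients of the theta function. -/
def thetaCoeff (τ : ℂ) (n : ℤ) : ℂ := (-1 : ℂ) ^ n * expi (((n : ℂ) + 1 / 2) ^ 2 / 2 * τ)

theorem thetaCoeff_succ (τ : ℂ) (n : ℤ) :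
    thetaCoeff τ (n + 1) = -(thetaCoeff τ n * expi τ ^ (n + 1)) := by
  rw [thetaCoeff, thetaCoeff, ← expi_int_mul, mul_assoc, ← expi_add, zpow_add_one₀ (by norm_num)]
  push_cast
  have : ((n : ℂ) + 1 + 1 / 2) ^ 2 / 2 * τ = (n + 1 / 2) ^ 2 / 2 * τ + (n + 1) * τ := by ring
  rw [this]
  ring

theorem theta_eq_tsum (ξ : ℂ) (τ : ℍ) :
    theta ξ τ = ∑' n : ℤ, thetaCoeff τ n * expi (((n : ℂ) + 1 / 2) * ξ) := by
  rw [theta]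
  refine tsum_congr fun n => ?_
  rw [thetaCoeff, mul_assoc ((-1 : ℂ) ^ n) (expi _), ← expi_add, expi]

/-- Completing the square, with 1/2 in the argument for the sign (-1)^n, reduces convergence and
differentiability to the even theta function. -/
theorem thetaTerm_eq (ξ : ℂ) (τ : ℍ) (n : ℤ) :
    thetaCoeff τ n * expi (((n : ℂ) + 1 / 2) * ξ) =
      expi (τ / 8 + ξ / 2) * jacobiTheta₂_term n (ξ + τ / 2 + 1 / 2) τ := by
  have h1 : (-1 : ℂ) ^ n = expi (n * (1 / 2)) := by
    rw [expi_int_mul, expi]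
    congr 1
    rw [show (2 * Real.pi * Complex.I * (1 / 2) : ℂ) = Real.pi * Complex.I by ring,
      Complex.exp_pi_mul_I]
  have h2 : jacobiTheta₂_term n (ξ + τ / 2 + 1 / 2) τ =
      expi (n * (ξ + τ / 2 + 1 / 2) + n ^ 2 * τ / 2) := by
    rw [jacobiTheta₂_term, expi]; congr 1; ring
  rw [thetaCoeff, h1, h2, ← expi_add, ← expi_add, ← expi_add]
  congr 1
  ring

theorem summable_thetaTerm (ξ : ℂ) (τ : ℍ) :
    Summable fun n : ℤ => thetaCoeff τ n * expi (((n : ℂ) + 1 / 2) * ξ) := by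
  simp_rw [thetaTerm_eq]
  exact ((summable_jacobiTheta₂_term_iff _ _).mpr τ.im_pos).mul_left _

theorem theta_eq_jacobiTheta₂ (ξ : ℂ) (τ : ℍ) :
    theta ξ τ = expi (τ / 8 + ξ / 2) * jacobiTheta₂ (ξ + τ / 2 + 1 / 2) τ := by
  rw [theta_eq_tsum]
  simp_rw [thetaTerm_eq]
  rw [tsum_mul_left, jacobiTheta₂]

theorem differentiable_theta (τ : ℍ) : Differentiable ℂ fun ξ => theta ξ τ := by
  simp_rw [theta_eq_jacobiTheta₂]
  intro ξ
  refine DifferentiableAt.mul ?_ ?_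
  · unfold expi; fun_prop
  · exact (differentiableAt_jacobiTheta₂_fst _ τ.im_pos).comp ξ
      (f := fun ξ : ℂ => ξ + τ / 2 + 1 / 2) (by fun_prop)

theorem theta_zero (τ : ℍ) : theta 0 τ = 0 := by
  have h : theta 0 τ = -theta 0 τ := by
    conv_lhs => rw [theta_eq_tsum, ← (Equiv.subLeft (-1 : ℤ)).tsum_eq]
    rw [theta_eq_tsum, ← tsum_neg]
    refine tsum_congr fun n => ?_
    have e1 : ((-1 : ℂ)) ^ ((Equiv.subLeft (-1 : ℤ)) n) = -(-1 : ℂ) ^ n := by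
      rw [Equiv.subLeft_apply, zpow_sub₀ (by norm_num), zpow_neg_one]
      rcases Int.even_or_odd n with h | h
      · simp [h.neg_one_zpow]
      · simp [h.neg_one_zpow]
    rw [thetaCoeff, thetaCoeff, e1, Equiv.subLeft_apply]
    push_cast
    rw [mul_zero, mul_zero, neg_mul, neg_mul]
    congr 4
    ring
  linear_combination h / 2

/-- On a horizontal line this is a Fourier series whose zeroth coefficient is 1, so it cannot vanish
identically. -/
theorem exists_jacobiTheta₂_ne_zero {τ : ℂ} (hτ : 0 < τ.im) (w : ℂ) :
    ∃ t : ℝ, jacobiTheta₂ (t + w) τ ≠ 0 := by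
  by_contra! h
  let f : ℤ → C(ℝ, ℂ) := fun n => ⟨fun t => jacobiTheta₂_term n (t + w) τ, by
    unfold jacobiTheta₂_term; fun_prop⟩
  have hs := ((summable_jacobiTheta₂_term_iff w τ).mpr hτ).norm
  have hnorm : ∀ n (t : ℝ), ‖f n t‖ = ‖jacobiTheta₂_term n w τ‖ := by
    intro n t
    simp only [f, ContinuousMap.coe_mk]
    rw [norm_jacobiTheta₂_term, norm_jacobiTheta₂_term]
    simp
  have h1 := intervalIntegral.hasSum_intervalIntegral_of_summable_norm (a := 0) (b := 1) (f := f) (by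
    refine Summable.of_nonneg_of_le (fun _ => norm_nonneg _) (fun n => ?_) hs
    rw [ContinuousMap.norm_le _ (norm_nonneg _)]
    intro x
    exact (hnorm n x).le)
  have h2 : ∫ x in (0 : ℝ)..1, ∑' n, f n x = 0 := by
    refine (intervalIntegral.integral_congr (g := fun _ => 0) fun x _ => ?_).trans (by simp)
    exact h x
  rw [h2] at h1
  have h3 : ∀ n : ℤ, ∫ x in (0 : ℝ)..1, f n x = if n = 0 then 1 else 0 := by
    intro n
    split_ifs with hn
    · subst hn
      simp [f, jacobiTheta₂_term]
    · have hc : (2 * Real.pi * Complex.I * n : ℂ) ≠ 0 :=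
        mul_ne_zero Complex.two_pi_I_ne_zero (by exact_mod_cast hn)
      have e1 : ∀ x : ℝ, f n x = jacobiTheta₂_term n w τ *
          Complex.exp (2 * Real.pi * Complex.I * n * x) := by
        intro x
        simp only [f, ContinuousMap.coe_mk, jacobiTheta₂_term]
        rw [← Complex.exp_add]
        congr 1
        ring
      simp_rw [e1]
      rw [intervalIntegral.integral_const_mul, integral_exp_mul_complex hc]
      have : Complex.exp (2 * Real.pi * Complex.I * n * (1 : ℝ)) = 1 := by
        rw [Complex.exp_eq_one_iff]
        exact ⟨n, by push_cast; ring⟩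
      rw [this]
      simp
  simp_rw [h3] at h1
  exact one_ne_zero ((hasSum_ite_eq (0 : ℤ) (1 : ℂ)).unique h1)

theorem exists_theta_ne_zero (τ : ℍ) : ∃ t : ℝ, theta t τ ≠ 0 := by
  obtain ⟨t, ht⟩ := exists_jacobiTheta₂_ne_zero τ.im_pos ((τ : ℂ) / 2 + 1 / 2)
  refine ⟨t, ?_⟩
  rw [theta_eq_jacobiTheta₂]
  refine mul_ne_zero (expi_ne_zero _) ?_
  rwa [add_assoc]

theorem not_eventually_theta_eq_zero (τ : ℍ) (ξ : ℂ) : ¬ ∀ᶠ α in 𝓝 ξ, theta α τ = 0 := by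
  intro h
  obtain ⟨t, ht⟩ := exists_theta_ne_zero τ
  have h1 : AnalyticOnNhd ℂ (fun ξ => theta ξ τ) Set.univ :=
    (differentiable_theta τ).differentiableOn.analyticOnNhd isOpen_univ
  have := h1.eqOn_of_preconnected_of_eventuallyEq (g := fun _ => 0) analyticOnNhd_const
    isPreconnected_univ (Set.mem_univ ξ) h (Set.mem_univ (t : ℂ))
  exact ht this

/-! ### The expansion of `θ(ξ + α) / θ(α)` -/

/-- The series `∑_{n ∈ ℤ} a_n / (1 - z q^{N - n})`, `a_n` the coefficients of the theta function. -/
def appell (z : ℂ) (τ : ℍ) (N : ℤ) : ℂ :=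
  ∑' n : ℤ, thetaCoeff τ n * (1 - z * expi τ ^ (N - n))⁻¹

theorem norm_expi_lt_one (τ : ℍ) : ‖expi τ‖ < 1 := by
  rw [norm_expi]; exact exp_neg_lt_one τ.im_pos

theorem norm_expi_pos (x : ℂ) : 0 < ‖expi x‖ := norm_pos_iff.mpr (expi_ne_zero _)

theorem norm_one_sub_ge {z : ℂ} (hz : ‖z‖ = 1) (τ : ℍ) {k : ℤ} (hk : k ≠ 0) :
    1 - ‖expi τ‖ ≤ ‖1 - z * expi τ ^ k‖ := by
  have hr0 := norm_expi_pos τ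
  have hr1 := norm_expi_lt_one τ
  set r := ‖expi τ‖ with hr
  have hn : ‖z * expi τ ^ k‖ = r ^ k := by rw [norm_mul, hz, one_mul, norm_zpow]
  rcases lt_or_gt_of_ne hk with h | h
  · have h1 : r ^ (-1 : ℤ) ≤ r ^ k := zpow_le_zpow_right_of_le_one₀ hr0 hr1.le (by omega)
    -- This is r + 1/r ≥ 2; it gives negative exponents the same lower bound 1 - |q| as positive
    -- ones.
    have h2 : 2 - r ≤ r ^ (-1 : ℤ) := by
      rw [zpow_neg_one, le_inv_comm₀ (by linarith) hr0, inv_eq_one_div, le_div_iff₀ (by linarith)]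
      nlinarith [sq_nonneg (1 - r)]
    have h3 := norm_sub_norm_le (z * expi τ ^ k) 1
    rw [norm_sub_rev, hn, norm_one] at h3
    linarith
  · have h1 : r ^ k ≤ r ^ (1 : ℤ) := zpow_le_zpow_right_of_le_one₀ hr0 hr1.le (by omega)
    rw [zpow_one] at h1
    have h3 := norm_sub_norm_le 1 (z * expi τ ^ k)
    rw [hn, norm_one] at h3
    linarith

theorem one_sub_ne_zero {z : ℂ} (hz : ‖z‖ = 1) (hz1 : z ≠ 1) (τ : ℍ) (k : ℤ) :
    1 - z * expi τ ^ k ≠ 0 := by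
  by_cases hk : k = 0
  · subst hk; simpa [sub_eq_zero] using hz1.symm
  · intro h
    have h1 := norm_one_sub_ge hz τ hk
    rw [h, norm_zero] at h1
    linarith [norm_expi_lt_one τ]

theorem exists_inv_bound {z : ℂ} (hz : ‖z‖ = 1) (τ : ℍ) :
    ∃ C : ℝ, 0 ≤ C ∧ ∀ k : ℤ, ‖(1 - z * expi τ ^ k)⁻¹‖ ≤ C := by
  have hr1 := norm_expi_lt_one τ
  have hpos : 0 < 1 - ‖expi τ‖ := by linarith
  refine ⟨max ‖(1 - z)⁻¹‖ (1 - ‖expi τ‖)⁻¹, le_max_of_le_left (norm_nonneg _), fun k => ?_⟩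
  by_cases hk : k = 0
  · subst hk; simp
  · refine le_max_of_le_right ?_
    rw [norm_inv]
    exact inv_anti₀ hpos (norm_one_sub_ge hz τ hk)

theorem summable_thetaCoeff (τ : ℍ) : Summable fun n : ℤ => ‖thetaCoeff τ n‖ := by
  simpa [expi] using (summable_thetaTerm 0 τ).norm

theorem tsum_thetaCoeff (τ : ℍ) : ∑' n : ℤ, thetaCoeff τ n = 0 := by
  have := theta_eq_tsum 0 τ
  rw [theta_zero] at this
  simpa [expi] using this.symm

theorem summable_appell {z : ℂ} (hz : ‖z‖ = 1) (τ : ℍ) (N : ℤ) :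
    Summable fun n : ℤ => thetaCoeff τ n * (1 - z * expi τ ^ (N - n))⁻¹ := by
  obtain ⟨C, _, hC⟩ := exists_inv_bound hz τ
  refine Summable.of_norm_bounded ((summable_thetaCoeff τ).mul_right C) fun n => ?_
  rw [norm_mul]
  exact mul_le_mul_of_nonneg_left (hC _) (norm_nonneg _)

/-- Shifting the summation index produces the factor z q^{N-n}/(1 - z q^{N-n}) = 1/(1 - z q^{N-n}) -
1, and the contribution of -1 is θ(0) = 0. -/
theorem appell_succ {z : ℂ} (hz : ‖z‖ = 1) (hz1 : z ≠ 1) (τ : ℍ) (N : ℤ) :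
    appell z τ (N + 1) = -(expi τ ^ (N + 1) * z * appell z τ N) := by
  have h1 : appell z τ (N + 1) =
      ∑' n : ℤ, thetaCoeff τ (n + 1) * (1 - z * expi τ ^ (N - n))⁻¹ := by
    rw [appell, ← (Equiv.addRight (1 : ℤ)).tsum_eq]
    refine tsum_congr fun n => ?_
    simp only [Equiv.coe_addRight, add_sub_add_right_eq_sub]
  have h2 : -(expi τ ^ (N + 1) * z * appell z τ N) = ∑' n : ℤ,
      (thetaCoeff τ (n + 1) * (1 - z * expi τ ^ (N - n))⁻¹ - thetaCoeff τ (n + 1)) := by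
    rw [appell, ← tsum_mul_left, ← tsum_neg]
    refine tsum_congr fun n => ?_
    have h3 := one_sub_ne_zero hz hz1 τ (N - n)
    have h4 : expi τ ^ (N + 1) = expi τ ^ (n + 1) * expi τ ^ (N - n) := by
      rw [← zpow_add₀ (expi_ne_zero _)]; congr 1; ring
    rw [thetaCoeff_succ, h4]
    linear_combination thetaCoeff τ n * expi τ ^ (n + 1) * mul_inv_cancel₀ h3
  have hs : Summable fun n : ℤ => thetaCoeff τ (n + 1) :=
    ((Equiv.addRight (1 : ℤ)).summable_iff (f := fun n => thetaCoeff τ n)).mpr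
      (summable_thetaCoeff τ).of_norm
  have hs' : Summable fun n : ℤ => thetaCoeff τ (n + 1) * (1 - z * expi τ ^ (N - n))⁻¹ := by
    have := ((Equiv.addRight (1 : ℤ)).summable_iff).mpr (summable_appell hz τ (N + 1))
    refine this.congr fun n => ?_
    simp only [Function.comp, Equiv.coe_addRight, add_sub_add_right_eq_sub]
  have h0 : ∑' n : ℤ, thetaCoeff τ (n + 1) = 0 := by
    rw [← tsum_thetaCoeff τ]
    exact (Equiv.addRight (1 : ℤ)).tsum_eq (fun n => thetaCoeff τ n)
  rw [h1, h2, hs'.tsum_sub hs, h0, sub_zero]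

theorem thetaCoeff_zero_ne_zero (τ : ℂ) : thetaCoeff τ 0 ≠ 0 := by
  simp [thetaCoeff, expi_ne_zero]

/-- The theta coefficients twisted by z^N satisfy the same first-order recursion, which determines a
sequence on ℤ from its value at 0. -/
theorem appell_eq {z : ℂ} (hz : ‖z‖ = 1) (hz1 : z ≠ 1) (τ : ℍ) (N : ℤ) :
    appell z τ N = appell z τ 0 / thetaCoeff τ 0 * (thetaCoeff τ N * z ^ N) := by
  have hz0 : z ≠ 0 := by rintro rfl; simp at hz
  have ha := thetaCoeff_zero_ne_zero τ
  induction N using Int.induction_on with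
  | zero => field_simp
  | succ i ih =>
    rw [appell_succ hz hz1, ih, thetaCoeff_succ, zpow_add_one₀ hz0]
    ring
  | pred i ih =>
    have h1 := appell_succ hz hz1 τ (-(i : ℤ) - 1)
    have h2 := thetaCoeff_succ τ (-(i : ℤ) - 1)
    have h3 := zpow_add_one₀ hz0 (-(i : ℤ) - 1)
    rw [sub_add_cancel] at h1 h2 h3
    rw [h1, h2, h3] at ih
    have h4 : expi τ ^ (-(i : ℤ)) * z ≠ 0 := mul_ne_zero (zpow_ne_zero _ (expi_ne_zero _)) hz0
    apply mul_left_cancel₀ h4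
    linear_combination -ih

theorem summable_kernel {z : ℂ} (hz : ‖z‖ = 1) (hz1 : z ≠ 1) (τ : ℍ) {α : ℂ} (h0 : 0 < α.im)
    (h1 : α.im < τ.im) : Summable fun k : ℤ => ‖expi α ^ k * (1 - z * expi τ ^ k)⁻¹‖ := by
  obtain ⟨C, hC0, hC⟩ := exists_inv_bound hz τ
  have hw1 : ‖expi α‖ < 1 := by rw [norm_expi]; exact exp_neg_lt_one h0
  have hw0 := norm_expi_pos α
  have hqw : ‖expi τ‖ / ‖expi α‖ < 1 := by
    rw [div_lt_one hw0, norm_expi, norm_expi, Real.exp_lt_exp]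
    have := mul_lt_mul_of_pos_left h1 Real.two_pi_pos
    simpa using this
  have hq0 := norm_expi_pos τ
  refine Summable.of_nat_of_neg ?_ ?_
  · refine Summable.of_nonneg_of_le (fun _ => norm_nonneg _) (fun k => ?_)
      ((summable_geometric_of_lt_one hw0.le hw1).mul_right C)
    rw [norm_mul, norm_zpow, zpow_natCast]
    exact mul_le_mul_of_nonneg_left (hC _) (by positivity)
  · refine Summable.of_nonneg_of_le (fun _ => norm_nonneg _) (fun k => ?_)
      ((summable_geometric_of_lt_one (by positivity) hqw).mul_right (1 + C))
    have h2 := one_sub_ne_zero hz hz1 τ (-(k : ℤ))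
    have hz0 : z ≠ 0 := by rintro rfl; simp at hz
    -- For negative exponents the kernel itself is of size |q|^k, which outweighs |w|^{-k} because
    -- |q| < |w|.
    have h3 : (1 - z * expi τ ^ (-(k : ℤ)))⁻¹ =
        -(z⁻¹ * expi τ ^ k * (1 - (1 - z * expi τ ^ (-(k : ℤ)))⁻¹)) := by
      have h4 : expi τ ^ k ≠ 0 := pow_ne_zero _ (expi_ne_zero _)
      rw [zpow_neg, zpow_natCast] at h2 ⊢
      have h5 : expi τ ^ k - z ≠ 0 := by
        intro h; apply h2; field_simp; simpa using h
      field_simp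
      ring
    have h6 : ‖1 - (1 - z * expi τ ^ (-(k : ℤ)))⁻¹‖ ≤ 1 + C :=
      (norm_sub_le _ _).trans (by rw [norm_one]; linarith [hC (-(k : ℤ))])
    rw [h3, norm_mul, norm_neg, norm_mul, norm_mul, norm_inv, hz, norm_zpow, norm_pow, zpow_neg,
      zpow_natCast, inv_one, one_mul, div_pow, div_eq_inv_mul, ← mul_assoc]
    exact mul_le_mul_of_nonneg_left h6 (by positivity)

/-- In the product of the two bilateral series, the coefficient of w^{N+1/2} is `appell (expi ξ) τ
N`. By `appell_eq` it is proportional to the corresponding coefficient of θ(ξ + α). -/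
theorem theta_mul_kernel {ξ : ℂ} (hz : ‖expi ξ‖ = 1) (hz1 : expi ξ ≠ 1) (τ : ℍ) {α : ℂ}
    (h0 : 0 < α.im) (h1 : α.im < τ.im) :
    theta α τ * ∑' k : ℤ, expi α ^ k * (1 - expi ξ * expi τ ^ k)⁻¹ =
      appell (expi ξ) τ 0 / thetaCoeff τ 0 * expi (-ξ / 2) * theta (ξ + α) τ := by
  have hs := summable_mul_of_summable_norm (summable_thetaTerm α τ).norm
    (summable_kernel hz hz1 τ h0 h1)
  rw [theta_eq_tsum, tsum_mul_tsum_of_summable_norm (summable_thetaTerm α τ).norm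
    (summable_kernel hz hz1 τ h0 h1)]
  let e : ℤ × ℤ ≃ ℤ × ℤ :=
    { toFun := fun p => (p.2, p.1 - p.2)
      invFun := fun p => (p.1 + p.2, p.1)
      left_inv := fun p => by simp
      right_inv := fun p => by simp }
  have hs' := (e.summable_iff).mpr hs
  refine (e.tsum_eq _).symm.trans (hs'.tsum_prod.trans ?_)
  rw [theta_eq_tsum, ← tsum_mul_left]
  refine tsum_congr fun N => ?_
  have h2 : ∀ n : ℤ, thetaCoeff τ n * expi (((n : ℂ) + 1 / 2) * α) *
      (expi α ^ (N - n) * (1 - expi ξ * expi τ ^ (N - n))⁻¹) =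
      expi (((N : ℂ) + 1 / 2) * α) * (thetaCoeff τ n * (1 - expi ξ * expi τ ^ (N - n))⁻¹) := by
    intro n
    have h3 : expi (((N : ℂ) + 1 / 2) * α) = expi (((n : ℂ) + 1 / 2) * α) * expi α ^ (N - n) := by
      rw [← expi_int_mul, ← expi_add]
      congr 1
      push_cast
      ring
    rw [h3]
    ring
  refine (tsum_congr h2).trans ?_
  rw [tsum_mul_left]
  have h3 : expi (((N : ℂ) + 1 / 2) * (ξ + α)) =
      expi (((N : ℂ) + 1 / 2) * α) * expi ξ ^ N * expi (ξ / 2) := by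
    rw [← expi_int_mul, ← expi_add, ← expi_add]
    congr 1
    ring
  have h4 : expi (-ξ / 2) * expi (ξ / 2) = 1 := by
    rw [← expi_add, show -ξ / 2 + ξ / 2 = 0 by ring]; simp [expi]
  have h5 := appell_eq hz hz1 τ N
  rw [appell] at h5
  rw [h5, h3]
  linear_combination (-(expi (((N : ℂ) + 1 / 2) * α)) * (appell (expi ξ) τ 0 / thetaCoeff τ 0 *
    (thetaCoeff τ N * expi ξ ^ N))) * h4

/-! ### The double series of the Kronecker function -/

/-- Weights `r^{(k+1)(m+1)}` with exponential growth `e^{(k+1)Y}` are summable. -/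
theorem summable_pair_exp {r Y : ℝ} (h0 : 0 ≤ r) (h1 : r < 1) (h : r * Real.exp Y < 1) :
    Summable fun p : ℕ × ℕ => r ^ ((p.1 + 1) * (p.2 + 1)) * Real.exp ((p.1 + 1) * Y) := by
  set ρ := r * Real.exp Y with hρ
  have hρ0 : 0 ≤ ρ := by positivity
  have hs : Summable fun p : ℕ × ℕ => ρ ^ p.1 * r ^ p.2 :=
    (summable_geometric_of_lt_one hρ0 h).mul_of_nonneg (summable_geometric_of_lt_one h0 h1)
      (fun _ => by positivity) (fun _ => by positivity)
  refine Summable.of_nonneg_of_le (fun _ => by positivity) (fun p => ?_) hs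
  have e1 : r ^ ((p.1 + 1) * (p.2 + 1)) * Real.exp ((p.1 + 1) * Y) =
      ρ ^ (p.1 + 1) * r ^ (p.2 * (p.1 + 1)) := by
    have : Real.exp (((p.1 : ℝ) + 1) * Y) = Real.exp Y ^ (p.1 + 1) := by
      rw [← Real.exp_nat_mul]; push_cast; rfl
    rw [this, hρ, mul_pow]
    ring
  rw [e1]
  refine mul_le_mul ?_ ?_ (by positivity) (by positivity)
  · exact pow_le_pow_of_le_one hρ0 h.le (by omega)
  · exact pow_le_pow_of_le_one h0 h1.le (by nlinarith)

/-- The terms of the double series of the Kronecker function. -/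
def pairTerm (z q y : ℂ) (p : ℕ × ℕ) : ℂ :=
  (z ^ (p.2 + 1) * Complex.exp ((p.1 + 1) * y) -
    z⁻¹ ^ (p.2 + 1) * Complex.exp (-((p.1 + 1) * y))) * q ^ ((p.1 + 1) * (p.2 + 1))

theorem norm_exp_le_exp_norm (k : ℕ) (y : ℂ) :
    ‖Complex.exp ((k + 1) * y)‖ ≤ Real.exp ((k + 1) * ‖y‖) := by
  rw [Complex.norm_exp]
  refine Real.exp_le_exp.mpr ((Complex.re_le_norm _).trans_eq ?_)
  rw [norm_mul]
  congr 1
  exact_mod_cast Complex.norm_natCast (k + 1)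

theorem summable_pair_pos {z q y : ℂ} (hz : ‖z‖ = 1) (hq : ‖q‖ < 1)
    (hy : ‖q‖ * Real.exp ‖y‖ < 1) : Summable fun p : ℕ × ℕ =>
      z ^ (p.2 + 1) * Complex.exp ((p.1 + 1) * y) * q ^ ((p.1 + 1) * (p.2 + 1)) := by
  refine Summable.of_norm_bounded (summable_pair_exp (norm_nonneg q) hq hy) fun p => ?_
  rw [norm_mul, norm_mul, norm_pow, norm_pow, hz, one_pow, one_mul, mul_comm]
  exact mul_le_mul_of_nonneg_left (norm_exp_le_exp_norm _ _) (by positivity)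

theorem summable_pair_neg {z q y : ℂ} (hz : ‖z‖ = 1) (hq : ‖q‖ < 1)
    (hy : ‖q‖ * Real.exp ‖y‖ < 1) : Summable fun p : ℕ × ℕ =>
      z⁻¹ ^ (p.2 + 1) * Complex.exp (-((p.1 + 1) * y)) * q ^ ((p.1 + 1) * (p.2 + 1)) := by
  have := summable_pair_pos (z := z⁻¹) (y := -y) (by rw [norm_inv, hz, inv_one]) hq
    (by rwa [norm_neg])
  simpa only [mul_neg] using this

theorem hasSum_geometric_succ {u : ℂ} (hu : ‖u‖ < 1) :
    HasSum (fun m : ℕ => u ^ (m + 1)) (u * (1 - u)⁻¹) := by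
  have := (hasSum_geometric_of_norm_lt_one hu).mul_left u
  simpa only [pow_succ'] using this

theorem tsum_geometric_pos {z Q : ℂ} (hz : ‖z‖ = 1) (hQ : ‖Q‖ < 1) (W : ℂ) :
    ∑' m : ℕ, z ^ (m + 1) * W * Q ^ (m + 1) = W * (1 - z * Q)⁻¹ - W := by
  have hu : ‖z * Q‖ < 1 := by rw [norm_mul, hz, one_mul]; exact hQ
  have h3 : (1 - z * Q) ≠ 0 := by
    intro h
    have : z * Q = 1 := by linear_combination -h
    rw [this, norm_one] at hu
    exact lt_irrefl _ hu
  have h2 := (hasSum_geometric_succ hu).mul_left W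
  have e : ∀ m : ℕ, z ^ (m + 1) * W * Q ^ (m + 1) = W * (z * Q) ^ (m + 1) := fun m => by
    rw [mul_pow]; ring
  rw [tsum_congr e, h2.tsum_eq]
  linear_combination -W * mul_inv_cancel₀ h3

theorem tsum_geometric_neg {z Q : ℂ} (hz : ‖z‖ = 1) (hQ : ‖Q‖ < 1) (hQ0 : Q ≠ 0) (W : ℂ) :
    ∑' m : ℕ, z⁻¹ ^ (m + 1) * W * Q ^ (m + 1) = -(W * (1 - z * Q⁻¹)⁻¹) := by
  have hz0 : z ≠ 0 := by rintro rfl; simp at hz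
  have hu : ‖z⁻¹ * Q‖ < 1 := by rw [norm_mul, norm_inv, hz, inv_one, one_mul]; exact hQ
  have h5 : 1 - z⁻¹ * Q ≠ 0 := by
    intro h
    have : z⁻¹ * Q = 1 := by linear_combination -h
    rw [this, norm_one] at hu
    exact lt_irrefl _ hu
  have a3 := mul_inv_cancel₀ hz0
  have a4 := mul_inv_cancel₀ hQ0
  have h3 : 1 - z * Q⁻¹ ≠ 0 := by
    intro h
    apply h5
    linear_combination (-z⁻¹ * Q) * h - Q * Q⁻¹ * a3 - a4
  have h2 := (hasSum_geometric_succ hu).mul_left W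
  have e : ∀ m : ℕ, z⁻¹ ^ (m + 1) * W * Q ^ (m + 1) = W * (z⁻¹ * Q) ^ (m + 1) := fun m => by
    rw [mul_pow]; ring
  have h6 : z⁻¹ * Q * (1 - z⁻¹ * Q)⁻¹ = -(1 - z * Q⁻¹)⁻¹ := by
    rw [← sub_eq_zero]
    have e2 : (z⁻¹ * Q * (1 - z⁻¹ * Q)⁻¹ - -(1 - z * Q⁻¹)⁻¹) *
        ((1 - z⁻¹ * Q) * (1 - z * Q⁻¹)) = 0 := by
      have a1 := mul_inv_cancel₀ h5
      have a2 := mul_inv_cancel₀ h3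
      linear_combination z⁻¹ * Q * (1 - z * Q⁻¹) * a1 + (1 - z⁻¹ * Q) * a2 - Q * Q⁻¹ * a3 - a4
    exact (mul_eq_zero.mp e2).resolve_right (mul_ne_zero h5 h3)
  rw [tsum_congr e, h2.tsum_eq, h6]
  ring

/-- The terms with k > 0 are expanded in powers of z q^k, those with k < 0 in powers of z^{-1}
q^{-k}. What is left over is 1/(1-z) from k = 0 and w/(1-w) from the leading 1 of the expansions
with k > 0. -/
theorem kernel_eq {z : ℂ} (hz : ‖z‖ = 1) (hz1 : z ≠ 1) (τ : ℍ) {α : ℂ} (h0 : 0 < α.im)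
    (h1 : ‖expi τ‖ * Real.exp ‖2 * Real.pi * Complex.I * α‖ < 1) :
    ∑' k : ℤ, expi α ^ k * (1 - z * expi τ ^ k)⁻¹ = z * (1 - z)⁻¹ + (1 - expi α)⁻¹ +
      ∑' p : ℕ × ℕ, pairTerm z (expi τ) (2 * Real.pi * Complex.I * α) p := by
  have hq := norm_expi_lt_one τ
  have hw1 : ‖expi α‖ < 1 := by rw [norm_expi]; exact exp_neg_lt_one h0
  have hwy : ∀ k : ℕ, Complex.exp ((k + 1) * (2 * Real.pi * Complex.I * α)) =
      expi α ^ (k + 1) := fun k => by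
    rw [expi, ← Complex.exp_nat_mul]; push_cast; rfl
  have hsp := summable_pair_pos hz hq h1
  have hsn := summable_pair_neg hz hq h1
  have hpt : ∑' p : ℕ × ℕ, pairTerm z (expi τ) (2 * Real.pi * Complex.I * α) p = _ - _ :=
    (tsum_congr fun p => sub_mul _ _ _).trans (hsp.tsum_sub hsn)
  have hq0 := expi_ne_zero (τ : ℂ)
  have hrow := fun k : ℕ => one_sub_ne_zero hz hz1 τ k
  clear h1
  simp only [Complex.exp_neg, hwy] at hsp hsn hpt
  rw [hpt]
  clear hpt hwy
  generalize expi α = w at *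
  generalize expi (τ : ℂ) = q at *
  have hqk : ∀ k : ℕ, ‖q ^ (k + 1)‖ < 1 := fun k => by
    rw [norm_pow]; exact pow_lt_one₀ (norm_nonneg _) hq (by omega)
  have hfp : ∀ k : ℕ, ∑' m : ℕ, z ^ (m + 1) * w ^ (k + 1) * q ^ ((k + 1) * (m + 1)) =
      w ^ (k + 1) * (1 - z * q ^ (k + 1))⁻¹ - w ^ (k + 1) := fun k => by
    simp only [pow_mul q]
    exact tsum_geometric_pos hz (hqk k) _
  have hfn : ∀ k : ℕ, ∑' m : ℕ, z⁻¹ ^ (m + 1) * (w ^ (k + 1))⁻¹ * q ^ ((k + 1) * (m + 1)) =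
      -((w ^ (k + 1))⁻¹ * (1 - z * (q ^ (k + 1))⁻¹)⁻¹) := fun k => by
    simp only [pow_mul q]
    exact tsum_geometric_neg hz (hqk k) (pow_ne_zero _ hq0) _
  have hS1 := hsp.prod.congr hfp
  have hS2 := hsn.prod.congr hfn
  have hgeo := hasSum_geometric_succ hw1
  have hS1' : Summable fun k : ℕ => w ^ (k + 1) * (1 - z * q ^ (k + 1))⁻¹ :=
    (hS1.add hgeo.summable).congr fun k => by ring
  have hneg : Summable fun k : ℕ => (w ^ (k + 1))⁻¹ * (1 - z * (q ^ (k + 1))⁻¹)⁻¹ := by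
    simpa using hS2.neg
  have hcast : ∀ k : ℕ, (-((k : ℤ) + 1)) = -((k + 1 : ℕ) : ℤ) := fun k => by push_cast; rfl
  have hI : ∑' k : ℤ, w ^ k * (1 - z * q ^ k)⁻¹ =
      ∑' k : ℕ, w ^ k * (1 - z * q ^ k)⁻¹ +
        ∑' k : ℕ, (w ^ (k + 1))⁻¹ * (1 - z * (q ^ (k + 1))⁻¹)⁻¹ := by
    rw [tsum_of_nat_of_neg_add_one (f := fun k : ℤ => w ^ k * (1 - z * q ^ k)⁻¹)]
    · simp only [hcast, zpow_neg, zpow_natCast]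
    · simp only [zpow_natCast]
      exact (summable_nat_add_iff 1).mp hS1'
    · simpa only [hcast, zpow_neg, zpow_natCast] using hneg
  rw [hI, ((summable_nat_add_iff (f := fun k : ℕ => w ^ k * (1 - z * q ^ k)⁻¹) 1).mp
    hS1').tsum_eq_zero_add, hsp.tsum_prod, hsn.tsum_prod, tsum_congr hfp, tsum_congr hfn,
    hS1'.tsum_sub hgeo.summable, hgeo.tsum_eq, tsum_neg]
  simp only [pow_zero, one_mul, mul_one]
  have hwne : 1 - w ≠ 0 := by
    intro h
    have : w = 1 := by linear_combination -h
    rw [this, norm_one] at hw1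
    exact lt_irrefl _ hw1
  have hzne : 1 - z ≠ 0 := sub_ne_zero.mpr hz1.symm
  linear_combination mul_inv_cancel₀ hzne - mul_inv_cancel₀ hwne

/-- The Taylor coefficients in `y` of the double series of the Kronecker function. -/
def pairCoeff (z q : ℂ) (n : ℕ) : ℂ :=
  ∑' p : ℕ × ℕ, (z ^ (p.2 + 1) - (-1) ^ n * z⁻¹ ^ (p.2 + 1)) *
    ((p.1 + 1 : ℂ) ^ n / (n.factorial : ℂ)) * q ^ ((p.1 + 1) * (p.2 + 1))

theorem hasSum_exp (x : ℂ) :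
    HasSum (fun n : ℕ => x ^ n / (n.factorial : ℂ)) (Complex.exp x) := by
  rw [Complex.exp_eq_exp_ℂ]
  exact NormedSpace.expSeries_div_hasSum_exp x

theorem hasSum_real_exp (x : ℝ) :
    HasSum (fun n : ℕ => x ^ n / (n.factorial : ℝ)) (Real.exp x) := by
  rw [Real.exp_eq_exp_ℝ]
  exact NormedSpace.expSeries_div_hasSum_exp x

/-- The terms of the double series of the Kronecker function, expanded in powers of `y`. -/
def pairExpand (z q y : ℂ) (p : ℕ × ℕ) (n : ℕ) : ℂ :=
  (z ^ (p.2 + 1) - (-1) ^ n * z⁻¹ ^ (p.2 + 1)) *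
    ((p.1 + 1 : ℂ) ^ n / (n.factorial : ℂ)) * q ^ ((p.1 + 1) * (p.2 + 1)) * y ^ n

theorem norm_pairExpand_le {z : ℂ} (hz : ‖z‖ = 1) (q y : ℂ) (p : ℕ × ℕ) (n : ℕ) :
    ‖pairExpand z q y p n‖ ≤ 2 * (‖q‖ ^ ((p.1 + 1) * (p.2 + 1)) *
      ((((p.1 : ℝ) + 1) * ‖y‖) ^ n / (n.factorial : ℝ))) := by
  have h1 : ‖z ^ (p.2 + 1) - (-1) ^ n * z⁻¹ ^ (p.2 + 1)‖ ≤ 2 := by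
    refine (norm_sub_le _ _).trans ?_
    simp only [norm_mul, norm_pow, norm_neg, norm_one, one_pow, norm_inv, hz, inv_one, one_mul]
    norm_num
  have h2 : ‖((p.1 : ℂ) + 1)‖ = (p.1 : ℝ) + 1 := by
    exact_mod_cast Complex.norm_natCast (p.1 + 1)
  rw [pairExpand, norm_mul, norm_mul, norm_mul, norm_div, norm_pow, norm_pow, norm_pow, h2,
    Complex.norm_natCast, mul_pow]
  calc _ ≤ 2 * (((p.1 : ℝ) + 1) ^ n / (n.factorial : ℝ)) *
        ‖q‖ ^ ((p.1 + 1) * (p.2 + 1)) * ‖y‖ ^ n := by gcongr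
    _ = _ := by ring

theorem hasSum_pairExpand (z q y : ℂ) (p : ℕ × ℕ) :
    HasSum (pairExpand z q y p) (pairTerm z q y p) := by
  have h1 := ((hasSum_exp (((p.1 : ℂ) + 1) * y)).mul_left (z ^ (p.2 + 1))).sub
    ((hasSum_exp (-(((p.1 : ℂ) + 1) * y))).mul_left (z⁻¹ ^ (p.2 + 1)))
  have h2 := h1.mul_right (q ^ ((p.1 + 1) * (p.2 + 1)))
  refine h2.congr_fun fun n => ?_
  rw [pairExpand, neg_pow (((p.1 : ℂ) + 1) * y) n, mul_pow]
  ring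

theorem summable_pairExpand {z q y : ℂ} (hz : ‖z‖ = 1) (hq : ‖q‖ < 1)
    (hy : ‖q‖ * Real.exp ‖y‖ < 1) :
    Summable fun x : (ℕ × ℕ) × ℕ => pairExpand z q y x.1 x.2 := by
  refine Summable.of_norm_bounded (g := fun x : (ℕ × ℕ) × ℕ =>
    2 * (‖q‖ ^ ((x.1.1 + 1) * (x.1.2 + 1)) *
      ((((x.1.1 : ℝ) + 1) * ‖y‖) ^ x.2 / (x.2.factorial : ℝ)))) ?_
    fun x => norm_pairExpand_le hz q y x.1 x.2
  have hB : ∀ p : ℕ × ℕ, HasSum (fun n : ℕ => 2 * (‖q‖ ^ ((p.1 + 1) * (p.2 + 1)) *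
      ((((p.1 : ℝ) + 1) * ‖y‖) ^ n / (n.factorial : ℝ))))
      (2 * (‖q‖ ^ ((p.1 + 1) * (p.2 + 1)) * Real.exp ((p.1 + 1) * ‖y‖))) := fun p =>
    ((hasSum_real_exp _).mul_left _).mul_left _
  rw [summable_prod_of_nonneg (fun x => by rw [Pi.zero_apply]; positivity)]
  refine ⟨fun p => (hB p).summable, ?_⟩
  simp only [fun p => (hB p).tsum_eq]
  exact (summable_pair_exp (norm_nonneg q) hq hy).mul_left 2

theorem hasSum_prod_swap {a b : Type*} {f : a × b → ℂ} {g : a → ℂ} {h : b → ℂ}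
    (hf : Summable f) (hg : ∀ x, HasSum (fun y => f (x, y)) (g x))
    (hh : ∀ y, HasSum (fun x => f (x, y)) (h y)) : HasSum h (∑' x, g x) := by
  have h1 : ∑' x, g x = ∑' x, f x := by
    rw [hf.tsum_prod]
    exact tsum_congr fun x => (hg x).tsum_eq.symm
  rw [h1]
  have h2 : HasSum (f ∘ Equiv.prodComm b a) (∑' x, f x) :=
    (Equiv.prodComm b a).hasSum_iff.mpr hf.hasSum
  exact h2.prod_fiberwise hh

/-- Both exponentials are expanded in powers of `y`; absolute convergence of the triple series
permits summing over the pairs first. -/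
theorem hasSum_pairCoeff {z q y : ℂ} (hz : ‖z‖ = 1) (hq : ‖q‖ < 1)
    (hy : ‖q‖ * Real.exp ‖y‖ < 1) :
    HasSum (fun n : ℕ => pairCoeff z q n * y ^ n) (∑' p : ℕ × ℕ, pairTerm z q y p) := by
  have hs := summable_pairExpand hz hq hy
  refine hasSum_prod_swap hs (hasSum_pairExpand z q y) fun n => ?_
  have h2 : Summable fun p : ℕ × ℕ => pairExpand z q y p n :=
    hs.comp_injective (i := fun p : ℕ × ℕ => (p, n)) fun p p' h => (Prod.ext_iff.mp h).1
  have h3 : ∑' p : ℕ × ℕ, pairExpand z q y p n = pairCoeff z q n * y ^ n := by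
    rw [pairCoeff, ← tsum_mul_right]
    rfl
  rw [← h3]
  exact h2.hasSum

/-! ### Bernoulli numbers -/

/-- The function `x/(e^x - 1)`. -/
def bernFun (x : ℂ) : ℂ := (dslope Complex.exp 0 x)⁻¹

theorem bernFun_zero : bernFun 0 = 1 := by
  simp [bernFun]

theorem bernFun_of_ne {x : ℂ} (hx : x ≠ 0) : bernFun x = x * (Complex.exp x - 1)⁻¹ := by
  rw [bernFun, dslope_of_ne _ hx, slope_def_field]
  simp [div_eq_mul_inv, mul_comm]

theorem analyticAt_dslope {f : ℂ → ℂ} (hf : Differentiable ℂ f) (a b : ℂ) :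
    AnalyticAt ℂ (dslope f a) b := by
  have h : DifferentiableOn ℂ (dslope f a) Set.univ :=
    (Complex.differentiableOn_dslope univ_mem).mpr hf.differentiableOn
  exact h.analyticAt univ_mem

theorem analyticAt_bernFun : AnalyticAt ℂ bernFun 0 :=
  (analyticAt_dslope Complex.differentiable_exp 0 0).inv (by simp)

/-- Leibniz' rule applied to B(x)(e^x - 1) = x gives the recursion that defines the Bernoulli
numbers. -/
theorem iteratedDeriv_bernFun (n : ℕ) : iteratedDeriv n bernFun 0 = (bernoulli n : ℂ) := by
  have hE : AnalyticAt ℂ (fun x => Complex.exp x - 1) 0 := by fun_prop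
  have hmul : bernFun * (fun x => Complex.exp x - 1) =ᶠ[𝓝 0] fun x => x := by
    have h1 : ∀ᶠ x in 𝓝 (0 : ℂ), dslope Complex.exp 0 x ≠ 0 :=
      (analyticAt_dslope Complex.differentiable_exp 0 0).continuousAt.eventually_ne (by simp)
    filter_upwards [h1] with x hx
    have h2 := sub_smul_dslope Complex.exp 0 x
    rw [sub_zero, Complex.exp_zero, smul_eq_mul] at h2
    rw [Pi.mul_apply, ← h2, bernFun]
    field_simp
  have hderiv : ∀ k : ℕ, iteratedDeriv k (fun x => Complex.exp x - 1) 0 =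
      if k = 0 then 0 else 1 := by
    intro k
    have h1 : iteratedDeriv k (fun x => Complex.exp x - 1) 0 =
        iteratedDeriv k (Complex.exp - fun _ => (1 : ℂ)) 0 := rfl
    rw [h1, iteratedDeriv_sub (by fun_prop) (by fun_prop), iteratedDeriv_eq_iterate,
      Complex.iter_deriv_exp, iteratedDeriv_const]
    split_ifs <;> simp
  have key : ∀ N : ℕ, ∑ i ∈ Finset.range N, (N.choose i : ℂ) * iteratedDeriv i bernFun 0 =
      if N = 1 then 1 else 0 := by
    intro N
    have h1 := iteratedDeriv_mul (n := N) (analyticAt_bernFun.contDiffAt) (hE.contDiffAt)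
    rw [Filter.EventuallyEq.iteratedDeriv_eq N hmul, iteratedDeriv_fun_id_zero,
      Finset.sum_range_succ, hderiv, if_pos (Nat.sub_self N), mul_zero, add_zero] at h1
    rw [h1]
    refine Finset.sum_congr rfl fun i hi => ?_
    have := Finset.mem_range.mp hi
    rw [hderiv, if_neg (by omega), mul_one]
  induction n using Nat.strong_induction_on with
  | _ n ih =>
    have h1 := key (n + 1)
    have h2 : ((∑ k ∈ Finset.range (n + 1), ((n + 1).choose k : ℚ) * bernoulli k : ℚ) : ℂ) =
        ((if n + 1 = 1 then 1 else 0 : ℚ) : ℂ) := by rw [sum_bernoulli]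
    push_cast at h2
    rw [Finset.sum_range_succ] at h1 h2
    have h3 : ∑ i ∈ Finset.range n, ((n + 1).choose i : ℂ) * iteratedDeriv i bernFun 0 =
        ∑ i ∈ Finset.range n, ((n + 1).choose i : ℂ) * (bernoulli i : ℂ) :=
      Finset.sum_congr rfl fun i hi => by rw [ih i (Finset.mem_range.mp hi)]
    rw [h3] at h1
    have h4 : ((n + 1).choose n : ℂ) ≠ 0 := by
      rw [Nat.choose_succ_self_right]; exact_mod_cast n.succ_ne_zero
    apply mul_left_cancel₀ h4
    have h5 : (if n + 1 = 1 then (1 : ℂ) else 0) = ((if n + 1 = 1 then 1 else 0 : ℚ) : ℂ) := by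
      split_ifs <;> simp
    push_cast at h5
    have h6 : (if n + 1 = 1 then (1 : ℂ) else 0) = if n = 0 then 1 else 0 := by simp
    linear_combination h1 - h2 + h5 + h6

theorem AnalyticAt.eventually_hasSum {f : ℂ → ℂ} (hf : AnalyticAt ℂ f 0) :
    ∀ᶠ x in 𝓝 (0 : ℂ), HasSum (fun n : ℕ => iteratedDeriv n f 0 / (n.factorial : ℂ) * x ^ n)
      (f x) := by
  have := hasFPowerSeriesAt_iff.mp hf.hasFPowerSeriesAt
  simpa [FormalMultilinearSeries.coeff_ofScalars, mul_comm] using this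

theorem iteratedDeriv_of_hasSum {f : ℂ → ℂ} {c : ℕ → ℂ}
    (h : ∀ᶠ x in 𝓝 (0 : ℂ), HasSum (fun n : ℕ => c n * x ^ n) (f x)) :
    AnalyticAt ℂ f 0 ∧ ∀ n, iteratedDeriv n f 0 = (n.factorial : ℂ) * c n := by
  have h1 : HasFPowerSeriesAt f (FormalMultilinearSeries.ofScalars ℂ c) 0 := by
    rw [hasFPowerSeriesAt_iff]
    simpa [FormalMultilinearSeries.coeff_ofScalars, mul_comm] using h
  have h2 : AnalyticAt ℂ f 0 := ⟨_, h1⟩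
  refine ⟨h2, fun n => ?_⟩
  have h3 := h2.hasFPowerSeriesAt.eq_formalMultilinearSeries h1
  have h4 := congrArg (fun p => FormalMultilinearSeries.coeff p n) h3
  simp only [FormalMultilinearSeries.coeff_ofScalars] at h4
  have : (n.factorial : ℂ) ≠ 0 := by exact_mod_cast n.factorial_ne_zero
  rw [← h4]
  field_simp

/-! ### The functions `f_n` on the real line -/

/-- The function `x ( z/(1-z) - 1/(e^x - 1) + ∑ (z^m e^{kx} - z^{-m} e^{-kx}) q^{mk} )`. -/
def kronReg (z q x : ℂ) : ℂ :=
  x * (z * (1 - z)⁻¹) - bernFun x + x * ∑' p : ℕ × ℕ, pairTerm z q x p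

/-- The Taylor coefficients of `kronReg`. -/
def kronCoeff (z q : ℂ) : ℕ → ℂ
  | 0 => -1
  | n + 1 => (if n = 0 then z * (1 - z)⁻¹ else 0) -
      (bernoulli (n + 1) : ℂ) / ((n + 1).factorial : ℂ) + pairCoeff z q n

theorem eventually_mul_exp_norm_lt_one {r : ℝ} (hr : r < 1) :
    ∀ᶠ x in 𝓝 (0 : ℂ), r * Real.exp ‖x‖ < 1 := by
  have h : ContinuousAt (fun x : ℂ => r * Real.exp ‖x‖) 0 := by fun_prop
  exact h.eventually_lt_const (by simpa using hr)

theorem eventually_hasSum_kronReg {z q : ℂ} (hz : ‖z‖ = 1) (hq : ‖q‖ < 1) :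
    ∀ᶠ x in 𝓝 (0 : ℂ), HasSum (fun n : ℕ => kronCoeff z q n * x ^ n) (kronReg z q x) := by
  filter_upwards [eventually_mul_exp_norm_lt_one hq,
    AnalyticAt.eventually_hasSum analyticAt_bernFun] with x hx hb
  have h1 := (hasSum_pairCoeff hz hq hx).mul_left x
  simp_rw [iteratedDeriv_bernFun] at hb
  have h2 := (hasSum_nat_add_iff' 1).mpr hb
  have h3 : HasSum (fun n : ℕ => if n = 0 then x * (z * (1 - z)⁻¹) else 0)
      (x * (z * (1 - z)⁻¹)) := hasSum_ite_eq 0 _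
  rw [← hasSum_nat_add_iff' 1]
  refine HasSum.congr_fun ?_ (fun n => ?_) (f := fun n => (if n = 0 then x * (z * (1 - z)⁻¹) else 0)
    - (bernoulli (n + 1) : ℂ) / ((n + 1).factorial : ℂ) * x ^ (n + 1) +
      x * (pairCoeff z q n * x ^ n))
  · have := (h3.sub h2).add h1
    have e : kronReg z q x - ∑ i ∈ Finset.range 1, kronCoeff z q i * x ^ i =
        x * (z * (1 - z)⁻¹) - (bernFun x - ∑ i ∈ Finset.range 1,
          (bernoulli i : ℂ) / (i.factorial : ℂ) * x ^ i) +
          x * ∑' p : ℕ × ℕ, pairTerm z q x p := by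
      simp [kronReg, kronCoeff]
      ring
    rw [e]
    exact this
  · rw [kronCoeff]
    split_ifs with hn
    · subst hn; simp; ring
    · ring

/-- The product formula is available for small α = iy with y > 0. After multiplication by α both
sides are analytic at 0, so the identity theorem extends it to a full neighbourhood. -/
theorem eventually_theta_mul_kronReg {ξ : ℂ} (hz : ‖expi ξ‖ = 1) (hz1 : expi ξ ≠ 1) (τ : ℍ) :
    ∃ C : ℂ, ∀ᶠ α in 𝓝 (0 : ℂ), dslope (fun x => theta x τ) 0 α *
      kronReg (expi ξ) (expi τ) (2 * Real.pi * Complex.I * α) = C * theta (ξ + α) τ := by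
  set D := appell (expi ξ) τ 0 / thetaCoeff τ 0 * expi (-ξ / 2) with hD
  have hq := norm_expi_lt_one τ
  have hlin : AnalyticAt ℂ (fun α : ℂ => 2 * Real.pi * Complex.I * α) 0 := by fun_prop
  have hlin0 : Tendsto (fun α : ℂ => 2 * Real.pi * Complex.I * α) (𝓝 0) (𝓝 0) := by
    have := hlin.continuousAt.tendsto
    rwa [mul_zero] at this
  have hR := (iteratedDeriv_of_hasSum (eventually_hasSum_kronReg hz hq)).1
  have hR' : AnalyticAt ℂ (fun α : ℂ => kronReg (expi ξ) (expi τ)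
      (2 * Real.pi * Complex.I * α)) 0 :=
    AnalyticAt.comp (g := kronReg (expi ξ) (expi τ)) (by rwa [mul_zero]) hlin
  have hL : AnalyticAt ℂ (fun α : ℂ => dslope (fun x => theta x τ) 0 α *
      kronReg (expi ξ) (expi τ) (2 * Real.pi * Complex.I * α)) 0 :=
    (analyticAt_dslope (differentiable_theta τ) 0 0).mul hR'
  have hr : AnalyticAt ℂ (fun α : ℂ => 2 * Real.pi * Complex.I * D * theta (ξ + α) τ) 0 := by
    have : Differentiable ℂ (fun α : ℂ => 2 * Real.pi * Complex.I * D * theta (ξ + α) τ) :=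
      (((differentiable_theta τ).comp (f := fun α : ℂ => ξ + α) (by fun_prop))).const_mul _
    exact this.analyticAt 0
  refine ⟨2 * Real.pi * Complex.I * D, (hL.frequently_eq_iff_eventually_eq hr).mp ?_⟩
  have hvert : Tendsto (fun y : ℝ => (y : ℂ) * Complex.I) (𝓝[>] 0) (𝓝[≠] 0) := by
    refine tendsto_nhdsWithin_iff.mpr ⟨?_, ?_⟩
    · have : Continuous fun y : ℝ => (y : ℂ) * Complex.I := by fun_prop
      have := this.tendsto 0
      simp only [Complex.ofReal_zero, zero_mul] at this
      exact this.mono_left nhdsWithin_le_nhds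
    · filter_upwards [self_mem_nhdsWithin] with y hy
      have : y ≠ 0 := ne_of_gt hy
      simpa using this
  refine hvert.frequently ?_
  refine Eventually.frequently ?_
  have hsmall := (hvert.mono_right nhdsWithin_le_nhds).eventually
    (hlin0.eventually (eventually_mul_exp_norm_lt_one hq))
  have him : ∀ᶠ y : ℝ in 𝓝[>] 0, y < τ.im := (eventually_lt_nhds τ.im_pos).filter_mono
    nhdsWithin_le_nhds
  filter_upwards [self_mem_nhdsWithin, hsmall, him] with y hy hy1 hy2
  have hy0 : (0 : ℝ) < y := hy
  set α : ℂ := (y : ℂ) * Complex.I with hα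
  have hαim : α.im = y := by simp [hα]
  have hα0 : α ≠ 0 := by
    intro h
    rw [h] at hαim
    simp at hαim
    linarith
  have h1 := theta_mul_kernel hz hz1 τ (α := α) (by rw [hαim]; exact hy0) (by rw [hαim]; exact hy2)
  rw [kernel_eq hz hz1 τ (by rw [hαim]; exact hy0) hy1] at h1
  have hx : 2 * Real.pi * Complex.I * α ≠ 0 := mul_ne_zero Complex.two_pi_I_ne_zero hα0
  have h2 : (1 - expi α)⁻¹ = -(expi α - 1)⁻¹ := by rw [← inv_neg]; congr 1; ring
  rw [kronReg, bernFun_of_ne hx, dslope_of_ne _ hα0, slope_def_field, theta_zero, sub_zero,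
    sub_zero]
  rw [h2] at h1
  have h3 : Complex.exp (2 * Real.pi * Complex.I * α) = expi α := rfl
  rw [h3]
  rw [div_mul_eq_mul_div, div_eq_iff hα0]
  linear_combination (2 * Real.pi * Complex.I * α) * h1

theorem kronReg_zero (z q : ℂ) : kronReg z q 0 = -1 := by
  simp [kronReg, bernFun_zero]

/-- The constant is found by putting α = 0. The identity stays multiplied by θ(ξ), because
nonvanishing of θ(ξ) and θ'(0) is deduced from it. -/
theorem deriv_theta_eq {ξ : ℂ} (hz : ‖expi ξ‖ = 1) (hz1 : expi ξ ≠ 1) (τ : ℍ) :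
    ∀ᶠ α in 𝓝 (0 : ℂ), theta ξ τ * (dslope (fun x => theta x τ) 0 α *
      kronReg (expi ξ) (expi τ) (2 * Real.pi * Complex.I * α)) =
        -deriv (fun x => theta x τ) 0 * theta (ξ + α) τ := by
  obtain ⟨C, hC⟩ := eventually_theta_mul_kronReg hz hz1 τ
  have h0 := hC.self_of_nhds
  rw [dslope_same, mul_zero, kronReg_zero, add_zero] at h0
  filter_upwards [hC] with α hα
  rw [hα]
  linear_combination -theta (ξ + α) τ * h0

theorem eventually_kronReg_ne_zero {ξ : ℂ} (hz : ‖expi ξ‖ = 1) (τ : ℍ) :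
    ∀ᶠ α in 𝓝 (0 : ℂ), kronReg (expi ξ) (expi τ) (2 * Real.pi * Complex.I * α) ≠ 0 := by
  have hR := (iteratedDeriv_of_hasSum (eventually_hasSum_kronReg hz (norm_expi_lt_one τ))).1
  have hlin : Tendsto (fun α : ℂ => 2 * Real.pi * Complex.I * α) (𝓝 0) (𝓝 0) := by
    have : Continuous (fun α : ℂ => 2 * Real.pi * Complex.I * α) := by fun_prop
    simpa using this.tendsto 0
  exact hlin.eventually (hR.continuousAt.eventually_ne (by rw [kronReg_zero]; norm_num))

theorem norm_expi_ofReal (t : ℝ) : ‖expi t‖ = 1 := by rw [norm_expi]; simp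

theorem expi_ofReal_ne_one {t : ℝ} (h0 : 0 < t) (h1 : t < 1) : expi t ≠ 1 := by
  rw [expi, Ne, Complex.exp_eq_one_iff]
  rintro ⟨n, hn⟩
  have h2 : (t : ℂ) = n := by
    apply mul_left_cancel₀ Complex.two_pi_I_ne_zero
    linear_combination hn
  have h3 : t = n := by exact_mod_cast h2
  rw [h3] at h0 h1
  have h4 : (0 : ℤ) < n := by exact_mod_cast h0
  have h5 : n < (1 : ℤ) := by exact_mod_cast h1
  omega

/-- If θ'(0) = 0, a real t in (0, 1) with θ(t) ≠ 0 would force θ to vanish near 0. So θ would vanish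
on the whole interval, hence identically. -/
theorem deriv_theta_ne_zero (τ : ℍ) : deriv (fun x => theta x τ) 0 ≠ 0 := by
  intro h
  have hall : ∀ t : ℝ, 0 < t → t < 1 → theta t τ = 0 := by
    intro t h0 h1
    by_contra hne
    have hz := norm_expi_ofReal t
    refine not_eventually_theta_eq_zero τ 0 ?_
    filter_upwards [deriv_theta_eq hz (expi_ofReal_ne_one h0 h1) τ,
      eventually_kronReg_ne_zero hz τ] with α h2 h3
    rw [h, neg_zero, zero_mul] at h2
    have h4 := ((mul_eq_zero.mp ((mul_eq_zero.mp h2).resolve_left hne))).resolve_right h3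
    have h5 := sub_smul_dslope (fun x => theta x τ) 0 α
    rw [h4, smul_zero, theta_zero, sub_zero] at h5
    exact h5.symm
  refine not_eventually_theta_eq_zero τ (1 / 2 : ℝ) ?_
  have han : AnalyticAt ℂ (fun x => theta x τ) (1 / 2 : ℝ) := (differentiable_theta τ).analyticAt _
  refine (han.frequently_eq_iff_eventually_eq analyticAt_const).mp ?_
  have hlim : Tendsto (fun t : ℝ => (t : ℂ)) (𝓝[>] (1 / 2)) (𝓝[≠] ((1 / 2 : ℝ) : ℂ)) := by
    refine tendsto_nhdsWithin_iff.mpr ⟨?_, ?_⟩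
    · exact (Complex.continuous_ofReal.tendsto _).mono_left nhdsWithin_le_nhds
    · filter_upwards [self_mem_nhdsWithin] with y hy
      have : y ≠ 1 / 2 := ne_of_gt hy
      exact fun h => this (Complex.ofReal_injective h)
  refine hlim.frequently (Eventually.frequently ?_)
  have h2 : ∀ᶠ t : ℝ in 𝓝[>] (1 / 2), t < 1 :=
    (eventually_lt_nhds (by norm_num)).filter_mono nhdsWithin_le_nhds
  filter_upwards [self_mem_nhdsWithin, h2] with t ht ht1
  exact hall t (lt_trans (by norm_num) ht) ht1

theorem kroneckerCoeff_ofReal {t : ℝ} (h0 : 0 < t) (h1 : t < 1) (τ : ℍ) (n : ℕ) :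
    kroneckerCoeff n t τ = -(2 * Real.pi * Complex.I) * kronCoeff (expi t) (expi τ) n := by
  have hz := norm_expi_ofReal t
  have hd := deriv_theta_ne_zero τ
  have hEq := deriv_theta_eq hz (expi_ofReal_ne_one h0 h1) τ
  -- If θ(t) = 0, `deriv_theta_eq` with θ'(0) ≠ 0 makes θ vanish near t.
  have hθ : theta t τ ≠ 0 := by
    intro h
    refine not_eventually_theta_eq_zero τ t ?_
    have h2 : ∀ᶠ α in 𝓝 (0 : ℂ), theta (t + α) τ = 0 := by
      filter_upwards [hEq] with α hα
      rw [h, zero_mul] at hα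
      exact (mul_eq_zero.mp hα.symm).resolve_left (neg_ne_zero.mpr hd)
    have h3 : Tendsto (fun x : ℂ => x - t) (𝓝 (t : ℂ)) (𝓝 0) := by
      have : Continuous fun x : ℂ => x - t := by fun_prop
      simpa using this.tendsto (t : ℂ)
    filter_upwards [h3.eventually h2] with x hx
    simpa using hx
  have hlin : Tendsto (fun α : ℂ => 2 * Real.pi * Complex.I * α) (𝓝 0) (𝓝 0) := by
    have : Continuous (fun α : ℂ => 2 * Real.pi * Complex.I * α) := by fun_prop
    simpa using this.tendsto 0
  have hds : ∀ᶠ α in 𝓝 (0 : ℂ), dslope (fun x => theta x τ) 0 α ≠ 0 :=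
    (analyticAt_dslope (differentiable_theta τ) 0 0).continuousAt.eventually_ne
      (by rwa [dslope_same])
  have hsum : ∀ᶠ α in 𝓝 (0 : ℂ), HasSum (fun n : ℕ => -(2 * Real.pi * Complex.I) *
      kronCoeff (expi t) (expi τ) n * (2 * Real.pi * Complex.I) ^ n * α ^ n)
      (kroneckerReg t τ α) := by
    filter_upwards [hEq, hds, hlin.eventually (eventually_hasSum_kronReg hz (norm_expi_lt_one τ))]
      with α h2 h3 h4
    have h5 : kroneckerReg t τ α = -(2 * Real.pi * Complex.I) *
        kronReg (expi t) (expi τ) (2 * Real.pi * Complex.I * α) := by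
      rw [kroneckerReg, div_eq_iff (mul_ne_zero hθ h3)]
      linear_combination (2 * Real.pi * Complex.I) * h2
    rw [h5]
    refine (h4.mul_left _).congr_fun fun n => ?_
    rw [mul_pow]
    ring
  rw [kroneckerCoeff, (iteratedDeriv_of_hasSum hsum).2 n]
  have e1 : (n.factorial : ℂ) ≠ 0 := by exact_mod_cast n.factorial_ne_zero
  have e2 := pow_ne_zero n Complex.two_pi_I_ne_zero
  field_simp

/-! ### Asymptotics of regularized integrals -/

/-- `F(ε) = c₀ + c₁ log ε + O(ε^{1/2})` as `ε → 0⁺`. -/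
def LogAsymp (F : ℝ → ℂ) (c₀ c₁ : ℂ) : Prop :=
  (fun ε : ℝ => F ε - (c₀ + c₁ * (Real.log ε : ℂ))) =O[𝓝[>] (0 : ℝ)] fun ε : ℝ => ε ^ (1 / 2 : ℝ)

theorem isBigO_id_sqrt : (fun ε : ℝ => ε) =O[𝓝[>] (0 : ℝ)] fun ε : ℝ => ε ^ (1 / 2 : ℝ) := by
  refine IsBigO.of_bound 1 ?_
  have h1 : ∀ᶠ ε : ℝ in 𝓝[>] 0, ε < 1 := (eventually_lt_nhds one_pos).filter_mono
    nhdsWithin_le_nhds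
  filter_upwards [self_mem_nhdsWithin, h1] with ε h0 h1
  have h0 : 0 < ε := h0
  rw [one_mul, Real.norm_of_nonneg h0.le, Real.norm_of_nonneg (by positivity)]
  calc ε = ε ^ (1 : ℝ) := (Real.rpow_one ε).symm
    _ ≤ _ := Real.rpow_le_rpow_of_exponent_ge h0 h1.le (by norm_num)

/-- Errors of size ε log ε occur, so the exponent in `LogAsymp` must be below 1; 1/2 is one such
choice. -/
theorem isBigO_mul_log_sqrt :
    (fun ε : ℝ => ε * Real.log ε) =O[𝓝[>] (0 : ℝ)] fun ε : ℝ => ε ^ (1 / 2 : ℝ) := by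
  have h := (isLittleO_log_rpow_nhdsGT_zero (r := -(1 / 2 : ℝ)) (by norm_num)).isBigO
  have h2 := (isBigO_refl (fun ε : ℝ => ε) (𝓝[>] 0)).mul h
  refine h2.congr' (EventuallyEq.refl _ _) ?_
  filter_upwards [self_mem_nhdsWithin] with ε h0
  have h0 : 0 < ε := h0
  nth_rewrite 1 [← Real.rpow_one ε]
  rw [← Real.rpow_add h0]
  norm_num

theorem LogAsymp.add {F G : ℝ → ℂ} {a b c d : ℂ} (hF : LogAsymp F a b) (hG : LogAsymp G c d) :
    LogAsymp (fun ε => F ε + G ε) (a + c) (b + d) := by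
  refine (IsBigO.add hF hG).congr_left fun ε => ?_
  ring

theorem LogAsymp.const_mul {F : ℝ → ℂ} {a b : ℂ} (hF : LogAsymp F a b) (c : ℂ) :
    LogAsymp (fun ε => c * F ε) (c * a) (c * b) := by
  refine (IsBigO.const_mul_left hF c).congr_left fun ε => ?_
  ring

theorem LogAsymp.sub {F G : ℝ → ℂ} {a b c d : ℂ} (hF : LogAsymp F a b) (hG : LogAsymp G c d) :
    LogAsymp (fun ε => F ε - G ε) (a - c) (b - d) := by
  refine (IsBigO.sub hF hG).congr_left fun ε => ?_
  ring

theorem LogAsymp.congr' {F G : ℝ → ℂ} {a b : ℂ} (hF : LogAsymp F a b)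
    (h : ∀ ε : ℝ, 0 < ε → ε < 1 / 2 → F ε = G ε) : LogAsymp G a b := by
  refine IsBigO.congr' hF ?_ (EventuallyEq.refl _ _)
  have h1 : ∀ᶠ ε : ℝ in 𝓝[>] 0, ε < 1 / 2 := (eventually_lt_nhds (by norm_num)).filter_mono
    nhdsWithin_le_nhds
  filter_upwards [self_mem_nhdsWithin, h1] with ε h0 h1
  rw [h ε h0 h1]

theorem LogAsymp.of_norm_le {F : ℝ → ℂ} {a : ℂ} {C : ℝ}
    (h : ∀ ε : ℝ, 0 < ε → ε < 1 / 2 → ‖F ε - a‖ ≤ C * ε) : LogAsymp F a 0 := by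
  refine IsBigO.trans ?_ isBigO_id_sqrt
  refine IsBigO.of_bound C ?_
  have h1 : ∀ᶠ ε : ℝ in 𝓝[>] 0, ε < 1 / 2 := (eventually_lt_nhds (by norm_num)).filter_mono
    nhdsWithin_le_nhds
  filter_upwards [self_mem_nhdsWithin, h1] with ε h0 h1
  have h0 : 0 < ε := h0
  rw [zero_mul, add_zero, Real.norm_of_nonneg h0.le]
  exact h ε h0 h1

theorem LogAsymp.ofReal_mul {F : ℝ → ℂ} {a b : ℂ} (hF : LogAsymp F a b) :
    LogAsymp (fun ε : ℝ => (ε : ℂ) * F ε) 0 0 := by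
  have hid : (fun ε : ℝ => (ε : ℂ)) =O[𝓝[>] (0 : ℝ)] fun ε : ℝ => ε ^ (1 / 2 : ℝ) :=
    IsBigO.of_norm_left (by simpa using isBigO_id_sqrt.norm_left)
  have hlog : (fun ε : ℝ => (ε : ℂ) * (Real.log ε : ℂ)) =O[𝓝[>] (0 : ℝ)]
      fun ε : ℝ => ε ^ (1 / 2 : ℝ) := by
    refine IsBigO.of_norm_left ?_
    have := isBigO_mul_log_sqrt.norm_left
    simpa using this
  have h1 : (fun ε : ℝ => (ε : ℂ)) =O[𝓝[>] (0 : ℝ)] fun _ => (1 : ℝ) := by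
    have : Continuous fun ε : ℝ => (ε : ℂ) := Complex.continuous_ofReal
    exact ((this.tendsto 0).mono_left nhdsWithin_le_nhds).isBigO_one ℝ
  have h2 := h1.mul hF
  simp only [one_mul] at h2
  refine ((h2.add (hid.const_mul_left a)).add (hlog.const_mul_left b)).congr_left fun ε => ?_
  ring

theorem abs_sub_pow_sub_pow_le {t ε : ℝ} (h0 : 0 ≤ ε) (h1 : ε ≤ t) (h2 : t ≤ 1) (p : ℕ) :
    |(t - ε) ^ p - t ^ p| ≤ p * ε := by
  induction p with
  | zero => simp
  | succ p ih =>
    have e : (t - ε) ^ (p + 1) - t ^ (p + 1) =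
        (t - ε) * ((t - ε) ^ p - t ^ p) - ε * t ^ p := by ring
    rw [e]
    refine (abs_sub _ _).trans ?_
    rw [abs_mul, abs_mul, abs_of_nonneg (sub_nonneg.mpr h1), abs_of_nonneg h0,
      abs_of_nonneg (pow_nonneg (h0.trans h1) p)]
    have h3 : (t - ε) * |(t - ε) ^ p - t ^ p| ≤ 1 * (p * ε) :=
      mul_le_mul (by linarith) ih (abs_nonneg _) zero_le_one
    have h4 : ε * t ^ p ≤ ε * 1 :=
      mul_le_mul_of_nonneg_left (pow_le_one₀ (h0.trans h1) h2) h0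
    push_cast
    linarith

theorem logAsymp_integral {h : ℝ → ℂ} (hh : ContinuousOn h (Set.Icc 0 1)) (p : ℕ) :
    LogAsymp (fun ε => ∫ t in ε..(1 - ε), h t * ((t : ℂ) - ε) ^ p)
      (∫ t in (0 : ℝ)..1, h t * (t : ℂ) ^ p) 0 := by
  obtain ⟨M, hM⟩ := isCompact_Icc.exists_bound_of_continuousOn hh
  have hM0 : 0 ≤ M := (norm_nonneg _).trans (hM 0 (by simp))
  -- The first term of the constant pays for replacing t - ε by t, the other two for the missing end
  -- intervals.
  refine LogAsymp.of_norm_le (C := M * p + M + M) fun ε h0 h1 => ?_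
  have hint : ∀ c : ℝ, ∀ a b : ℝ, a ∈ Set.Icc (0 : ℝ) 1 → b ∈ Set.Icc (0 : ℝ) 1 →
      IntervalIntegrable (fun t : ℝ => h t * ((t : ℂ) - c) ^ p) volume a b := by
    intro c a b ha hb
    refine ContinuousOn.intervalIntegrable (ContinuousOn.mono ?_ (Set.uIcc_subset_Icc ha hb))
    exact hh.mul (by fun_prop)
  have hint0 : ∀ a b : ℝ, a ∈ Set.Icc (0 : ℝ) 1 → b ∈ Set.Icc (0 : ℝ) 1 →
      IntervalIntegrable (fun t : ℝ => h t * (t : ℂ) ^ p) volume a b := by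
    intro a b ha hb
    simpa using hint 0 a b ha hb
  have m0 : (0 : ℝ) ∈ Set.Icc (0 : ℝ) 1 := by simp
  have m1 : (1 : ℝ) ∈ Set.Icc (0 : ℝ) 1 := by simp
  have mε : ε ∈ Set.Icc (0 : ℝ) 1 := ⟨h0.le, by linarith⟩
  have mε' : 1 - ε ∈ Set.Icc (0 : ℝ) 1 := ⟨by linarith, by linarith⟩
  have hsplit : (∫ t in ε..(1 - ε), h t * ((t : ℂ) - ε) ^ p) -
      (∫ t in (0 : ℝ)..1, h t * (t : ℂ) ^ p) =
      (∫ t in ε..(1 - ε), (h t * ((t : ℂ) - ε) ^ p - h t * (t : ℂ) ^ p)) -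
      (∫ t in (0 : ℝ)..ε, h t * (t : ℂ) ^ p) - ∫ t in (1 - ε)..1, h t * (t : ℂ) ^ p := by
    rw [intervalIntegral.integral_sub (hint ε _ _ mε mε') (hint0 _ _ mε mε'),
      ← intervalIntegral.integral_add_adjacent_intervals (hint0 _ _ m0 mε) (hint0 _ _ mε m1),
      ← intervalIntegral.integral_add_adjacent_intervals (hint0 _ _ mε mε') (hint0 _ _ mε' m1)]
    ring
  have hpow : ∀ t ∈ Set.Icc (0 : ℝ) 1, ‖h t * (t : ℂ) ^ p‖ ≤ M := by
    intro t ht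
    rw [norm_mul, norm_pow, Complex.norm_real, Real.norm_of_nonneg ht.1]
    calc _ ≤ M * 1 := mul_le_mul (hM t ht) (pow_le_one₀ ht.1 ht.2) (pow_nonneg ht.1 _) hM0
      _ = M := mul_one M
  have b1 : ‖∫ t in ε..(1 - ε), (h t * ((t : ℂ) - ε) ^ p - h t * (t : ℂ) ^ p)‖ ≤ M * p * ε := by
    have : ‖∫ t in ε..(1 - ε), (h t * ((t : ℂ) - ε) ^ p - h t * (t : ℂ) ^ p)‖ ≤
        M * (p * ε) * |1 - ε - ε| := by
      refine intervalIntegral.norm_integral_le_of_norm_le_const fun t ht => ?_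
      rw [Set.uIoc_of_le (by linarith)] at ht
      rw [← mul_sub, norm_mul]
      refine mul_le_mul (hM t ⟨by linarith [ht.1], by linarith [ht.2]⟩) ?_ (norm_nonneg _) hM0
      have := abs_sub_pow_sub_pow_le h0.le ht.1.le (by linarith [ht.2]) p
      rw [← Real.norm_eq_abs, ← Complex.norm_real] at this
      push_cast at this
      exact this
    refine this.trans ?_
    rw [abs_of_nonneg (by linarith)]
    have : 0 ≤ M * (p * ε) := by positivity
    nlinarith
  have b2 : ‖∫ t in (0 : ℝ)..ε, h t * (t : ℂ) ^ p‖ ≤ M * |ε - 0| := by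
    refine intervalIntegral.norm_integral_le_of_norm_le_const fun t ht => ?_
    rw [Set.uIoc_of_le h0.le] at ht
    exact hpow t ⟨ht.1.le, by linarith [ht.2]⟩
  have b3 : ‖∫ t in (1 - ε)..1, h t * (t : ℂ) ^ p‖ ≤ M * |1 - (1 - ε)| := by
    refine intervalIntegral.norm_integral_le_of_norm_le_const fun t ht => ?_
    rw [Set.uIoc_of_le (by linarith)] at ht
    exact hpow t ⟨by linarith [ht.1], ht.2⟩
  rw [sub_zero, abs_of_pos h0] at b2
  rw [sub_sub_cancel, abs_of_pos h0] at b3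
  rw [hsplit]
  calc _ ≤ _ := (norm_sub_le _ _).trans (add_le_add_left (norm_sub_le _ _) _)
    _ ≤ _ := by linarith

theorem logAsymp_log : LogAsymp (fun ε => (Real.log ε : ℂ)) 0 1 := by
  refine (isBigO_zero _ _).congr_left fun ε => ?_
  simp

theorem logAsymp_log_one_sub : LogAsymp (fun ε => (Real.log (1 - ε) : ℂ)) 0 0 := by
  refine LogAsymp.of_norm_le (C := 2) fun ε h0 h1 => ?_
  rw [sub_zero, Complex.norm_real, Real.norm_eq_abs]
  have h2 : Real.log (1 - ε) ≤ 0 := Real.log_nonpos (by linarith) (by linarith)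
  rw [abs_of_nonpos h2]
  have h3 := Real.one_sub_inv_le_log_of_pos (x := 1 - ε) (by linarith)
  have h4 : (1 - ε)⁻¹ ≤ 1 + 2 * ε := by
    rw [inv_le_iff_one_le_mul₀ (by linarith)]
    nlinarith
  linarith

theorem logAsymp_one_sub_two_mul_pow (p : ℕ) (a : ℂ) :
    LogAsymp (fun ε : ℝ => (1 - 2 * (ε : ℂ)) ^ p * a) a 0 := by
  refine LogAsymp.of_norm_le (C := 2 * p * ‖a‖) fun ε h0 h1 => ?_
  rw [← sub_one_mul, norm_mul]
  have := abs_sub_pow_sub_pow_le (t := 1) (ε := 2 * ε) (by linarith) (by linarith) le_rfl p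
  rw [← Real.norm_eq_abs, ← Complex.norm_real] at this
  push_cast at this
  rw [one_pow] at this
  calc _ ≤ p * (2 * ε) * ‖a‖ := mul_le_mul_of_nonneg_right this (norm_nonneg a)
    _ = _ := by ring

theorem integral_sub_pow (ε : ℝ) (p : ℕ) :
    ∫ t in ε..(1 - ε), ((t : ℂ) - ε) ^ p = (1 - 2 * (ε : ℂ)) ^ (p + 1) * (1 / ((p : ℂ) + 1)) := by
  have h1 : ∫ t in ε..(1 - ε), ((t : ℂ) - ε) ^ p =
      ∫ t in ε..(1 - ε), (((t - ε) ^ p : ℝ) : ℂ) := by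
    refine intervalIntegral.integral_congr fun t _ => ?_
    push_cast
    rfl
  rw [h1, intervalIntegral.integral_ofReal,
    intervalIntegral.integral_comp_sub_right (fun t => t ^ p), integral_pow]
  push_cast
  rw [sub_self, zero_pow p.succ_ne_zero]
  ring

/-- Induction through (t-ε)^{p+1}/t = (t-ε)^p - ε (t-ε)^p/t; only the existence of the constants
matters. -/
theorem exists_logAsymp_inv (p : ℕ) : ∃ c₀ c₁ : ℂ,
    LogAsymp (fun ε => ∫ t in ε..(1 - ε), (t : ℂ)⁻¹ * ((t : ℂ) - ε) ^ p) c₀ c₁ := by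
  induction p with
  | zero =>
    refine ⟨_, _, (logAsymp_log_one_sub.sub logAsymp_log).congr' fun ε h0 h1 => ?_⟩
    have e : ∫ t in ε..(1 - ε), (t : ℂ)⁻¹ * ((t : ℂ) - ε) ^ 0 =
        ∫ t in ε..(1 - ε), ((t⁻¹ : ℝ) : ℂ) := by
      refine intervalIntegral.integral_congr fun t _ => ?_
      simp
    rw [e, intervalIntegral.integral_ofReal, integral_inv_of_pos h0 (by linarith),
      Real.log_div (by linarith) h0.ne']
    push_cast
    rfl
  | succ p ih =>
    obtain ⟨c₀, c₁, h⟩ := ih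
    refine ⟨_, _, ((logAsymp_one_sub_two_mul_pow (p + 1) (1 / ((p : ℂ) + 1))).sub
      h.ofReal_mul).congr' fun ε h0 h1 => ?_⟩
    rw [← integral_sub_pow, ← intervalIntegral.integral_const_mul,
      ← intervalIntegral.integral_sub]
    · refine intervalIntegral.integral_congr fun t ht => ?_
      rw [Set.uIcc_of_le (by linarith)] at ht
      have : (t : ℂ) ≠ 0 := by
        have : 0 < t := h0.trans_le ht.1
        exact_mod_cast this.ne'
      field_simp
      ring
    · exact Continuous.intervalIntegrable (by fun_prop) _ _
    · refine ContinuousOn.intervalIntegrable (ContinuousOn.const_mul (ContinuousOn.mul ?_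
        (by fun_prop)) _)
      refine ContinuousOn.inv₀ (by fun_prop) fun t ht => ?_
      rw [Set.uIcc_of_le (by linarith)] at ht
      have : 0 < t := h0.trans_le ht.1
      exact_mod_cast this.ne'

/-- The induction writes t - ε = (1 - ε) - (1 - t), so the logarithm persists for every `p`. -/
theorem exists_logAsymp_inv_one_sub (p : ℕ) : ∃ c₀ c₁ : ℂ,
    LogAsymp (fun ε => ∫ t in ε..(1 - ε), (1 - (t : ℂ))⁻¹ * ((t : ℂ) - ε) ^ p) c₀ c₁ := by
  induction p with
  | zero =>
    refine ⟨_, _, (logAsymp_log_one_sub.sub logAsymp_log).congr' fun ε h0 h1 => ?_⟩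
    have e : ∫ t in ε..(1 - ε), (1 - (t : ℂ))⁻¹ * ((t : ℂ) - ε) ^ 0 =
        ∫ t in ε..(1 - ε), (((1 - t)⁻¹ : ℝ) : ℂ) := by
      refine intervalIntegral.integral_congr fun t _ => ?_
      simp
    rw [e, intervalIntegral.integral_ofReal,
      intervalIntegral.integral_comp_sub_left (fun t => t⁻¹), sub_sub_cancel,
      integral_inv_of_pos h0 (by linarith), Real.log_div (by linarith) h0.ne']
    push_cast
    rfl
  | succ p ih =>
    obtain ⟨c₀, c₁, h⟩ := ih
    refine ⟨_, _, ((h.sub h.ofReal_mul).sub (logAsymp_one_sub_two_mul_pow (p + 1)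
      (1 / ((p : ℂ) + 1)))).congr' fun ε h0 h1 => ?_⟩
    have hi : IntervalIntegrable (fun t : ℝ => (1 - (t : ℂ))⁻¹ * ((t : ℂ) - ε) ^ p) volume
        ε (1 - ε) := by
      refine ContinuousOn.intervalIntegrable (ContinuousOn.mul ?_ (by fun_prop))
      refine ContinuousOn.inv₀ (by fun_prop) fun t ht => ?_
      rw [Set.uIcc_of_le (by linarith)] at ht
      have : 0 < 1 - t := by linarith [ht.2]
      exact_mod_cast this.ne'
    rw [← integral_sub_pow, ← intervalIntegral.integral_const_mul,
      ← intervalIntegral.integral_sub hi (hi.const_mul _), ← intervalIntegral.integral_sub]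
    · refine intervalIntegral.integral_congr fun t ht => ?_
      rw [Set.uIcc_of_le (by linarith)] at ht
      have : (1 - t : ℂ) ≠ 0 := by
        have : 0 < 1 - t := by linarith [ht.2]
        exact_mod_cast this.ne'
      field_simp
      ring
    · exact hi.sub (hi.const_mul _)
    · exact Continuous.intervalIntegrable (by fun_prop) _ _

/-! ### The singular part of `f_1` -/

/-- The entire function `(1 - e^{2πix}) / (x (x - 1))`. -/
def expiQuot : ℂ → ℂ := dslope (dslope (fun x => 1 - expi x) 0) 1

theorem differentiable_dslope {f : ℂ → ℂ} (hf : Differentiable ℂ f) (a : ℂ) :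
    Differentiable ℂ (dslope f a) := fun b => (analyticAt_dslope hf a b).differentiableAt

theorem hasDerivAt_expi (x : ℂ) : HasDerivAt expi (2 * Real.pi * Complex.I * expi x) x := by
  have := ((hasDerivAt_id x).const_mul (2 * Real.pi * Complex.I)).cexp
  simp only [id, mul_one] at this
  rw [mul_comm]
  exact this

theorem differentiable_expiQuot : Differentiable ℂ expiQuot := by
  refine differentiable_dslope (differentiable_dslope ?_ 0) 1
  exact fun x => ((hasDerivAt_expi x).differentiableAt.const_sub 1)

theorem expi_one : expi 1 = 1 := by
  have := Complex.exp_two_pi_mul_I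
  rwa [expi, mul_one]

theorem one_sub_expi_eq (x : ℂ) : 1 - expi x = x * (x - 1) * expiQuot x := by
  have h0 : expi 0 = 1 := by simp [expi]
  have h1 : ∀ x, x * dslope (fun x => 1 - expi x) 0 x = 1 - expi x := fun x => by
    have := sub_smul_dslope (fun x => 1 - expi x) 0 x
    simpa [h0] using this
  have h2 := sub_smul_dslope (dslope (fun x => 1 - expi x) 0) 1 x
  have h3 := h1 1
  rw [one_mul, expi_one, sub_self] at h3
  rw [h3, sub_zero, smul_eq_mul] at h2
  rw [← h1, ← h2, expiQuot]
  ring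

theorem expi_eq_expiQuot (x : ℂ) : -(2 * Real.pi * Complex.I * expi x) =
    (2 * x - 1) * expiQuot x + x * (x - 1) * deriv expiQuot x := by
  have h1 : HasDerivAt (fun x => 1 - expi x) (-(2 * Real.pi * Complex.I * expi x)) x :=
    (hasDerivAt_expi x).const_sub 1
  have h2 := ((hasDerivAt_id x).mul ((hasDerivAt_id x).sub_const 1)).mul
    (differentiable_expiQuot x).hasDerivAt
  have h3 : (fun x => 1 - expi x) = (id * fun x => id x - 1) * expiQuot := by
    funext x
    simpa using one_sub_expi_eq x
  rw [h3] at h1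
  rw [h1.unique h2]
  simp only [id, Pi.mul_apply]
  ring

/-- The zeros of 1 - e^{2πix} at 0 and 1 are simple, and it has no others on [0, 1]. -/
theorem expiQuot_ne_zero {t : ℝ} (ht : t ∈ Set.Icc (0 : ℝ) 1) : expiQuot t ≠ 0 := by
  intro h
  have h1 := one_sub_expi_eq t
  have h2 := expi_eq_expiQuot t
  rw [h, mul_zero] at h1 h2
  have h3 : (t : ℂ) * (t - 1) ≠ 0 := by
    intro h4
    rw [h4, zero_mul, add_zero, neg_eq_zero] at h2
    exact mul_ne_zero Complex.two_pi_I_ne_zero (expi_ne_zero _) h2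
  have h4 : t ≠ 0 := by rintro rfl; simp at h3
  have h5 : t ≠ 1 := by rintro rfl; simp at h3
  exact expi_ofReal_ne_one (lt_of_le_of_ne ht.1 h4.symm) (lt_of_le_of_ne ht.2 h5)
    (by linear_combination -h1)

/-- The regular part of `-2πi e^{2πit} / (1 - e^{2πit})` on `[0, 1]`. -/
def expiLogDeriv (t : ℝ) : ℂ := deriv expiQuot t / expiQuot t

theorem continuousOn_expiLogDeriv : ContinuousOn expiLogDeriv (Set.Icc 0 1) := by
  have h1 : Continuous fun t : ℝ => deriv expiQuot t := by
    have : Continuous (deriv expiQuot) :=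
      (differentiable_expiQuot.contDiff (n := 1)).continuous_deriv le_rfl
    exact this.comp Complex.continuous_ofReal
  have h2 : Continuous fun t : ℝ => expiQuot t :=
    differentiable_expiQuot.continuous.comp Complex.continuous_ofReal
  exact h1.continuousOn.div h2.continuousOn fun t ht => expiQuot_ne_zero ht

/-- The left side is the logarithmic derivative of 1 - e^{2πit} = t(t-1)Q(t), which splits into the
two poles and Q'/Q. This isolates the singularity of f_1. -/
theorem expi_mul_inv_one_sub {t : ℝ} (h0 : 0 < t) (h1 : t < 1) :
    -(2 * Real.pi * Complex.I) * (expi t * (1 - expi t)⁻¹) =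
      (t : ℂ)⁻¹ - (1 - (t : ℂ))⁻¹ + expiLogDeriv t := by
  have h2 : (t : ℂ) ≠ 0 := by exact_mod_cast h0.ne'
  have h3 : (1 - t : ℂ) ≠ 0 := by
    have : 0 < 1 - t := by linarith
    exact_mod_cast this.ne'
  have h4 := expiQuot_ne_zero (t := t) ⟨h0.le, h1.le⟩
  have h5 : (t - 1 : ℂ) ≠ 0 := by rw [← neg_sub]; exact neg_ne_zero.mpr h3
  rw [expiLogDeriv, ← mul_assoc, neg_mul, expi_eq_expiQuot, one_sub_expi_eq]
  have h6 : (1 - (t : ℂ))⁻¹ = -(t - 1 : ℂ)⁻¹ := by rw [← inv_neg, neg_sub]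
  rw [h6]
  field_simp
  ring

/-! ### Lambert series -/

theorem summable_pair_pow {r : ℝ} (h0 : 0 ≤ r) (h1 : r < 1) (i : ℕ) :
    Summable fun p : ℕ × ℕ => ((p.1 : ℝ) + 1) ^ i * r ^ ((p.1 + 1) * (p.2 + 1)) := by
  -- A small exponential e^{(k+1)Y} dominates any power of k + 1 while keeping the pair series
  -- convergent.
  obtain ⟨Y, hY0, hY⟩ : ∃ Y : ℝ, 0 < Y ∧ r * Real.exp Y < 1 := by
    have hc : ContinuousAt (fun Y : ℝ => r * Real.exp Y) 0 := by fun_prop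
    have h2 : ∀ᶠ Y : ℝ in 𝓝[>] 0, r * Real.exp Y < 1 :=
      (hc.eventually_lt_const (by simpa using h1)).filter_mono nhdsWithin_le_nhds
    obtain ⟨Y, hY⟩ := (h2.and self_mem_nhdsWithin).exists
    exact ⟨Y, hY.2, hY.1⟩
  refine Summable.of_nonneg_of_le (fun _ => by positivity) (fun p => ?_)
    ((summable_pair_exp h0 h1 hY).mul_left ((i.factorial : ℝ) / Y ^ i))
  have h2 := Real.pow_div_factorial_le_exp (x := ((p.1 : ℝ) + 1) * Y) (by positivity) i
  have h3 : (0 : ℝ) < i.factorial := by exact_mod_cast i.factorial_pos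
  have h4 : ((p.1 : ℝ) + 1) ^ i ≤ (i.factorial : ℝ) / Y ^ i * Real.exp ((p.1 + 1) * Y) := by
    rw [div_mul_eq_mul_div, le_div_iff₀ (by positivity), ← mul_pow]
    rwa [div_le_iff₀' h3] at h2
  calc _ ≤ (i.factorial : ℝ) / Y ^ i * Real.exp ((p.1 + 1) * Y) * r ^ ((p.1 + 1) * (p.2 + 1)) :=
        mul_le_mul_of_nonneg_right h4 (by positivity)
    _ = _ := by ring

theorem sum_fiber_mul (n : ℕ) (f : ℕ × ℕ → ℂ) :
    ∑' b : (fun p : ℕ × ℕ => (p.1 + 1) * (p.2 + 1)) ⁻¹' {n}, f b =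
      ∑ x ∈ n.divisorsAntidiagonal, f (x.1 - 1, x.2 - 1) := by
  have hset : (fun p : ℕ × ℕ => (p.1 + 1) * (p.2 + 1)) ⁻¹' {n} =
      ((n.divisorsAntidiagonal.image fun x => (x.1 - 1, x.2 - 1) : Finset (ℕ × ℕ)) :
        Set (ℕ × ℕ)) := by
    ext ⟨a, b⟩
    simp only [Set.mem_preimage, Set.mem_singleton_iff, Finset.coe_image, Set.mem_image,
      Finset.mem_coe, Nat.mem_divisorsAntidiagonal, Prod.exists, Prod.mk.injEq]
    constructor
    · rintro h
      exact ⟨a + 1, b + 1, ⟨h, by rw [← h]; positivity⟩, by simp, by simp⟩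
    · rintro ⟨c, d, ⟨h, h0⟩, rfl, rfl⟩
      have hc : c ≠ 0 := by rintro rfl; simp at h; omega
      have hd : d ≠ 0 := by rintro rfl; simp at h; omega
      rw [Nat.sub_add_cancel (by omega), Nat.sub_add_cancel (by omega), h]
  rw [tsum_congr_set_coe f hset, Finset.tsum_subtype', Finset.sum_image]
  rintro ⟨a, b⟩ ha ⟨c, d⟩ hc h
  simp only [Finset.mem_coe, Nat.mem_divisorsAntidiagonal, Prod.mk.injEq] at ha hc h
  obtain ⟨ha, h0⟩ := ha
  obtain ⟨hc, -⟩ := hc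
  have a1 : a ≠ 0 := by rintro rfl; simp at ha; omega
  have a2 : b ≠ 0 := by rintro rfl; simp at ha; omega
  have a3 : c ≠ 0 := by rintro rfl; simp at hc; omega
  have a4 : d ≠ 0 := by rintro rfl; simp at hc; omega
  ext <;> simp only [] <;> omega

theorem norm_natCast_add_one (n : ℕ) : ‖((n : ℂ) + 1)‖ = (n : ℝ) + 1 := by
  exact_mod_cast Complex.norm_natCast (n + 1)

/-- Pairs (k, m) are grouped by n = km. Since k^i/m^{l+1} = k^{i+l+1}/n^{l+1}, each group gives
σ_{i+l+1}(n)/(2πin)^{l+1}. -/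
theorem hasSum_lambert (i l : ℕ) (τ : ℍ) :
    HasSum (fun p : ℕ × ℕ => ((p.1 : ℂ) + 1) ^ i /
        (2 * Real.pi * Complex.I * ((p.2 : ℂ) + 1)) ^ (l + 1) *
        expi τ ^ ((p.1 + 1) * (p.2 + 1)))
      (qs (antiCoeff (sigCoeff (i + l + 2)) (l + 1)) τ) := by
  have hs : Summable (fun p : ℕ × ℕ => ((p.1 : ℂ) + 1) ^ i /
        (2 * Real.pi * Complex.I * ((p.2 : ℂ) + 1)) ^ (l + 1) *
        expi τ ^ ((p.1 + 1) * (p.2 + 1))) := by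
    refine Summable.of_norm_bounded (summable_pair_pow (norm_nonneg (expi τ))
      (norm_expi_lt_one τ) i) fun p => ?_
    rw [norm_mul, norm_div, norm_pow, norm_pow, norm_pow, norm_natCast_add_one]
    refine mul_le_mul_of_nonneg_right (div_le_self (by positivity) (one_le_pow₀ ?_))
      (by positivity)
    rw [norm_mul, norm_natCast_add_one]
    have h1 : (1 : ℝ) ≤ ‖(2 * Real.pi * Complex.I : ℂ)‖ := by
      simp only [norm_mul, Complex.norm_ofNat, Complex.norm_real, Complex.norm_I, mul_one,
        Real.norm_of_nonneg Real.pi_pos.le]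
      linarith [Real.two_le_pi]
    have h2 : (1 : ℝ) ≤ (p.2 : ℝ) + 1 := by linarith [(Nat.cast_nonneg p.2 : (0 : ℝ) ≤ p.2)]
    exact one_le_mul_of_one_le_of_one_le h1 h2
  have h1 := hs.hasSum.tsum_fiberwise fun p : ℕ × ℕ => (p.1 + 1) * (p.2 + 1)
  rw [qs]
  convert hs.hasSum using 1
  rw [← h1.tsum_eq]
  refine tsum_congr fun n => ?_
  refine Eq.trans ?_ (sum_fiber_mul n fun p : ℕ × ℕ => ((p.1 : ℂ) + 1) ^ i /
    (2 * Real.pi * Complex.I * ((p.2 : ℂ) + 1)) ^ (l + 1) *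
      expi τ ^ ((p.1 + 1) * (p.2 + 1))).symm
  rw [antiCoeff, sigCoeff, ArithmeticFunction.sigma_apply, Nat.cast_sum,
    ← Nat.sum_divisorsAntidiagonal (fun d _ => ((d ^ (i + l + 2 - 1) : ℕ) : ℂ)), Finset.sum_div,
    Finset.sum_mul]
  refine Finset.sum_congr rfl fun x hx => ?_
  obtain ⟨hx, hn⟩ := Nat.mem_divisorsAntidiagonal.mp hx
  have a1 : x.1 ≠ 0 := by intro h; rw [h] at hx; simp at hx; omega
  have a2 : x.2 ≠ 0 := by intro h; rw [h] at hx; simp at hx; omega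
  obtain ⟨a, ha⟩ := Nat.exists_eq_succ_of_ne_zero a1
  obtain ⟨b, hb⟩ := Nat.exists_eq_succ_of_ne_zero a2
  rw [← hx, ha, hb, qexp, ← expi]
  have e1 : (a : ℂ) + 1 ≠ 0 := by exact_mod_cast a.succ_ne_zero
  have e2 : (b : ℂ) + 1 ≠ 0 := by exact_mod_cast b.succ_ne_zero
  have e3 := Complex.two_pi_I_ne_zero
  simp only [Nat.succ_eq_add_one, Nat.add_sub_cancel]
  push_cast
  congr 1
  generalize (2 * Real.pi * Complex.I : ℂ) = w at *
  rw [add_assoc i l 1, pow_add, mul_pow, mul_pow, mul_pow]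
  field_simp

/-! ### Integrals over the real period -/

/-- The moments `∫_0^1 e^{ct} t^j/j! dt`. -/
def expMoment (c : ℂ) (j : ℕ) : ℂ :=
  ∫ t in (0 : ℝ)..1, Complex.exp (c * t) * ((t : ℂ) ^ j / (j.factorial : ℂ))

theorem hasDerivAt_exp_mul_ofReal (c : ℂ) (t : ℝ) :
    HasDerivAt (fun t : ℝ => Complex.exp (c * t)) (c * Complex.exp (c * t)) t := by
  have := ((hasDerivAt_id t).ofReal_comp.const_mul c).cexp
  simp only [id, Complex.ofReal_one, mul_one] at this
  rw [mul_comm]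
  exact this

theorem hasDerivAt_ofReal_pow_div_factorial (j : ℕ) (t : ℝ) :
    HasDerivAt (fun t : ℝ => (t : ℂ) ^ (j + 1) / ((j + 1).factorial : ℂ))
      ((t : ℂ) ^ j / (j.factorial : ℂ)) t := by
  have h := ((hasDerivAt_id t).ofReal_comp.pow (j + 1)).div_const ((j + 1).factorial : ℂ)
  refine h.congr_deriv ?_
  have h1 : ((j : ℂ) + 1) ≠ 0 := by exact_mod_cast j.succ_ne_zero
  have h2 : (j.factorial : ℂ) ≠ 0 := by exact_mod_cast j.factorial_ne_zero
  rw [Nat.factorial_succ]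
  simp only [id, Complex.ofReal_one, mul_one, Nat.add_sub_cancel]
  push_cast
  field_simp

theorem expMoment_zero {c : ℂ} (hc : c ≠ 0) (h1 : Complex.exp c = 1) : expMoment c 0 = 0 := by
  have h : ∀ t ∈ Set.uIcc (0 : ℝ) 1, HasDerivAt (fun t : ℝ => Complex.exp (c * t) / c)
      (Complex.exp (c * t) * ((t : ℂ) ^ 0 / ((0 : ℕ).factorial : ℂ))) t := fun t _ => by
    refine ((hasDerivAt_exp_mul_ofReal c t).div_const c).congr_deriv ?_
    rw [mul_div_cancel_left₀ _ hc]
    simp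
  rw [expMoment, intervalIntegral.integral_eq_sub_of_hasDerivAt h
    (Continuous.intervalIntegrable (by fun_prop) _ _)]
  simp [h1]

/-- Integration by parts; the boundary term is simple because e^c = 1, as holds for c = ±2πim. -/
theorem expMoment_succ {c : ℂ} (hc : c ≠ 0) (h1 : Complex.exp c = 1) (j : ℕ) :
    expMoment c (j + 1) = 1 / (((j + 1).factorial : ℂ) * c) - expMoment c j / c := by
  have h : ∀ t ∈ Set.uIcc (0 : ℝ) 1,
      HasDerivAt (fun t : ℝ => Complex.exp (c * t) * ((t : ℂ) ^ (j + 1) / ((j + 1).factorial : ℂ)))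
      (c * (Complex.exp (c * t) * ((t : ℂ) ^ (j + 1) / ((j + 1).factorial : ℂ))) +
        Complex.exp (c * t) * ((t : ℂ) ^ j / (j.factorial : ℂ))) t := fun t _ => by
    refine ((hasDerivAt_exp_mul_ofReal c t).mul
      (hasDerivAt_ofReal_pow_div_factorial j t)).congr_deriv ?_
    ring
  have h2 := intervalIntegral.integral_eq_sub_of_hasDerivAt h
    (Continuous.intervalIntegrable (by fun_prop) _ _)
  rw [intervalIntegral.integral_add (Continuous.intervalIntegrable (by fun_prop) _ _)
    (Continuous.intervalIntegrable (by fun_prop) _ _), intervalIntegral.integral_const_mul,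
    ← expMoment, ← expMoment] at h2
  simp only [Complex.ofReal_one, mul_one, h1, one_pow, one_mul, Complex.ofReal_zero, ne_eq,
    Nat.add_eq_zero_iff, one_ne_zero, and_false, not_false_eq_true, zero_pow, zero_div,
    mul_zero, sub_zero] at h2
  have h3 : ((j + 1).factorial : ℂ) ≠ 0 := by exact_mod_cast (j + 1).factorial_ne_zero
  field_simp at h2 ⊢
  linear_combination h2

theorem expMoment_eq {c : ℂ} (hc : c ≠ 0) (h1 : Complex.exp c = 1) (j : ℕ) :
    expMoment c j =
      ∑ l ∈ Finset.range j, (-1) ^ l / (((j - l).factorial : ℂ) * c ^ (l + 1)) := by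
  induction j with
  | zero => rw [expMoment_zero hc h1, Finset.sum_range_zero]
  | succ j ih =>
    rw [expMoment_succ hc h1, ih, Finset.sum_range_succ', Finset.sum_div, sub_eq_add_neg, add_comm,
      ← Finset.sum_neg_distrib]
    congr 1
    · refine Finset.sum_congr rfl fun l _ => ?_
      rw [Nat.add_sub_add_right, pow_succ (-1 : ℂ), pow_succ c (l + 1)]
      field_simp
    · simp

theorem exp_two_pi_mul_I_mul_natCast (m : ℕ) : Complex.exp (2 * Real.pi * Complex.I * m) = 1 := by
  rw [mul_comm]
  exact Complex.exp_nat_mul_two_pi_mul_I m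

theorem expi_ofReal_pow (t : ℝ) (m : ℕ) :
    expi t ^ m = Complex.exp (2 * Real.pi * Complex.I * m * t) := by
  rw [expi, ← Complex.exp_nat_mul]
  congr 1
  ring

theorem continuous_expi_ofReal : Continuous fun t : ℝ => expi t := by
  unfold expi
  fun_prop

theorem norm_pairCoeff_term_le {z : ℂ} (hz : ‖z‖ = 1) (q : ℂ) (i : ℕ) (p : ℕ × ℕ) :
    ‖(z ^ (p.2 + 1) - (-1) ^ i * z⁻¹ ^ (p.2 + 1)) *
      ((p.1 + 1 : ℂ) ^ i / (i.factorial : ℂ)) * q ^ ((p.1 + 1) * (p.2 + 1))‖ ≤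
      2 * (((p.1 : ℝ) + 1) ^ i * ‖q‖ ^ ((p.1 + 1) * (p.2 + 1))) := by
  have h1 : ‖z ^ (p.2 + 1) - (-1) ^ i * z⁻¹ ^ (p.2 + 1)‖ ≤ 2 := by
    refine (norm_sub_le _ _).trans ?_
    simp only [norm_mul, norm_pow, norm_neg, norm_one, one_pow, norm_inv, hz, inv_one, one_mul]
    norm_num
  have h2 : ((p.1 : ℝ) + 1) ^ i / (i.factorial : ℝ) ≤ ((p.1 : ℝ) + 1) ^ i := by
    refine div_le_self (by positivity) ?_
    exact_mod_cast Nat.one_le_iff_ne_zero.mpr i.factorial_ne_zero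
  rw [norm_mul, norm_mul, norm_div, norm_pow, norm_pow, norm_natCast_add_one, Complex.norm_natCast,
    ← mul_assoc]
  gcongr

theorem continuous_inv_expi : Continuous fun t : ℝ => (expi t)⁻¹ :=
  continuous_expi_ofReal.inv₀ fun _ => expi_ne_zero _

theorem continuous_pairCoeff (τ : ℍ) (i : ℕ) : Continuous fun t : ℝ =>
    pairCoeff (expi t) (expi τ) i := by
  refine continuous_tsum (fun p => ?_) ((summable_pair_pow (norm_nonneg (expi τ))
    (norm_expi_lt_one τ) i).mul_left 2) fun p t => norm_pairCoeff_term_le (norm_expi_ofReal t) _ _ _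
  have h1 := continuous_expi_ofReal
  have h2 := continuous_inv_expi
  fun_prop

/-- The moments of the double series. -/
theorem integral_pairCoeff (τ : ℍ) (i j : ℕ) :
    ∫ t in (0 : ℝ)..1, pairCoeff (expi t) (expi τ) i * ((t : ℂ) ^ j / (j.factorial : ℂ)) =
      ∑ l ∈ Finset.range j, 1 / ((j - l).factorial : ℂ) * ((-1) ^ l * (2 * parity (i + l + 2)) /
        (i.factorial : ℂ) * qs (antiCoeff (sigCoeff (i + l + 2)) (l + 1)) τ) := by
  have hterm : ∀ p : ℕ × ℕ, ∫ t in (0 : ℝ)..1, (expi t ^ (p.2 + 1) -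
      (-1) ^ i * (expi t)⁻¹ ^ (p.2 + 1)) * ((p.1 + 1 : ℂ) ^ i / (i.factorial : ℂ)) *
        expi τ ^ ((p.1 + 1) * (p.2 + 1)) * ((t : ℂ) ^ j / (j.factorial : ℂ)) =
      ∑ l ∈ Finset.range j, 1 / ((j - l).factorial : ℂ) * ((-1) ^ l * (2 * parity (i + l + 2)) /
        (i.factorial : ℂ) * (((p.1 : ℂ) + 1) ^ i /
        (2 * Real.pi * Complex.I * ((p.2 : ℂ) + 1)) ^ (l + 1) *
        expi τ ^ ((p.1 + 1) * (p.2 + 1)))) := by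
    intro p
    have hm : (2 * Real.pi * Complex.I * ((p.2 + 1 : ℕ) : ℂ)) ≠ 0 :=
      mul_ne_zero Complex.two_pi_I_ne_zero (by exact_mod_cast p.2.succ_ne_zero)
    have hm1 := exp_two_pi_mul_I_mul_natCast (p.2 + 1)
    have e1 : ∀ t : ℝ, (expi t ^ (p.2 + 1) -
      (-1) ^ i * (expi t)⁻¹ ^ (p.2 + 1)) * ((p.1 + 1 : ℂ) ^ i / (i.factorial : ℂ)) *
        expi τ ^ ((p.1 + 1) * (p.2 + 1)) * ((t : ℂ) ^ j / (j.factorial : ℂ)) =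
      ((p.1 + 1 : ℂ) ^ i / (i.factorial : ℂ) * expi τ ^ ((p.1 + 1) * (p.2 + 1))) *
        (Complex.exp (2 * Real.pi * Complex.I * ((p.2 + 1 : ℕ) : ℂ) * t) *
            ((t : ℂ) ^ j / (j.factorial : ℂ)) -
          (-1) ^ i * (Complex.exp (-(2 * Real.pi * Complex.I * ((p.2 + 1 : ℕ) : ℂ)) * t) *
            ((t : ℂ) ^ j / (j.factorial : ℂ)))) := by
      intro t
      rw [inv_pow, expi_ofReal_pow, ← Complex.exp_neg, neg_mul]
      ring
    simp_rw [e1]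
    rw [intervalIntegral.integral_const_mul, intervalIntegral.integral_sub
      (Continuous.intervalIntegrable (by fun_prop) _ _)
      (Continuous.intervalIntegrable (by fun_prop) _ _), intervalIntegral.integral_const_mul,
      ← expMoment, ← expMoment, expMoment_eq hm hm1, expMoment_eq (neg_ne_zero.mpr hm)
        (by rw [Complex.exp_neg, hm1, inv_one]), Finset.mul_sum, ← Finset.sum_sub_distrib,
      Finset.mul_sum]
    refine Finset.sum_congr rfl fun l _ => ?_
    have e2 : ((j - l).factorial : ℂ) ≠ 0 := by exact_mod_cast (j - l).factorial_ne_zero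
    have e3 : (i.factorial : ℂ) ≠ 0 := by exact_mod_cast i.factorial_ne_zero
    -- The moments for the frequencies m and -m either add up or cancel, which produces the parity
    -- factor of the Eisenstein series.
    have e4 : 2 * parity (i + l + 2) = 1 - (-1) ^ i * (-1) ^ (l + 1) := by
      rw [parity]
      ring
    have e5 : ((p.2 + 1 : ℕ) : ℂ) = (p.2 : ℂ) + 1 := by push_cast; rfl
    rw [e4]
    rw [e5] at hm ⊢
    have e6 : ((-1 : ℂ) ^ (l + 1))⁻¹ = (-1) ^ (l + 1) := by
      rw [← inv_pow]; norm_num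
    generalize (2 * Real.pi * Complex.I * ((p.2 : ℂ) + 1)) = w at *
    have e7 := pow_ne_zero (l + 1) hm
    rw [neg_pow w, div_eq_mul_inv _ (((j - l).factorial : ℂ) * ((-1) ^ (l + 1) * w ^ (l + 1))),
      mul_inv, mul_inv, e6]
    field_simp
  have hleft : HasSum (fun p : ℕ × ℕ => ∫ t in (0 : ℝ)..1, (expi t ^ (p.2 + 1) -
      (-1) ^ i * (expi t)⁻¹ ^ (p.2 + 1)) * ((p.1 + 1 : ℂ) ^ i / (i.factorial : ℂ)) *
        expi τ ^ ((p.1 + 1) * (p.2 + 1)) * ((t : ℂ) ^ j / (j.factorial : ℂ)))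
      (∫ t in (0 : ℝ)..1, pairCoeff (expi t) (expi τ) i * ((t : ℂ) ^ j / (j.factorial : ℂ))) := by
    have hs := (summable_pair_pow (norm_nonneg (expi τ)) (norm_expi_lt_one τ) i).mul_left 2
    have hsn : ∀ t : ℝ, Summable fun p : ℕ × ℕ => (expi t ^ (p.2 + 1) -
      (-1) ^ i * (expi t)⁻¹ ^ (p.2 + 1)) * ((p.1 + 1 : ℂ) ^ i / (i.factorial : ℂ)) *
        expi τ ^ ((p.1 + 1) * (p.2 + 1)) := fun t =>
      Summable.of_norm_bounded hs fun p => norm_pairCoeff_term_le (norm_expi_ofReal t) _ _ _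
    refine intervalIntegral.hasSum_integral_of_dominated_convergence
      (fun p _ => 2 * (((p.1 : ℝ) + 1) ^ i * ‖expi τ‖ ^ ((p.1 + 1) * (p.2 + 1))))
      (fun p => ?_) (fun p => ?_) ?_ ?_ ?_
    · have h1 := continuous_expi_ofReal
      have h2 := continuous_inv_expi
      exact Continuous.aestronglyMeasurable (by fun_prop)
    · refine ae_of_all _ fun t ht => ?_
      rw [Set.uIoc_of_le zero_le_one] at ht
      rw [norm_mul]
      refine (mul_le_mul (norm_pairCoeff_term_le (norm_expi_ofReal t) _ _ _) ?_ (norm_nonneg _)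
        (by positivity)).trans_eq (mul_one _)
      rw [norm_div, norm_pow, Complex.norm_real, Real.norm_of_nonneg ht.1.le,
        Complex.norm_natCast]
      refine div_le_one_of_le₀ ((pow_le_one₀ ht.1.le ht.2).trans ?_) (by positivity)
      exact_mod_cast Nat.one_le_iff_ne_zero.mpr j.factorial_ne_zero
    · exact ae_of_all _ fun t _ => hs
    · exact intervalIntegrable_const
    · exact ae_of_all _ fun t _ => (hsn t).hasSum.mul_right _
  refine hleft.unique ?_
  simp_rw [hterm]
  refine hasSum_sum fun l _ => ?_
  exact ((hasSum_lambert i l τ).mul_left _).mul_left _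

/-! ### Existence of the regularized values -/

theorem omega_ofReal (n : ℕ) (t : ℝ) (τ : ℍ) : omega n t τ = kroneckerCoeff n t τ := by
  rw [omega, Finset.sum_range_succ', Finset.sum_eq_zero fun k _ => by simp]
  simp

theorem omega_zero_ofReal {t : ℝ} (h0 : 0 < t) (h1 : t < 1) (τ : ℍ) :
    omega 0 t τ = 2 * Real.pi * Complex.I := by
  rw [omega_ofReal, kroneckerCoeff_ofReal h0 h1, kronCoeff]
  ring

theorem omega_succ_ofReal {t : ℝ} (h0 : 0 < t) (h1 : t < 1) (τ : ℍ) (i : ℕ) :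
    omega (i + 1) t τ = (if i = 0 then (t : ℂ)⁻¹ - (1 - (t : ℂ))⁻¹ + expiLogDeriv t else 0) +
      2 * Real.pi * Complex.I * ((bernoulli (i + 1) : ℂ) / ((i + 1).factorial : ℂ) -
        pairCoeff (expi t) (expi τ) i) := by
  rw [omega_ofReal, kroneckerCoeff_ofReal h0 h1, kronCoeff]
  split_ifs with h
  · rw [← expi_mul_inv_one_sub h0 h1]; ring
  · ring

theorem iterInt_replicate_zero (τ : ℍ) {ε : ℝ} (h0 : 0 < ε) (j : ℕ) :
    ∀ b : ℝ, ε ≤ b → b < 1 → iterInt τ ε (List.replicate j 0) b =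
      (2 * Real.pi * Complex.I) ^ j / (j.factorial : ℂ) * ((b : ℂ) - ε) ^ j := by
  induction j with
  | zero => intro b _ _; simp [iterInt]
  | succ j ih =>
    intro b hb hb1
    rw [List.replicate_succ, iterInt]
    have h : ∀ t ∈ Set.uIcc ε b, HasDerivAt (fun t : ℝ => (2 * Real.pi * Complex.I) ^ (j + 1) /
        ((j + 1).factorial : ℂ) * ((t : ℂ) - ε) ^ (j + 1))
        ((2 * Real.pi * Complex.I) ^ (j + 1) / (j.factorial : ℂ) * ((t : ℂ) - ε) ^ j) t := by
      intro t _
      refine ((((hasDerivAt_id t).ofReal_comp.sub_const (ε : ℂ)).pow (j + 1)).const_mul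
        _).congr_deriv ?_
      have h1 : ((j : ℂ) + 1) ≠ 0 := by exact_mod_cast j.succ_ne_zero
      have h2 : (j.factorial : ℂ) ≠ 0 := by exact_mod_cast j.factorial_ne_zero
      rw [Nat.factorial_succ]
      simp only [id, Complex.ofReal_one, mul_one, Nat.add_sub_cancel]
      push_cast
      field_simp
    have h2 := intervalIntegral.integral_eq_sub_of_hasDerivAt h
      (Continuous.intervalIntegrable (by fun_prop) _ _)
    rw [sub_self, zero_pow j.succ_ne_zero, mul_zero, sub_zero] at h2
    rw [← h2]
    refine intervalIntegral.integral_congr fun t ht => ?_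
    rw [Set.uIcc_of_le hb] at ht
    have ht1 : t < 1 := ht.2.trans_lt hb1
    rw [ih t ht.1 ht1, omega_zero_ofReal (h0.trans_le ht.1) ht1]
    ring

theorem log_neg_two_pi_I_mul {ε : ℝ} (h : 0 < ε) :
    Complex.log (-2 * Real.pi * Complex.I * (ε : ℂ)) =
      (Real.log ε : ℂ) + Complex.log (-2 * Real.pi * Complex.I) := by
  have h1 : (-2 * Real.pi * Complex.I : ℂ) ≠ 0 := by
    have := Complex.two_pi_I_ne_zero
    rw [neg_mul, neg_mul]
    exact neg_ne_zero.mpr this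
  rw [mul_comm, Complex.log_ofReal_mul h h1]

/-- The regularization uses powers of log(-2πiε) = log ε + log(-2πi), so changing variable shifts
the constant term. No power above the first is needed in depth one. -/
theorem LogAsymp.isRegularizedValue {n : ℕ} {ns : List ℕ} {τ : ℍ} {c₀ c₁ : ℂ}
    (h : LogAsymp (fun ε => iterInt τ ε (n :: ns) (1 - ε)) c₀ c₁) :
    IsRegularizedValue (n :: ns) τ (c₀ - c₁ * Complex.log (-2 * Real.pi * Complex.I)) := by
  refine ⟨fun k => if k = 0 then c₀ - c₁ * Complex.log (-2 * Real.pi * Complex.I) else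
    if k = 1 then c₁ else 0, if_pos rfl, 1 / 2, by norm_num, ?_⟩
  refine IsBigO.congr' h ?_ (EventuallyEq.refl _ _)
  filter_upwards [self_mem_nhdsWithin] with ε hε
  rw [List.length_cons, Finset.sum_range_succ', Finset.sum_range_succ',
    Finset.sum_eq_zero fun k _ => by simp, log_neg_two_pi_I_mul hε]
  simp
  ring

/-- The singular part of f_1 does not involve τ, so its moments are absolute constants. -/
theorem exists_logAsymp_singular : ∃ a b : ℕ → ℂ, ∀ j, LogAsymp (fun ε => ∫ t in ε..(1 - ε),
    ((t : ℂ)⁻¹ - (1 - (t : ℂ))⁻¹ + expiLogDeriv t) * ((t : ℂ) - ε) ^ j) (a j) (b j) := by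
  choose a₁ b₁ h₁ using exists_logAsymp_inv
  choose a₂ b₂ h₂ using exists_logAsymp_inv_one_sub
  refine ⟨_, _, fun j => (((h₁ j).sub (h₂ j)).add
    (logAsymp_integral continuousOn_expiLogDeriv j)).congr' fun ε h0 h1 => ?_⟩
  have hle : ε ≤ 1 - ε := by linarith
  have i1 : IntervalIntegrable (fun t : ℝ => (t : ℂ)⁻¹ * ((t : ℂ) - ε) ^ j) volume ε (1 - ε) := by
    refine ContinuousOn.intervalIntegrable (ContinuousOn.mul ?_ (by fun_prop))
    refine ContinuousOn.inv₀ (by fun_prop) fun t ht => ?_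
    rw [Set.uIcc_of_le hle] at ht
    have : 0 < t := h0.trans_le ht.1
    exact_mod_cast this.ne'
  have i2 : IntervalIntegrable (fun t : ℝ => (1 - (t : ℂ))⁻¹ * ((t : ℂ) - ε) ^ j) volume
      ε (1 - ε) := by
    refine ContinuousOn.intervalIntegrable (ContinuousOn.mul ?_ (by fun_prop))
    refine ContinuousOn.inv₀ (by fun_prop) fun t ht => ?_
    rw [Set.uIcc_of_le hle] at ht
    have : 0 < 1 - t := by linarith [ht.2]
    exact_mod_cast this.ne'
  have i3 : IntervalIntegrable (fun t : ℝ => expiLogDeriv t * ((t : ℂ) - ε) ^ j) volume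
      ε (1 - ε) := by
    refine ContinuousOn.intervalIntegrable (ContinuousOn.mul (continuousOn_expiLogDeriv.mono ?_)
      (by fun_prop))
    rw [Set.uIcc_of_le hle]
    exact Set.Icc_subset_Icc h0.le (by linarith)
  rw [← intervalIntegral.integral_sub i1 i2, ← intervalIntegral.integral_add (i1.sub i2) i3]
  refine intervalIntegral.integral_congr fun t _ => ?_
  ring

/-- The `q`-series part of the coefficients of `ℰ`. -/
def coreSeries (i l : ℕ) (τ : ℂ) : ℂ :=
  (-1) ^ (i + 1) * (4 * Real.pi * Complex.I) / (i.factorial : ℂ) *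
    (parity (i + l + 2) * qs (antiCoeff (sigCoeff (i + l + 2)) (l + 1)) τ)

/-- The two signs differ only when `i + l` is odd, where the parity factor vanishes. -/
theorem neg_one_pow_mul_parity (i l : ℕ) :
    (-1 : ℂ) ^ l * parity (i + l + 2) = (-1) ^ i * parity (i + l + 2) := by
  have h1 : ((-1 : ℂ) ^ i) * (-1) ^ i = 1 := by rw [← mul_pow]; norm_num
  have h2 : ((-1 : ℂ) ^ l) * (-1) ^ l = 1 := by rw [← mul_pow]; norm_num
  rw [parity, pow_add, pow_add]
  linear_combination (1 / 2 : ℂ) * (-1) ^ i * h2 - (1 / 2 : ℂ) * (-1) ^ l * h1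

theorem integral_regular (τ : ℍ) (i j : ℕ) :
    ∫ t in (0 : ℝ)..1, 2 * Real.pi * Complex.I * ((bernoulli (i + 1) : ℂ) /
        ((i + 1).factorial : ℂ) - pairCoeff (expi t) (expi τ) i) * (t : ℂ) ^ j =
      (j.factorial : ℂ) * (2 * Real.pi * Complex.I * (bernoulli (i + 1) : ℂ) /
        ((i + 1).factorial : ℂ) / ((j + 1).factorial : ℂ) +
        ∑ l ∈ Finset.range j, 1 / ((j - l).factorial : ℂ) * coreSeries i l τ) := by
  have hj : (j.factorial : ℂ) ≠ 0 := by exact_mod_cast j.factorial_ne_zero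
  have e1 : ∀ t : ℝ, 2 * Real.pi * Complex.I * ((bernoulli (i + 1) : ℂ) /
        ((i + 1).factorial : ℂ) - pairCoeff (expi t) (expi τ) i) * (t : ℂ) ^ j =
      (j.factorial : ℂ) * (2 * Real.pi * Complex.I * (bernoulli (i + 1) : ℂ) /
        ((i + 1).factorial : ℂ) * ((t : ℂ) ^ j / (j.factorial : ℂ)) - 2 * Real.pi * Complex.I *
        (pairCoeff (expi t) (expi τ) i * ((t : ℂ) ^ j / (j.factorial : ℂ)))) := by
    intro t
    field_simp
  have hmom : ∫ t in (0 : ℝ)..1, ((t : ℂ) ^ j / (j.factorial : ℂ)) =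
      1 / ((j + 1).factorial : ℂ) := by
    rw [intervalIntegral.integral_eq_sub_of_hasDerivAt
      (fun t _ => hasDerivAt_ofReal_pow_div_factorial j t)
      (Continuous.intervalIntegrable (by fun_prop) _ _)]
    simp
  have hc := continuous_pairCoeff τ i
  simp_rw [e1]
  rw [intervalIntegral.integral_const_mul, intervalIntegral.integral_sub
    (Continuous.intervalIntegrable (by fun_prop) _ _)
    (Continuous.intervalIntegrable (by fun_prop) _ _), intervalIntegral.integral_const_mul,
    intervalIntegral.integral_const_mul, hmom, integral_pairCoeff, Finset.mul_sum,
    sub_eq_add_neg, ← Finset.sum_neg_distrib, mul_one_div]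
  congr 2
  refine Finset.sum_congr rfl fun l _ => ?_
  have h := neg_one_pow_mul_parity i l
  rw [coreSeries, pow_succ]
  linear_combination (-(4 * Real.pi * Complex.I) * (1 / ((j - l).factorial : ℂ)) /
    (i.factorial : ℂ) * qs (antiCoeff (sigCoeff (i + l + 2)) (l + 1)) τ) * h

theorem isRegularizedValue_zero (j : ℕ) (τ : ℍ) :
    IsRegularizedValue (0 :: List.replicate j 0) τ
      ((2 * Real.pi * Complex.I) ^ (j + 1) / ((j + 1).factorial : ℂ)) := by
  have h := logAsymp_one_sub_two_mul_pow (j + 1)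
    ((2 * Real.pi * Complex.I) ^ (j + 1) / ((j + 1).factorial : ℂ))
  have h2 : LogAsymp (fun ε => iterInt τ ε (0 :: List.replicate j 0) (1 - ε))
      ((2 * Real.pi * Complex.I) ^ (j + 1) / ((j + 1).factorial : ℂ)) 0 := by
    refine h.congr' fun ε h0 h1 => ?_
    rw [← List.replicate_succ, iterInt_replicate_zero τ h0 _ _ (by linarith) (by linarith)]
    push_cast
    ring
  simpa using h2.isRegularizedValue

/-- The sequence `a` is chosen before τ: all dependence on τ sits in `coreSeries`, which has no
constant term in q. The values of `a` will cancel between A and A^∞. -/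
theorem exists_isRegularizedValue : ∃ a : ℕ → ℂ, ∀ (i j : ℕ) (τ : ℍ),
    IsRegularizedValue ((i + 1) :: List.replicate j 0) τ ((2 * Real.pi * Complex.I) ^ j *
      ((if i = 0 then a j else 0) + 2 * Real.pi * Complex.I * (bernoulli (i + 1) : ℂ) /
        ((i + 1).factorial : ℂ) / ((j + 1).factorial : ℂ) +
        ∑ l ∈ Finset.range j, 1 / ((j - l).factorial : ℂ) * coreSeries i l τ)) := by
  obtain ⟨a, b, hab⟩ := exists_logAsymp_singular
  refine ⟨fun j => (a j - b j * Complex.log (-2 * Real.pi * Complex.I)) / (j.factorial : ℂ),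
    fun i j τ => ?_⟩
  have hj : (j.factorial : ℂ) ≠ 0 := by exact_mod_cast j.factorial_ne_zero
  have hcont : Continuous fun t : ℝ => 2 * Real.pi * Complex.I * ((bernoulli (i + 1) : ℂ) /
        ((i + 1).factorial : ℂ) - pairCoeff (expi t) (expi τ) i) := by
    have := continuous_pairCoeff τ i
    fun_prop
  have hreg := logAsymp_integral hcont.continuousOn j
  rw [integral_regular] at hreg
  have hint : ∀ ε : ℝ, 0 < ε → ε < 1 / 2 →
      iterInt τ ε ((i + 1) :: List.replicate j 0) (1 - ε) =
      (2 * Real.pi * Complex.I) ^ j / (j.factorial : ℂ) * ∫ t in ε..(1 - ε),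
        ((if i = 0 then (t : ℂ)⁻¹ - (1 - (t : ℂ))⁻¹ + expiLogDeriv t else 0) +
      2 * Real.pi * Complex.I * ((bernoulli (i + 1) : ℂ) / ((i + 1).factorial : ℂ) -
        pairCoeff (expi t) (expi τ) i)) * ((t : ℂ) - ε) ^ j := by
    intro ε h0 h1
    rw [iterInt, ← intervalIntegral.integral_const_mul]
    refine intervalIntegral.integral_congr fun t ht => ?_
    rw [Set.uIcc_of_le (by linarith)] at ht
    have ht1 : t < 1 := by linarith [ht.2]
    rw [iterInt_replicate_zero τ h0 j t ht.1 ht1, omega_succ_ofReal (h0.trans_le ht.1) ht1]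
    ring
  rcases eq_or_ne i 0 with rfl | hi
  · have h := ((hab j).add hreg).const_mul ((2 * Real.pi * Complex.I) ^ j / (j.factorial : ℂ))
    have h2 := (h.congr' (G := fun ε => iterInt τ ε ((0 + 1) :: List.replicate j 0) (1 - ε))
      fun ε h0 h1 => ?_).isRegularizedValue
    · convert h2 using 1
      simp only [if_true]
      field_simp
      ring
    · rw [hint ε h0 h1, ← intervalIntegral.integral_add]
      · congr 1
        refine intervalIntegral.integral_congr fun t _ => ?_
        simp only [if_true]
        ring
      · have hle : ε ≤ 1 - ε := by linarith
        refine ContinuousOn.intervalIntegrable (ContinuousOn.mul (ContinuousOn.add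
          (ContinuousOn.sub ?_ ?_) (continuousOn_expiLogDeriv.mono ?_)) (by fun_prop))
        · refine ContinuousOn.inv₀ (by fun_prop) fun t ht => ?_
          rw [Set.uIcc_of_le hle] at ht
          have : 0 < t := h0.trans_le ht.1
          exact_mod_cast this.ne'
        · refine ContinuousOn.inv₀ (by fun_prop) fun t ht => ?_
          rw [Set.uIcc_of_le hle] at ht
          have : 0 < 1 - t := by linarith [ht.2]
          exact_mod_cast this.ne'
        · rw [Set.uIcc_of_le hle]
          exact Set.Icc_subset_Icc h0.le (by linarith)
      · exact Continuous.intervalIntegrable (by fun_prop) _ _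
  · have h := hreg.const_mul ((2 * Real.pi * Complex.I) ^ j / (j.factorial : ℂ))
    have h2 := (h.congr' (G := fun ε => iterInt τ ε ((i + 1) :: List.replicate j 0) (1 - ε))
      fun ε h0 h1 => ?_).isRegularizedValue
    · convert h2 using 1
      simp only [if_neg hi]
      field_simp
      ring
    · rw [hint ε h0 h1]
      simp only [if_neg hi, zero_add]

/-! ### The `q`-expansions -/

theorem qParam_one (z : ℂ) : Function.Periodic.qParam 1 z = expi z := by
  simp [Function.Periodic.qParam, expi]

theorem hasSum_cuspFunction {f : ℍ → ℂ} {c : ℕ → ℂ}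
    (h : ∀ τ : ℍ, HasSum (fun m => c m * expi τ ^ m) (f τ)) {z : ℂ} (hz : z ≠ 0)
    (hz1 : ‖z‖ < 1) : HasSum (fun m => c m * z ^ m) (cuspFunction 1 f z) := by
  have him := Function.Periodic.im_invQParam_pos_of_norm_lt_one one_pos hz1 hz
  have h1 := h ⟨_, him⟩
  have h2 : expi (Function.Periodic.invQParam 1 z) = z := by
    rw [← qParam_one, Function.Periodic.qParam_right_inv one_ne_zero hz]
  have h3 : cuspFunction 1 f z = f ⟨_, him⟩ := by
    rw [cuspFunction, Function.Periodic.cuspFunction_eq_of_nonzero _ _ hz, Function.comp_apply,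
      ofComplex_apply_of_im_pos him]
  rw [h3]
  simpa only [UpperHalfPlane.coe_mk, h2] using h1

theorem eventually_hasSum_of_punctured {g : ℂ → ℂ} {c : ℕ → ℂ}
    (h : ∀ z : ℂ, z ≠ 0 → ‖z‖ < 1 → HasSum (fun m => c m * z ^ m) (g z)) :
    ∀ᶠ z in 𝓝 (0 : ℂ), HasSum (fun m => c m * z ^ m) (Function.update g 0 (c 0) z) := by
  have hball : ∀ᶠ z : ℂ in 𝓝 0, ‖z‖ < 1 := by
    have : ContinuousAt (fun z : ℂ => ‖z‖) 0 := by fun_prop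
    exact this.eventually_lt_const (by simp)
  filter_upwards [hball] with z hz
  rcases eq_or_ne z 0 with rfl | hz0
  · rw [Function.update_self]
    convert hasSum_single (f := fun m => c m * (0 : ℂ) ^ m) 0 fun m hm => by simp [hm] using 1
    simp
  · rw [Function.update_of_ne hz0]
    exact h z hz0 hz

/-- The cusp function agrees with the convergent power series on the punctured disc, and its value
at 0 is the limit there; Taylor coefficients are unique. -/
theorem qExpansion_coeff_eq {f : ℍ → ℂ} {c : ℕ → ℂ}
    (h : ∀ τ : ℍ, HasSum (fun m => c m * expi τ ^ m) (f τ)) (m : ℕ) :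
    (qExpansion 1 f).coeff m = c m := by
  have hev := eventually_hasSum_of_punctured fun z hz hz1 => hasSum_cuspFunction h hz hz1
  have h0 : cuspFunction 1 f 0 = c 0 := by
    rw [cuspFunction, Function.Periodic.cuspFunction_zero_eq_limUnder_nhds_ne]
    refine Tendsto.limUnder_eq ?_
    have h1 := (iteratedDeriv_of_hasSum hev).1.continuousAt.tendsto
    rw [Function.update_self] at h1
    refine (h1.mono_left nhdsWithin_le_nhds).congr' ?_
    filter_upwards [self_mem_nhdsWithin] with z hz
    exact Function.update_of_ne hz _ _
  rw [← h0, Function.update_eq_self] at hev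
  have h1 : (m.factorial : ℂ) ≠ 0 := by exact_mod_cast m.factorial_ne_zero
  rw [qExpansion_coeff, (iteratedDeriv_of_hasSum hev).2, inv_mul_cancel_left₀ h1]

theorem hasSum_qs {c : ℕ → ℂ} (h : HasPolyGrowth c) (τ : ℍ) :
    HasSum (fun m => c m * expi τ ^ m) (qs c τ) := (h.summable τ.im_pos).hasSum

/-! ### The constant terms of the depth one values -/

/-- The constant term of the `q`-expansion of `A_{i+1,j+1} / (2πi)^j`; the sequence `a` gives the
values for `i = 0` up to a common explicit summand. -/
def constTerm (a : ℕ → ℂ) (i j : ℕ) : ℂ :=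
  (if i = 0 then a j else 0) + 2 * Real.pi * Complex.I * (bernoulli (i + 1) : ℂ) /
    ((i + 1).factorial : ℂ) / ((j + 1).factorial : ℂ)

/-- The coefficients of the `q`-expansion of `coreSeries`. -/
def coreSeriesCoeff (i l m : ℕ) : ℂ :=
  (-1) ^ (i + 1) * (4 * Real.pi * Complex.I) / (i.factorial : ℂ) *
    (parity (i + l + 2) * antiCoeff (sigCoeff (i + l + 2)) (l + 1) m)

theorem coreSeriesCoeff_zero (i l : ℕ) : coreSeriesCoeff i l 0 = 0 := by
  rw [coreSeriesCoeff, ((hasPolyGrowth_sigCoeff (i + l + 2)).antiCoeff (l + 1)).apply_zero]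
  simp

theorem hasSum_coreSeries (i l : ℕ) (τ : ℍ) :
    HasSum (fun m => coreSeriesCoeff i l m * expi τ ^ m) (coreSeries i l τ) := by
  have h := ((hasSum_qs ((hasPolyGrowth_sigCoeff (i + l + 2)).antiCoeff (l + 1)) τ).mul_left
    (parity (i + l + 2))).mul_left
      ((-1) ^ (i + 1) * (4 * Real.pi * Complex.I) / (i.factorial : ℂ))
  refine h.congr_fun fun m => ?_
  rw [coreSeriesCoeff]
  ring

theorem hasSum_const_mul_pow (a x : ℂ) :
    HasSum (fun m : ℕ => (if m = 0 then a else 0) * x ^ m) a := by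
  convert hasSum_single (f := fun m : ℕ => (if m = 0 then a else 0) * x ^ m) 0
    (fun m hm => by simp [hm]) using 1
  simp

theorem hasSum_constTerm (a : ℂ) (i j : ℕ) (τ : ℍ) :
    HasSum (fun m => (2 * Real.pi * Complex.I) ^ j * ((if m = 0 then a else 0) +
      ∑ l ∈ Finset.range j, 1 / ((j - l).factorial : ℂ) * coreSeriesCoeff i l m) * expi τ ^ m)
      ((2 * Real.pi * Complex.I) ^ j * (a +
        ∑ l ∈ Finset.range j, 1 / ((j - l).factorial : ℂ) * coreSeries i l τ)) := by
  have h := ((hasSum_const_mul_pow a (expi τ)).add (hasSum_sum fun l (_ : l ∈ Finset.range j) =>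
    (hasSum_coreSeries i l τ).mul_left (1 / ((j - l).factorial : ℂ)))).mul_left
      ((2 * Real.pi * Complex.I) ^ j)
  refine h.congr_fun fun m => ?_
  rw [mul_assoc, add_mul, Finset.sum_mul]
  congr 2
  refine Finset.sum_congr rfl fun l _ => ?_
  ring

theorem HasSum.qExpansion {f : ℍ → ℂ} {c : ℕ → ℂ}
    (h : ∀ τ : ℍ, HasSum (fun m => c m * expi τ ^ m) (f τ)) (τ : ℍ) :
    HasSum (fun m => (UpperHalfPlane.qExpansion 1 f).coeff m * expi τ ^ m) (f τ) := by
  simp_rw [qExpansion_coeff_eq h]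
  exact h τ

theorem depthOneA_zero (j : ℕ) (τ : ℍ) : depthOneA 0 (j + 1) τ =
    (2 * Real.pi * Complex.I) ^ (j + 1) / ((j + 1).factorial : ℂ) :=
  (isRegularizedValue_zero j τ).ellipticA_eq

theorem exists_depthOneA : ∃ a : ℕ → ℂ,
    (∀ (i j : ℕ) (τ : ℍ), IsRegularizedValue ((i + 1) :: List.replicate j 0) τ
      (depthOneA (i + 1) (j + 1) τ)) ∧
    (∀ (i j : ℕ) (τ : ℍ), depthOneA (i + 1) (j + 1) τ = (2 * Real.pi * Complex.I) ^ j *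
      (constTerm a i j + ∑ l ∈ Finset.range j, 1 / ((j - l).factorial : ℂ) * coreSeries i l τ)) := by
  obtain ⟨a, ha⟩ := exists_isRegularizedValue
  have h : ∀ (i j : ℕ) (τ : ℍ), depthOneA (i + 1) (j + 1) τ = (2 * Real.pi * Complex.I) ^ j *
      (constTerm a i j + ∑ l ∈ Finset.range j, 1 / ((j - l).factorial : ℂ) * coreSeries i l τ) :=
    fun i j τ => (ha i j τ).ellipticA_eq
  refine ⟨a, fun i j τ => ?_, h⟩
  rw [h]
  exact ha i j τ

theorem depthOneA_spec (n j : ℕ) (τ : ℍ) :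
    IsRegularizedValue (n :: List.replicate j 0) τ (depthOneA n (j + 1) τ) ∧
      HasSum (fun m => (qExpansion 1 (depthOneA n (j + 1))).coeff m * expi τ ^ m)
        (depthOneA n (j + 1) τ) := by
  cases n with
  | zero =>
    refine ⟨?_, HasSum.qExpansion (c := fun m => if m = 0 then
      (2 * Real.pi * Complex.I) ^ (j + 1) / ((j + 1).factorial : ℂ) else 0) (fun τ => ?_) τ⟩
    · rw [depthOneA_zero]
      exact isRegularizedValue_zero j τ
    · rw [depthOneA_zero]
      exact hasSum_const_mul_pow _ _
  | succ i =>
    obtain ⟨a, h1, h2⟩ := exists_depthOneA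
    exact ⟨h1 i j τ, HasSum.qExpansion
      (fun τ => (h2 i j τ).symm ▸ hasSum_constTerm (constTerm a i j) i j τ) τ⟩

theorem depthOneAInf_eq {a : ℕ → ℂ} (h : ∀ (i j : ℕ) (τ : ℍ), depthOneA (i + 1) (j + 1) τ =
      (2 * Real.pi * Complex.I) ^ j * (constTerm a i j +
        ∑ l ∈ Finset.range j, 1 / ((j - l).factorial : ℂ) * coreSeries i l τ)) (i j : ℕ) :
    depthOneAInf (i + 1) (j + 1) = (2 * Real.pi * Complex.I) ^ j * constTerm a i j := by
  rw [depthOneAInf, qExpansion_coeff_eq (fun τ => by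
    rw [h]
    exact hasSum_constTerm (constTerm a i j) i j τ)]
  simp [coreSeriesCoeff_zero]

/-! ### The Dedekind eta function -/

/-- In weight 2 the primitive of ∑ σ_1(n) q^n, summed over one index first, is the logarithm of ∏(1
- q^n) up to a factor, and B_2 = 1/6 supplies πiτ/12. -/
theorem coreCoeff_zero_zero (τ : ℍ) : coreCoeff 0 0 τ = 2 * logEta τ := by
  have hq := norm_expi_lt_one τ
  have hL := hasSum_lambert 0 0 τ
  have hfib : ∀ k : ℕ, HasSum (fun m : ℕ => ((k : ℂ) + 1) ^ 0 /
      (2 * Real.pi * Complex.I * ((m : ℂ) + 1)) ^ (0 + 1) * expi τ ^ ((k + 1) * (m + 1)))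
      (-(2 * Real.pi * Complex.I)⁻¹ * Complex.log (1 - expi τ ^ (k + 1))) := by
    intro k
    have hk : ‖expi τ ^ (k + 1)‖ < 1 := by
      rw [norm_pow]; exact pow_lt_one₀ (norm_nonneg _) hq (by omega)
    have h1 := (hasSum_nat_add_iff' 1).mpr (Complex.hasSum_taylorSeries_neg_log hk)
    simp only [Finset.sum_range_one, Nat.cast_zero, div_zero, sub_zero] at h1
    have h2 := h1.mul_left (2 * Real.pi * Complex.I)⁻¹
    rw [mul_neg, ← neg_mul] at h2
    refine h2.congr_fun fun m => ?_
    rw [pow_zero, zero_add, pow_one, pow_mul, one_div, mul_inv]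
    push_cast
    ring
  have h3 := (hL.prod_fiberwise hfib).tsum_eq
  rw [tsum_mul_left] at h3
  have hb : (bernoulli 2 : ℂ) = 1 / 6 := by
    rw [bernoulli_two]; norm_num
  rw [coreCoeff, logEta, ← h3, parity_even (by decide), eisConst]
  have h4 := Complex.two_pi_I_ne_zero
  have h5 : (Complex.I : ℂ) ≠ 0 := Complex.I_ne_zero
  have h6 : (Real.pi : ℂ) ≠ 0 := by exact_mod_cast Real.pi_ne_zero
  change _ = 2 * (Real.pi * Complex.I * (τ : ℂ) / 12 +
    ∑' n : ℕ, Complex.log (1 - expi τ ^ (n + 1)))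
  generalize ∑' n : ℕ, Complex.log (1 - expi τ ^ (n + 1)) = S
  simp only [zero_add, hb, Nat.factorial_zero, Nat.factorial_one, Nat.cast_one,
    Nat.cast_ofNat, pow_one]
  field_simp
  ring

/-! ### The identity for the trivial element -/

/-- The powers of τ created by translating A^∞ cancel those in the Eisenstein integrals: both are
multiples of B_{i+l+2}. The index i + l + 1 is positive, so the unevaluated sequence `a` does not
enter. -/
theorem constTerm_succ_eq (a : ℕ → ℂ) (i j l : ℕ) (h : l < j) (τ : ℂ) :
    (-τ) ^ (l + 1) * ((i + (l + 1)).choose (l + 1) : ℂ) * constTerm a (i + (l + 1)) (j - (l + 1)) +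
      1 / ((j - l).factorial : ℂ) * ((-1) ^ (i + 1) * (4 * Real.pi * Complex.I) /
        (i.factorial : ℂ) * (eisConst (i + l + 2) * τ ^ (l + 1) / ((l + 1).factorial : ℂ))) = 0 := by
  have hch : ((i + (l + 1)).choose (l + 1) : ℂ) =
      ((i + l + 1).factorial : ℂ) / ((i.factorial : ℂ) * ((l + 1).factorial : ℂ)) := by
    rw [Nat.add_choose, Nat.cast_div (Nat.factorial_mul_factorial_dvd_factorial_add _ _)]
    · push_cast
      rfl
    · exact_mod_cast mul_ne_zero i.factorial_ne_zero (l + 1).factorial_ne_zero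
  rw [constTerm, if_neg (by omega), zero_add, hch, show j - (l + 1) + 1 = j - l by omega,
    show i + (l + 1) + 1 = i + l + 2 by omega, eisConst, Nat.factorial_succ (i + l + 1), neg_pow]
  have h1 : ((j - l).factorial : ℂ) ≠ 0 := by exact_mod_cast Nat.factorial_ne_zero _
  have h2 : ((i + l + 1).factorial : ℂ) ≠ 0 := by exact_mod_cast Nat.factorial_ne_zero _
  have h3 : (i.factorial : ℂ) ≠ 0 := by exact_mod_cast Nat.factorial_ne_zero _
  have h4 : ((l + 1).factorial : ℂ) ≠ 0 := by exact_mod_cast Nat.factorial_ne_zero _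
  have h5 : (i : ℂ) + l + 2 ≠ 0 := by
    exact_mod_cast (show i + l + 2 ≠ 0 by omega)
  -- For even i + l the signs cancel; for odd i + l the Bernoulli number vanishes.
  have key : ((-1 : ℂ) ^ (l + 1) + (-1) ^ i) * (bernoulli (i + l + 2) : ℂ) = 0 := by
    rcases Nat.even_or_odd (i + l + 2) with he | ho
    · have : (-1 : ℂ) ^ i = (-1) ^ l := by
        have he' : Even (i + l) := by simpa [Nat.even_add_one, parity_simps] using he
        have e1 : (-1 : ℂ) ^ i * (-1) ^ l = 1 := by rw [← pow_add, he'.neg_one_pow]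
        have e2 : (-1 : ℂ) ^ l * (-1) ^ l = 1 := by rw [← mul_pow]; norm_num
        linear_combination (-1 : ℂ) ^ l * e1 - (-1 : ℂ) ^ i * e2
      rw [this, pow_succ]
      ring
    · have h0 : bernoulli (i + l + 2) = 0 := by
        rw [bernoulli_eq_zero_of_odd ho (by rcases ho with ⟨k, hk⟩; omega)]
      rw [h0]
      simp
  have e6 : (((i + l + 1 + 1) * (i + l + 1).factorial : ℕ) : ℂ) =
      ((i : ℂ) + l + 2) * ((i + l + 1).factorial : ℂ) := by push_cast; ring
  have e7 : ((i + l + 2 : ℕ) : ℂ) = (i : ℂ) + l + 2 := by push_cast; rfl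
  rw [e6, e7, pow_succ (-1 : ℂ) i]
  have e8 : 2 * Real.pi * Complex.I * τ ^ (l + 1) / ((i.factorial : ℂ) * ((l + 1).factorial : ℂ) *
      ((j - l).factorial : ℂ) * ((i : ℂ) + l + 2)) *
      (((-1 : ℂ) ^ (l + 1) + (-1) ^ i) * (bernoulli (i + l + 2) : ℂ)) = 0 := by rw [key, mul_zero]
  refine Eq.trans ?_ e8
  generalize ((i : ℂ) + l + 2) = N at *
  field_simp
  ring

theorem constTerm_add_sum (a : ℕ → ℂ) (i j : ℕ) (τ : ℂ) :
    constTerm a i j + ∑ l ∈ Finset.range j, 1 / ((j - l).factorial : ℂ) * coreSeries i l τ =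
      ∑ k ∈ Finset.range (j + 1), (-τ) ^ k * ((i + k).choose k : ℂ) * constTerm a (i + k) (j - k) +
        ∑ l ∈ Finset.range j, 1 / ((j - l).factorial : ℂ) * coreCoeff i l τ := by
  have h1 : ∀ l, coreCoeff i l τ = (-1) ^ (i + 1) * (4 * Real.pi * Complex.I) /
      (i.factorial : ℂ) * (eisConst (i + l + 2) * τ ^ (l + 1) / ((l + 1).factorial : ℂ)) +
      coreSeries i l τ := fun l => by rw [coreCoeff, coreSeries]; ring
  have h2 := Finset.sum_congr rfl fun l (hl : l ∈ Finset.range j) =>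
    constTerm_succ_eq a i j l (Finset.mem_range.mp hl) τ
  rw [Finset.sum_const_zero, Finset.sum_add_distrib] at h2
  simp_rw [h1, mul_add, Finset.sum_add_distrib]
  rw [Finset.sum_range_succ']
  simp only [pow_zero, add_zero, Nat.choose_zero_right, Nat.cast_one, one_mul, Nat.sub_zero]
  linear_combination -h2

theorem coeff_expYSubOne_mul (K : MvPowerSeries (Fin 2) ℂ) (i j : ℕ) :
    MvPowerSeries.coeff (bideg i j) (expYSubOne * K) = ∑ l ∈ Finset.range j,
      1 / ((j - l).factorial : ℂ) * MvPowerSeries.coeff (bideg i l) K := by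
  have hc : ∀ p r, MvPowerSeries.coeff (bideg p r) expYSubOne =
      if p = 0 ∧ r ≠ 0 then 1 / (r.factorial : ℂ) else 0 := by
    intro p r
    have h0 : bideg p r = 0 ↔ p = 0 ∧ r = 0 := by
      have : (0 : Fin 2 →₀ ℕ) = bideg 0 0 := by simp [bideg]
      rw [this, bideg_inj]
    rw [expYSubOne, map_sub, coeff_series, MvPowerSeries.coeff_one, if_congr h0 rfl rfl]
    rcases eq_or_ne p 0 with rfl | hp
    · rcases eq_or_ne r 0 with rfl | hr
      · simp
      · simp [hr]
    · simp [hp]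
  rw [MvPowerSeries.coeff_mul]
  symm
  refine Finset.sum_of_injOn (fun l => (bideg 0 (j - l), bideg i l)) ?_ ?_ ?_ ?_
  · intro l _ l' _ h
    exact (bideg_inj.mp (Prod.ext_iff.mp h).2).2
  · intro l hl
    have := Finset.mem_range.mp (Finset.mem_coe.mp hl)
    rw [Finset.mem_coe, Finset.HasAntidiagonal.mem_antidiagonal]
    ext t
    fin_cases t
    · simp
    · simp; omega
  · rintro ⟨d, e⟩ hde hnot
    rw [Finset.HasAntidiagonal.mem_antidiagonal] at hde
    have e0 := DFunLike.congr_fun hde 0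
    have e1 := DFunLike.congr_fun hde 1
    simp only [Finsupp.add_apply, bideg_zero, bideg_one] at e0 e1
    rw [← bideg_eta d, hc, if_neg, zero_mul]
    rintro ⟨h0, h1⟩
    apply hnot
    refine ⟨e 1, by simp; omega, ?_⟩
    have a1 : j - e 1 = d 1 := by omega
    have a2 : i = e 0 := by omega
    simp only [a1, a2, Prod.mk.injEq]
    rw [bideg_eta]
    refine ⟨?_, rfl⟩
    rw [← h0, bideg_eta]
  · intro l hl
    have := Finset.mem_range.mp hl
    simp only [hc]
    rw [if_pos ⟨trivial, by omega⟩]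

theorem genA_eq_polarPart_add (τ : ℍ) : genA τ = polarPart +
    HahnSeries.ofPowerSeries ℤ (PowerSeries ℂ) (PowerSeries.mk fun i => PowerSeries.mk fun j =>
      depthOneA (i + 1) (j + 1) τ / (2 * Real.pi * Complex.I) ^ j) := by
  have h1 : (PowerSeries.mk fun n => PowerSeries.mk fun j =>
        depthOneA n (j + 1) τ / (2 * Real.pi * Complex.I) ^ j : PowerSeries (PowerSeries ℂ)) =
      PowerSeries.C (PowerSeries.mk fun j => 2 * Real.pi * Complex.I / ((j + 1).factorial : ℂ)) +
      PowerSeries.X * PowerSeries.mk fun i => PowerSeries.mk fun j =>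
        depthOneA (i + 1) (j + 1) τ / (2 * Real.pi * Complex.I) ^ j := by
    ext n j
    cases n with
    | zero =>
      have h2 := pow_ne_zero j Complex.two_pi_I_ne_zero
      simp only [PowerSeries.coeff_mk, map_add, PowerSeries.coeff_zero_eq_constantCoeff,
        PowerSeries.constantCoeff_C, PowerSeries.coeff_zero_X_mul, add_zero]
      rw [depthOneA_zero, pow_succ]
      field_simp
    | succ n =>
      simp [PowerSeries.coeff_succ_X_mul]
  rw [genA, h1, map_add, mul_add, map_mul, HahnSeries.ofPowerSeries_C, HahnSeries.ofPowerSeries_X,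
    ← mul_assoc, HahnSeries.single_mul_single, HahnSeries.C_apply, HahnSeries.single_mul_single,
    polarPart]
  simp

/-- This is the theorem for trivial γ: all three nonpolar terms are matched coefficientwise through
`constTerm_add_sum`. -/
theorem genA_eq (τ : ℍ) : genA τ = polarPart + toLaurent
    (expOp (shiftOp (-(τ : ℂ))) genAInfReg + 2 * expYSubOne * MvPowerSeries.C (logEta τ) +
      expYSubOne * dropConst (genE τ)) := by
  obtain ⟨a, -, h⟩ := exists_depthOneA
  rw [genA_eq_polarPart_add, toLaurent]
  congr 2
  ext i j
  rw [PowerSeries.coeff_mk, PowerSeries.coeff_mk, PowerSeries.coeff_mk, PowerSeries.coeff_mk, h]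
  have hw := Complex.two_pi_I_ne_zero
  have h1 : 2 * expYSubOne * MvPowerSeries.C (logEta τ) =
      expYSubOne * MvPowerSeries.C (2 * logEta τ) := by
    rw [map_mul, map_ofNat]
    ring
  -- The term 2 log η fills the gap left at bidegree (0, 0) in ℰ*, so `coreCoeff` describes all
  -- coefficients uniformly.
  have h2 : ∀ i l, MvPowerSeries.coeff (bideg i l) (MvPowerSeries.C (2 * logEta τ) +
      dropConst (genE τ)) = coreCoeff i l τ := by
    intro i l
    rw [map_add, coeff_dropConst, MvPowerSeries.coeff_C]
    have h0 : bideg i l = 0 ↔ i + l = 0 := by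
      have : (0 : Fin 2 →₀ ℕ) = bideg 0 0 := by simp [bideg]
      rw [this, bideg_inj]
      omega
    rw [if_congr h0 rfl rfl]
    split_ifs with hil
    · obtain ⟨rfl, rfl⟩ : i = 0 ∧ l = 0 := by omega
      rw [coreCoeff_zero_zero, add_zero]
    · rw [coeff_genE (by omega), zero_add]
  have h3 := constTerm_add_sum a i j τ
  rw [← bideg, h1, add_assoc, ← mul_add, map_add, coeff_expOp_shiftOp, coeff_expYSubOne_mul,
    mul_div_cancel_left₀ _ (pow_ne_zero _ hw), h3]
  simp_rw [h2]
  congr 1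
  refine Finset.sum_congr rfl fun k _ => ?_
  rw [genAInfReg, coeff_series, depthOneAInf_eq h, mul_div_cancel_left₀ _ (pow_ne_zero _ hw)]

end EllipticMZV

end

/-! ### Modular behaviour of the depth one A-elliptic multiple zeta values -/

theorem mainTheorem6 :
    (∀ n r : ℕ, 1 ≤ r → ∀ τ : UpperHalfPlane,
      EllipticMZV.IsRegularizedValue (n :: List.replicate (r - 1) 0) τ
        (EllipticMZV.depthOneA n r τ) ∧
      HasSum (fun j : ℕ => (UpperHalfPlane.qExpansion 1 (EllipticMZV.depthOneA n r)).coeff j *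
          Complex.exp (2 * Real.pi * Complex.I * (τ : ℂ)) ^ j)
        (EllipticMZV.depthOneA n r τ)) ∧
    (∀ (γ : Matrix.SpecialLinearGroup (Fin 2) ℤ) (m : ℕ), 4 ≤ m → ∀ τ : UpperHalfPlane,
      EllipticMZV.eisInt m τ =
        EllipticMZV.eisCocycle m γ + EllipticMZV.polyAct γ (EllipticMZV.eisInt m (γ • τ))) ∧
    ∀ (γ : Matrix.SpecialLinearGroup (Fin 2) ℤ) (τ : UpperHalfPlane),
      EllipticMZV.genA (γ • τ) =
        EllipticMZV.polarPart +
        EllipticMZV.toLaurent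
          (EllipticMZV.expOp (EllipticMZV.shiftOp (-((γ • τ : UpperHalfPlane) : ℂ)))
              EllipticMZV.genAInfReg +
            2 * EllipticMZV.expYSubOne * MvPowerSeries.C (EllipticMZV.logEta (γ • τ)) +
            EllipticMZV.expYSubOne *
              EllipticMZV.expOp (EllipticMZV.shiftOp (-((γ • τ : UpperHalfPlane) : ℂ)))
                (EllipticMZV.linSubst (γ 1 1) (γ 0 1) (γ 1 0) (γ 0 0)
                  (EllipticMZV.expOp (EllipticMZV.shiftOp (τ : ℂ))
                    (EllipticMZV.dropConst (EllipticMZV.genE τ)))) -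
            2 * EllipticMZV.expYSubOne *
              EllipticMZV.expOp (EllipticMZV.shiftOp (-((γ • τ : UpperHalfPlane) : ℂ)))
                (EllipticMZV.linSubst (γ 1 1) (γ 0 1) (γ 1 0) (γ 0 0)
                  (EllipticMZV.laplace
                    (EllipticMZV.linSubst (1 / (2 * Real.pi * Complex.I)) 0
                      0 (-1 / (2 * Real.pi * Complex.I))
                      (EllipticMZV.periodSeries γ))))) := by
  refine ⟨fun n r hr τ => ?_, fun γ m hm τ => EllipticMZV.eisInt_eq_cocycle_add γ hm τ,
    fun γ τ => ?_⟩
  · obtain ⟨j, rfl⟩ := Nat.exists_eq_add_of_le' hr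
    exact EllipticMZV.depthOneA_spec n j τ
  -- The case of trivial γ is applied at γτ, and only ℰ*(γτ) is then rewritten in terms of τ.
  · rw [EllipticMZV.genA_eq, EllipticMZV.dropConst_genE_smul γ τ EllipticMZV.expOp_dropConst_genE
      fun m hm => EllipticMZV.eisInt_eq_cocycle_add γ hm τ]
    congr 2
    ring
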